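/- Let $\gamma>0$, and for small $\epsilon>0$ let $A=A(\epsilon)>0$ be a driving amplitude with $A=\mathcal O(1)$ as $\epsilon\to0^+$ (for instance a positive constant). Consider real solutions $\phi=(\phi_n)_{n\ge1}$ of the static equation $$-\phi_n+\epsilon\left(\phi_{n+1}+\phi_{n-1}+\gamma\phi_n^3\right)=0,\quad n=1,2,\dots,\qquad \phi_0=A.$$ A family of such solutions, given for all small $\epsilon>0$, is called a rapidly decaying discrete soliton with leading order $\vartheta(\epsilon)$ if, for small $\epsilon>0$, $|\phi_n|$ decreases monotonically to $0$ in $n\ge1$, and if, as $\epsilon\to0^+$, $\phi_1=\vartheta(\epsilon)(1+o(1))$ while $\phi_n=o(\vartheta(\epsilon))$ for every fixed $n\ge2$. Let $\Phi_1,\Phi_2,\Phi_3$ be the rapidly decaying discrete solitons with leading order $\frac1{\sqrt{\epsilon\gamma}}$, $\epsilon A$ and $-\frac1{\sqrt{\epsilon\gamma}}$, respectively. For $\phi=\Phi_j$ consider the linearized eigenvalue problem, for $(v_n)_{n\ge1},(w_n)_{n\ge1}\in\ell^2(\mathbb C)$ and $v_0=w_0=0$, $$\lambda\epsilon\begin{pmatrix}v_n\\w_n\end{pmatrix}=\epsilon\sigma\begin{pmatrix}v_{n-1}\\w_{n-1}\end{pmatrix}+\begin{pmatrix}-1+2\epsilon\gamma\phi_n^2&\epsilon\gamma\phi_n^2\\-\epsilon\gamma\phi_n^2&1-2\epsilon\gamma\phi_n^2\end{pmatrix}\begin{pmatrix}v_n\\w_n\end{pmatrix}+\epsilon\sigma\begin{pmatrix}v_{n+1}\\w_{n+1}\end{pmatrix},\qquad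 \sigma=\begin{pmatrix}1&0\\0&-1\end{pmatrix}.$$ An eigenvalue is a $\lambda\in\mathbb C$ for which there is a non-zero solution in $\ell^2$; $\phi$ is called stable if the spectrum of the bounded operator on $\ell^2\times\ell^2$ given by $\epsilon^{-1}$ times the right-hand side is contained in $\mathbb R$, and unstable otherwise. Such solitons $\Phi_1,\Phi_2,\Phi_3$ exist, and any such solitons have the following properties for all sufficiently small $\epsilon>0$. 1. $\Phi_1$ is unstable. Up to sign it has a single eigenvalue, which is purely imaginary: the set of eigenvalues is $\{i\mu,-i\mu\}$ with $\mu>0$, both eigenvalues are algebraically simple, and $\mu=\epsilon^{-1/4}\sqrt{2A\sqrt\gamma}+\mathcal O(\epsilon^{1/4})$ as $\epsilon\to0^+$. 2. $\Phi_2$ is stable and has no eigenvalues. 3. $\Phi_3$ is stable. Up to sign it has a single eigenvalue, which is real: the set of eigenvalues is $\{\mu,-\mu\}$ with $\mu>0$, both eigenvalues are algebraically simple, and $\mu=\epsilon^{-1/4}\sqrt{2A\sqrt\gamma}+\mathcal O(\epsilon^{1/4})$ as $\epsilon\to0^+$. -/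

import Mathlib

open Filter Topology Asymptotics

noncomputable section

namespace BoundaryDrivenDNLS

/-! ## Static solutions and rapidly decaying discrete solitons -/

/-- `φ` solves the static equation
`-φ n + ε (φ (n+1) + φ (n-1) + γ (φ n)^3) = 0`, `n = 1, 2, …`, with boundary value `φ 0 = A`. -/
def IsStaticSolution (γ ε A : ℝ) (φ : ℕ → ℝ) : Prop :=
  φ 0 = A ∧
    ∀ n : ℕ, 1 ≤ n → -φ n + ε * (φ (n + 1) + φ (n - 1) + γ * φ n ^ 3) = 0

/-- A family `ε ↦ φ ε` of rapidly decaying discrete solitons, with driving amplitude `A ε` and with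
leading order `ϑ ε` at the first site (so `ϑ` is the first gauge function times the non-zero
leading coefficient): for small `ε > 0` the sequence `φ ε` is a static solution whose modulus
decreases monotonically to `0` along the sites `n = 1, 2, …`; as `ε → 0+` only the first site
is non-zero to leading order. -/
structure IsRapidlyDecayingSoliton (γ : ℝ) (A ϑ : ℝ → ℝ) (φ : ℝ → ℕ → ℝ) : Prop where
  static : ∀ᶠ ε in 𝓝[>] (0 : ℝ), IsStaticSolution γ ε (A ε) (φ ε)
  decreasing : ∀ᶠ ε in 𝓝[>] (0 : ℝ), AntitoneOn (fun n : ℕ => |φ ε n|) (Set.Ici 1)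
  tendsto_zero : ∀ᶠ ε in 𝓝[>] (0 : ℝ), Tendsto (fun n : ℕ => |φ ε n|) atTop (𝓝 0)
  first_site : (fun ε => φ ε 1) ~[𝓝[>] (0 : ℝ)] ϑ
  other_sites : ∀ n : ℕ, 2 ≤ n → (fun ε => φ ε n) =o[𝓝[>] (0 : ℝ)] ϑ

/-- The soliton `Φ₁`, with `Φ₁(1) = 1 / √(ε γ) + …`. -/
def IsPhi1 (γ : ℝ) (A : ℝ → ℝ) (φ : ℝ → ℕ → ℝ) : Prop :=
  IsRapidlyDecayingSoliton γ A (fun ε => 1 / √(ε * γ)) φ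

/-- The soliton `Φ₂`, with `Φ₂(1) = ε A + …`. -/
def IsPhi2 (γ : ℝ) (A : ℝ → ℝ) (φ : ℝ → ℕ → ℝ) : Prop :=
  IsRapidlyDecayingSoliton γ A (fun ε => ε * A ε) φ

/-- The soliton `Φ₃`, with `Φ₃(1) = -1 / √(ε γ) + …`. -/
def IsPhi3 (γ : ℝ) (A : ℝ → ℝ) (φ : ℝ → ℕ → ℝ) : Prop :=
  IsRapidlyDecayingSoliton γ A (fun ε => -(1 / √(ε * γ))) φ

/-! ## The linearized operator on `ℓ²` -/

/-- Square-summable complex sequences; the coordinate `k : ℕ` is the value at the site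
`n = k + 1`. -/
abbrev EllTwo : Type := lp (fun _ : ℕ => ℂ) 2

lemma memEllTwo_iff (u : ℕ → ℂ) :
    Memℓp u 2 ↔ Summable (fun k => ‖u k‖ ^ 2) := by
  rw [memℓp_gen_iff (by norm_num)]
  simp

lemma summable_sq (u : EllTwo) : Summable (fun k => ‖u k‖ ^ 2) :=
  (memEllTwo_iff _).1 (lp.memℓp u)

lemma norm_sq_eq (u : EllTwo) : ‖u‖ ^ 2 = ∑' k, ‖u k‖ ^ 2 := by
  have h := lp.norm_rpow_eq_tsum (p := 2) (by norm_num) u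
  simpa using h

lemma norm_le_of_tsum_sq_le (u : EllTwo) {C : ℝ} (hC : 0 ≤ C)
    (h : ∑' k, ‖u k‖ ^ 2 ≤ C ^ 2) : ‖u‖ ≤ C := by
  rw [← norm_sq_eq] at h
  exact (sq_le_sq₀ (norm_nonneg _) hC).1 h

/-- The sequence `n ↦ u (n+1)`. -/
def nextSite : EllTwo →L[ℂ] EllTwo :=
  LinearMap.mkContinuous
    { toFun := fun u =>
        ⟨fun k => u (k + 1), (memEllTwo_iff _).2 ((summable_nat_add_iff 1).2 (summable_sq u))⟩
      map_add' := fun u v => by ext k; rfl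
      map_smul' := fun c u => by ext k; rfl } 1 (by
    intro u
    refine norm_le_of_tsum_sq_le _ (by positivity) ?_
    rw [one_mul, norm_sq_eq, (summable_sq u).tsum_eq_zero_add]
    exact le_add_of_nonneg_left (by positivity))

/-- The sequence `n ↦ u (n-1)`, with the boundary value `0` at the site `0`. -/
def prevSite : EllTwo →L[ℂ] EllTwo :=
  LinearMap.mkContinuous
    { toFun := fun u =>
        ⟨fun k => if k = 0 then 0 else u (k - 1), (memEllTwo_iff _).2
          ((summable_nat_add_iff 1).1 (by simpa using summable_sq u))⟩
      map_add' := fun u v => by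
        ext k
        change (if k = 0 then 0 else u (k - 1) + v (k - 1) : ℂ) =
          (if k = 0 then 0 else u (k - 1)) + (if k = 0 then 0 else v (k - 1))
        by_cases hk : k = 0 <;> simp [hk]
      map_smul' := fun c u => by
        ext k
        by_cases hk : k = 0 <;> simp [hk] } 1 (by
    intro u
    refine norm_le_of_tsum_sq_le _ (by positivity) ?_
    rw [one_mul, norm_sq_eq]
    have hs : Summable (fun k : ℕ => ‖(if k = 0 then 0 else u (k - 1) : ℂ)‖ ^ 2) :=
      (summable_nat_add_iff 1).1 (by simpa using summable_sq u)
    change ∑' k : ℕ, ‖(if k = 0 then 0 else u (k - 1) : ℂ)‖ ^ 2 ≤ _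
    rw [hs.tsum_eq_zero_add]
    simp)

open Classical in
/-- Multiplication by a bounded real sequence `a` (which is the only case of interest; the operator
is set to `0` if `a` is unbounded). -/
def mulOp (a : ℕ → ℝ) : EllTwo →L[ℂ] EllTwo :=
  if h : ∃ C : ℝ, 0 ≤ C ∧ ∀ k, |a k| ≤ C then
    LinearMap.mkContinuous
      { toFun := fun u =>
          ⟨fun k => (a k : ℂ) * u k, (memEllTwo_iff _).2 (by
            refine Summable.of_nonneg_of_le (fun k => by positivity) (fun k => ?_)
              ((summable_sq u).mul_left (h.choose ^ 2))
            rw [norm_mul, mul_pow, Complex.norm_real, Real.norm_eq_abs]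
            gcongr
            exact h.choose_spec.2 k)⟩
        map_add' := fun u v => by
          ext k
          exact mul_add (a k : ℂ) (u k) (v k)
        map_smul' := fun c u => by
          ext k
          simp [mul_left_comm] } h.choose (by
      intro u
      refine norm_le_of_tsum_sq_le _ (mul_nonneg h.choose_spec.1 (norm_nonneg _)) ?_
      have hle : ∀ k, ‖(a k : ℂ) * u k‖ ^ 2 ≤ h.choose ^ 2 * ‖u k‖ ^ 2 := by
        intro k
        rw [norm_mul, mul_pow, Complex.norm_real, Real.norm_eq_abs]
        gcongr
        exact h.choose_spec.2 k
      have hs := (summable_sq u).mul_left (h.choose ^ 2)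
      rw [mul_pow, norm_sq_eq, ← tsum_mul_left]
      exact Summable.tsum_le_tsum hle
        (Summable.of_nonneg_of_le (fun k => by positivity) hle hs) hs)
  else 0

@[simp] lemma nextSite_apply (u : EllTwo) (k : ℕ) : nextSite u k = u (k + 1) := rfl

@[simp] lemma prevSite_apply_zero (u : EllTwo) : prevSite u 0 = 0 := rfl

@[simp] lemma prevSite_apply_succ (u : EllTwo) (k : ℕ) : prevSite u (k + 1) = u k := rfl

lemma mulOp_apply {a : ℕ → ℝ} {C : ℝ} (ha : ∀ k, |a k| ≤ C) (u : EllTwo) (k : ℕ) :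
    mulOp a u k = (a k : ℂ) * u k := by
  have h : ∃ C : ℝ, 0 ≤ C ∧ ∀ k, |a k| ≤ C :=
    ⟨C, (abs_nonneg _).trans (ha 0), ha⟩
  rw [mulOp, dif_pos h]
  rfl

/-- The first diagonal entry `ε (u (n-1) + u (n+1)) + (-1 + 2 ε γ |φ n|²) u n`. -/
def diagOp (γ ε : ℝ) (φ : ℕ → ℝ) : EllTwo →L[ℂ] EllTwo :=
  (ε : ℂ) • (prevSite + nextSite) + mulOp (fun k => -1 + 2 * ε * γ * |φ (k + 1)| ^ 2)

/-- The off-diagonal entry `ε γ (φ n)² u n`. -/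
def offDiagOp (γ ε : ℝ) (φ : ℕ → ℝ) : EllTwo →L[ℂ] EllTwo :=
  mulOp (fun k => ε * γ * φ (k + 1) ^ 2)

/-- The linearized operator on pairs `(v, w)` of `ℓ²` sequences: the right-hand side of
`λ ε (v n, w n) = ε σ (v (n-1), w (n-1)) + 𝓛 (v n, w n) + ε σ (v (n+1), w (n+1))`,
where `v 0 = w 0 = 0`, `σ = diag (1, -1)`, and `𝓛` is the matrix with rows
`(-1 + 2 ε γ |φ n|², ε γ (φ n)²)` and `(-ε γ (φ n)², 1 - 2 ε γ |φ n|²)`. -/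
def rhsOp (γ ε : ℝ) (φ : ℕ → ℝ) : (EllTwo × EllTwo) →L[ℂ] (EllTwo × EllTwo) :=
  ContinuousLinearMap.prod
    (diagOp γ ε φ ∘L ContinuousLinearMap.fst ℂ EllTwo EllTwo +
      offDiagOp γ ε φ ∘L ContinuousLinearMap.snd ℂ EllTwo EllTwo)
    (-(offDiagOp γ ε φ ∘L ContinuousLinearMap.fst ℂ EllTwo EllTwo) -
      diagOp γ ε φ ∘L ContinuousLinearMap.snd ℂ EllTwo EllTwo)

lemma rhsOp_apply {γ ε : ℝ} {φ : ℕ → ℝ} {C : ℝ} (hφ : ∀ n, |φ (n + 1)| ≤ C)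
    (v w : EllTwo) (k : ℕ) :
    (rhsOp γ ε φ (v, w)).1 k =
        (ε : ℂ) * (prevSite v k + v (k + 1)) +
          ((-1 + 2 * ε * γ * |φ (k + 1)| ^ 2 : ℝ) : ℂ) * v k +
          ((ε * γ * φ (k + 1) ^ 2 : ℝ) : ℂ) * w k ∧
      (rhsOp γ ε φ (v, w)).2 k =
        -(ε : ℂ) * (prevSite w k + w (k + 1)) -
          ((ε * γ * φ (k + 1) ^ 2 : ℝ) : ℂ) * v k +
          ((1 - 2 * ε * γ * |φ (k + 1)| ^ 2 : ℝ) : ℂ) * w k := by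
  have hsq : ∀ n, φ (n + 1) ^ 2 ≤ C ^ 2 := fun n => by
    rw [← sq_abs]
    gcongr
    exact hφ n
  have h1 : ∀ n, |(-1 + 2 * ε * γ * |φ (n + 1)| ^ 2)| ≤ 1 + |2 * ε * γ| * C ^ 2 := fun n => by
    refine (abs_add_le _ _).trans ?_
    rw [abs_neg, abs_one, abs_mul, sq_abs, abs_of_nonneg (sq_nonneg (φ (n + 1)))]
    have := hsq n
    gcongr
  have h2 : ∀ n, |ε * γ * φ (n + 1) ^ 2| ≤ |ε * γ| * C ^ 2 := fun n => by
    rw [abs_mul, abs_of_nonneg (sq_nonneg (φ (n + 1)))]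
    have := hsq n
    gcongr
  have e1 := mulOp_apply h1
  have e2 := mulOp_apply h2
  have d : ∀ u : EllTwo, diagOp γ ε φ u k = (ε : ℂ) * (prevSite u k + u (k + 1)) +
      ((-1 + 2 * ε * γ * |φ (k + 1)| ^ 2 : ℝ) : ℂ) * u k := fun u => by
    rw [← e1 u k]
    rfl
  constructor
  · rw [← e2 w k, ← d v]
    rfl
  · have : (rhsOp γ ε φ (v, w)).2 k = -(offDiagOp γ ε φ v k) - diagOp γ ε φ w k := rfl
    rw [this, d w, offDiagOp, e2 v k]
    push_cast
    ring

/-- The operator whose eigenvalues and spectrum are those of the problem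
`λ ε (v, w) = rhsOp (v, w)`. -/
def linearization (γ ε : ℝ) (φ : ℕ → ℝ) : (EllTwo × EllTwo) →L[ℂ] (EllTwo × EllTwo) :=
  (ε : ℂ)⁻¹ • rhsOp γ ε φ

/-- The set of all eigenvalues, that is of the `λ : ℂ` for which the linearized problem has a
non-zero solution in `ℓ²`, whether or not `λ` lies in the continuous spectrum. -/
def eigenvalues (γ ε : ℝ) (φ : ℕ → ℝ) : Set ℂ :=
  {l | Module.End.HasEigenvalue (linearization γ ε φ).toLinearMap l}

/-- `l` is algebraically simple: its generalized eigenspace is one-dimensional. -/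
def IsSimpleEigenvalue (γ ε : ℝ) (φ : ℕ → ℝ) (l : ℂ) : Prop :=
  Module.finrank ℂ (Module.End.maxGenEigenspace (linearization γ ε φ).toLinearMap l) = 1

/-- Linear (spectral) stability: the whole spectrum lies on the real axis. (Perturbations evolve
like `exp (i λ z)`.) -/
def IsLinearlyStable (γ ε : ℝ) (φ : ℕ → ℝ) : Prop :=
  ∀ l ∈ spectrum ℂ (linearization γ ε φ), l.im = 0

end BoundaryDrivenDNLS

end

noncomputable section

namespace BoundaryDrivenDNLS

/-! ## Sequences and fixed points -/

/-! Multiplying φ by √(εγ) turns the static equation into y_n = ε(y_{n+1} + y_{n-1}) + y_n³. At ε =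
0 the first site may carry σ ∈ {0, 1, -1} while all other sites vanish; a contraction continues
these three configurations to small ε (`exists_profile`).

For the spectrum put z = λε, g_k = εγφ_{k+1}², p = v + w, q = v - w. The eigenvalue problem becomes
L₋q = zp, L₊p = zq, where L₋ = εΔ + g - 1, L₊ = εΔ + 3g - 1 and Δ is the sum of the two neighbours.
For a large soliton, φ normalized to ρ_0 = 1 would lie in the kernel of L₋ but for the driving: L₋ρ
= -ηδ_0 with η = εA/φ_1. Writing q = zr, one finds r ≈ ρ and p_0 ≈ -η. Since L₊ ≈ 2 at the first
site, z² = ζ ≈ -2η. The sign of φ_1 thus decides between real and imaginary eigenvalues, and |φ_1| ≈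
1/√(εγ) gives their size. `exists_realMode` makes this rigorous by a second contraction.

That there are no other eigenvalues rests on `jost_bound`: away from the first site the equations
have constant coefficients up to a small, geometrically decaying potential, and a decaying solution
is controlled by its first value, uniformly in z and even inside the continuous spectrum. For the
large solitons the first site then forces z to be small, and a comparison with the constructed mode
gives proportionality (`mode_eq`). For Φ₂ the potential is weak everywhere and the boundary value is
0, so no mode survives (`IsMode.eq_zero_of_weak`). Algebraic simplicity follows by pairing with the
adjoint eigenvector, because Σ p_k r_k ≈ -η is non-zero (`coeff_eq_zero`).

Stability also needs the rest of the spectrum. With the first-site potential removed, the form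
twisted by diag(1, -1) is negative definite, so every non-real number lies in the resolvent set.
Restoring the potential is a perturbation of rank at most two, so by the Fredholm alternative a
non-real spectral point is an eigenvalue (`mem_eigenvalues_of_mem_spectrum`).

Most vanishing and a priori bounds run through `le_of_bootstrap`: if any upper bound B improves to a
+ B/2, then the supremum is at most 2a. -/

lemma le_of_bootstrap {ι : Type*} {x : ι → ℝ} {a : ℝ} (hx : BddAbove (Set.range x))
    (h : ∀ B, (∀ i, x i ≤ B) → ∀ i, x i ≤ a + B / 2) (i : ι) : x i ≤ 2 * a := by
  have : Nonempty ι := ⟨i⟩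
  have h1 := h (⨆ j, x j) (fun j => le_ciSup hx j)
  have h2 : (⨆ j, x j) ≤ a + (⨆ j, x j) / 2 := ciSup_le h1
  have h3 := le_ciSup hx i
  linarith

/-- A bounded sequence dominated by a small multiple of the sum of its neighbours decays
geometrically. -/
lemma le_two_mul_of_le_neighbours {x : ℕ → ℝ} {θ B : ℝ} (hx : ∀ n, 0 ≤ x n) (hB : ∀ n, x n ≤ B)
    (hθ : 0 ≤ θ) (hθ' : θ ≤ 1 / 4) (h : ∀ n, x (n + 1) ≤ θ * (x n + x (n + 2))) (n : ℕ) :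
    x (n + 1) ≤ 2 * θ * x n := by
  by_contra! hn
  -- One failure of the ratio bound makes the next term more than double. As 2 ≥ 2θ the failure then
  -- persists, and the resulting exponential growth contradicts the bound B.
  have step : ∀ m, 2 * θ * x m < x (m + 1) → 2 * x (m + 1) < x (m + 2) := by
    intro m hm
    have h1 := h m
    have h0 := hx m
    have h2 : 0 < x (m + 1) := lt_of_le_of_lt (by positivity) hm
    have h3 : x (m + 1) < 2 * (θ * x (m + 2)) := by nlinarith
    have h4 : θ * x (m + 2) ≤ 1 / 4 * x (m + 2) :=
      mul_le_mul_of_nonneg_right hθ' (hx _)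
    linarith
  have hpos : 0 < x (n + 1) := lt_of_le_of_lt (mul_nonneg (by positivity) (hx n)) hn
  have key : ∀ k, 2 * θ * x (n + k) < x (n + k + 1) ∧ 2 ^ k * x (n + 1) ≤ x (n + k + 1) := by
    intro k
    induction k with
    | zero => exact ⟨hn, by simp⟩
    | succ k ih =>
      have h1 := step _ ih.1
      have h2 : n + (k + 1) + 1 = n + k + 2 := by ring
      have h3 : n + (k + 1) = n + k + 1 := by ring
      have h4 := hx (n + k + 1)
      rw [h2, h3]
      constructor
      · nlinarith
      · rw [pow_succ]; linarith [ih.2]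
  obtain ⟨k, hk⟩ := pow_unbounded_of_one_lt (B / x (n + 1)) (one_lt_two (α := ℝ))
  rw [div_lt_iff₀ hpos] at hk
  linarith [(key k).2, hB (n + k + 1)]

/-- The decaying solution of `v (n+2) - (κ + κ⁻¹) v (n+1) + v n = f n`, with `|κ| ≤ 1` and a
geometrically decaying source. -/
lemma jost_bound {v f : ℕ → ℂ} {κ : ℂ} {c θ : ℝ} (hv : Tendsto v atTop (𝓝 0))
    (hκ0 : κ ≠ 0) (hκ : ‖κ‖ ≤ 1) (hc : 0 ≤ c) (hθ : 0 ≤ θ) (hθ' : θ ≤ 1 / 2)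
    (hf : ∀ n, ‖f n‖ ≤ c * θ ^ n)
    (h : ∀ n, v (n + 2) - (κ + κ⁻¹) * v (n + 1) + v n = f n) :
    (∀ n, ‖v (n + 1) - κ * v n‖ ≤ 2 * c * θ ^ n) ∧ ∀ n, ‖v n‖ ≤ ‖v 0‖ + 4 * c := by
  -- With S the shift, the recurrence factors as (S - κ⁻¹)(S - κ)v = f. So d solves a first-order
  -- equation that can be summed from infinity. Only ‖κ‖ ≤ 1 is used, so ‖κ‖ = 1 (the continuous
  -- spectrum) is allowed.
  set d : ℕ → ℂ := fun n => v (n + 1) - κ * v n with hd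
  have hrec : ∀ n, d n = κ * (d (n + 1) - f n) := by
    intro n
    simp only [hd]
    rw [← h n]
    field_simp
    ring
  have hstep : ∀ n, ‖d n‖ ≤ ‖d (n + 1)‖ + c * θ ^ n := by
    intro n
    rw [hrec n, norm_mul]
    calc ‖κ‖ * ‖d (n + 1) - f n‖ ≤ 1 * ‖d (n + 1) - f n‖ := by gcongr
      _ ≤ ‖d (n + 1)‖ + ‖f n‖ := by rw [one_mul]; exact norm_sub_le _ _
      _ ≤ _ := by gcongr; exact hf n
  have hsum : ∀ k n, ‖d n‖ ≤ ‖d (n + k)‖ + (2 * c * θ ^ n - 2 * c * θ ^ (n + k)) := by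
    intro k
    induction k with
    | zero => intro n; simp
    | succ k ih =>
      intro n
      have h1 := ih n
      have h2 := hstep (n + k)
      have h3 : 0 ≤ c * θ ^ (n + k) := by positivity
      have h4 : θ ^ (n + (k + 1)) = θ ^ (n + k) * θ := by rw [← add_assoc, pow_succ]
      rw [h4, ← add_assoc]
      nlinarith
  have hd0 : Tendsto (fun k => ‖d k‖) atTop (𝓝 0) := by
    have : Tendsto d atTop (𝓝 (0 - κ * 0)) :=
      ((tendsto_add_atTop_iff_nat 1).2 hv).sub (hv.const_mul κ)
    simpa using this.norm
  have hdn : ∀ n, ‖d n‖ ≤ 2 * c * θ ^ n := by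
    intro n
    have h1 : Tendsto (fun k => ‖d (n + k)‖ + 2 * c * θ ^ n) atTop (𝓝 (0 + 2 * c * θ ^ n)) := by
      refine Tendsto.add_const _ ?_
      simpa [add_comm] using (tendsto_add_atTop_iff_nat n).2 hd0
    rw [zero_add] at h1
    refine ge_of_tendsto' h1 fun k => ?_
    have := hsum k n
    have h3 : 0 ≤ 2 * c * θ ^ (n + k) := by positivity
    linarith
  refine ⟨hdn, ?_⟩
  have hvn : ∀ n, ‖v n‖ ≤ ‖v 0‖ + (4 * c - 4 * c * θ ^ n) := by
    intro n
    induction n with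
    | zero => simp
    | succ n ih =>
      have h1 : ‖v (n + 1)‖ ≤ ‖κ‖ * ‖v n‖ + ‖d n‖ := by
        rw [← norm_mul]
        have : v (n + 1) = κ * v n + d n := by simp [hd]
        rw [this]
        exact norm_add_le _ _
      have h2 : ‖κ‖ * ‖v n‖ ≤ 1 * ‖v n‖ := by gcongr
      have h3 := hdn n
      have h4 : 0 ≤ c * θ ^ n := by positivity
      rw [pow_succ]
      nlinarith
  intro n
  have h4 : 0 ≤ 4 * c * θ ^ n := by positivity
  linarith [hvn n]

/-- The two roots of κ² - Eκ + 1 have product 1, so one of them lies in the closed unit disk. -/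
lemma exists_joukowski (E : ℂ) : ∃ κ : ℂ, κ ≠ 0 ∧ ‖κ‖ ≤ 1 ∧ κ + κ⁻¹ = E := by
  obtain ⟨s, hs⟩ := IsAlgClosed.exists_pow_nat_eq (E ^ 2 - 4) (n := 2) (by norm_num)
  have hk : ((E + s) / 2) * ((E - s) / 2) = 1 := by linear_combination (-1 / 4) * hs
  have hk0 : (E + s) / 2 ≠ 0 := left_ne_zero_of_mul_eq_one hk
  have hinv : ((E + s) / 2)⁻¹ = (E - s) / 2 := inv_eq_of_mul_eq_one_right hk
  rcases le_total ‖(E + s) / 2‖ 1 with h | h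
  · exact ⟨_, hk0, h, by rw [hinv]; ring⟩
  · refine ⟨((E + s) / 2)⁻¹, inv_ne_zero hk0, ?_, by rw [inv_inv, hinv]; ring⟩
    rw [norm_inv]
    exact inv_le_one_of_one_le₀ h

/-- Contraction principle for real families in a weighted supremum norm. -/
lemma exists_fixedPoint_of_weighted_contraction {ι : Type*} (W : ι → ℝ) (R : ℝ)
    (Ψ : (ι → ℝ) → ι → ℝ) (h0 : ∀ i, |Ψ 0 i| ≤ R / 2 * W i)
    (hΨ : ∀ (x y : ι → ℝ) (D : ℝ), (∀ i, |x i| ≤ R * W i) → (∀ i, |y i| ≤ R * W i) →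
      (∀ i, |x i - y i| ≤ D * W i) → ∀ i, |Ψ x i - Ψ y i| ≤ D / 2 * W i) :
    ∃ x : ι → ℝ, (∀ i, |x i| ≤ R * W i) ∧ Ψ x = x := by
  have hRW : ∀ i, 0 ≤ R * W i := fun i => by
    have := (abs_nonneg _).trans (h0 i)
    linarith
  have hinv : ∀ x : ι → ℝ, (∀ i, |x i| ≤ R * W i) → ∀ i, |Ψ x i| ≤ R * W i := by
    intro x hx i
    have h1 := hΨ x 0 R hx (fun i => by simpa using hRW i) (fun i => by simpa using hx i) i
    have h2 := abs_sub_abs_le_abs_sub (Ψ x i) (Ψ 0 i)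
    linarith [h0 i]
  -- Picard iteration from 0. It converges geometrically in each coordinate, so completeness of ℝ
  -- suffices.
  set u : ℕ → ι → ℝ := fun k => Ψ^[k] 0 with hu
  have husucc : ∀ k, u (k + 1) = Ψ (u k) := fun k => Function.iterate_succ_apply' _ _ _
  have hub : ∀ k i, |u k i| ≤ R * W i := by
    intro k
    induction k with
    | zero => intro i; simpa [hu] using hRW i
    | succ k ih => rw [husucc]; exact hinv _ ih
  have hstep : ∀ k i, |u k i - u (k + 1) i| ≤ R / 2 ^ (k + 1) * W i := by
    intro k
    induction k with
    | zero =>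
      intro i
      have h1 : u 0 = 0 := rfl
      rw [husucc, h1]
      simpa using h0 i
    | succ k ih =>
      intro i
      rw [husucc, husucc (k + 1)]
      have := hΨ _ _ _ (hub k) (hub (k + 1)) ih i
      rwa [div_div, ← pow_succ] at this
  have hdist : ∀ i k, dist (u k i) (u (k + 1) i) ≤ R * W i / 2 / 2 ^ k := by
    intro i k
    rw [Real.dist_eq]
    refine (hstep k i).trans (le_of_eq ?_)
    rw [pow_succ]
    field_simp
  have hlim : ∀ i, ∃ l, Tendsto (fun k => u k i) atTop (𝓝 l) := fun i =>
    cauchySeq_tendsto_of_complete (cauchySeq_of_le_geometric_two (hdist i))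
  choose x hx using hlim
  have hxb : ∀ i, |x i| ≤ R * W i := fun i =>
    le_of_tendsto' (hx i).abs fun k => hub k i
  refine ⟨x, hxb, ?_⟩
  have hxu : ∀ k i, |x i - u k i| ≤ R / 2 ^ k * W i := by
    intro k i
    have := dist_le_of_le_geometric_two_of_tendsto (hdist i) (hx i) k
    rw [dist_comm, Real.dist_eq] at this
    refine this.trans (le_of_eq ?_)
    ring
  funext i
  have h1 : ∀ k, |Ψ x i - u (k + 1) i| ≤ R * W i / 2 * (1 / 2) ^ k := by
    intro k
    rw [husucc]
    refine (hΨ _ _ _ hxb (hub k) (hxu k) i).trans (le_of_eq ?_)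
    rw [one_div, inv_pow]
    field_simp
  have h2 : Tendsto (fun k => R * W i / 2 * (1 / 2 : ℝ) ^ k) atTop (𝓝 0) := by
    simpa using (tendsto_pow_atTop_nhds_zero_of_lt_one (r := (1 / 2 : ℝ))
      (by norm_num) (by norm_num)).const_mul (R * W i / 2)
  have h3 : Tendsto (fun k => u (k + 1) i) atTop (𝓝 (Ψ x i)) := by
    rw [tendsto_iff_dist_tendsto_zero]
    refine squeeze_zero (fun _ => dist_nonneg) (fun k => ?_) h2
    rw [dist_comm, Real.dist_eq]
    exact h1 k
  exact tendsto_nhds_unique h3 ((tendsto_add_atTop_iff_nat 1).2 (hx i))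

/-! ## Existence of the solitons -/

lemma abs_sq_sub_sq_le {x y R D : ℝ} (hx : |x| ≤ R) (hy : |y| ≤ R) (hD : |x - y| ≤ D) :
    |x ^ 2 - y ^ 2| ≤ 2 * R * D := by
  have h1 : x ^ 2 - y ^ 2 = (x + y) * (x - y) := by ring
  have h2 : |x + y| ≤ 2 * R := (abs_add_le _ _).trans (by linarith)
  rw [h1, abs_mul]
  exact mul_le_mul h2 hD (abs_nonneg _) ((abs_nonneg _).trans h2)

lemma abs_cube_sub_cube_le {x y R D : ℝ} (hx : |x| ≤ R) (hy : |y| ≤ R) (hD : |x - y| ≤ D) :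
    |x ^ 3 - y ^ 3| ≤ 3 * R ^ 2 * D := by
  have h1 : x ^ 3 - y ^ 3 = (x ^ 2 + x * y + y ^ 2) * (x - y) := by ring
  have hR : 0 ≤ R := (abs_nonneg _).trans hx
  have hx2 : |x ^ 2| ≤ R ^ 2 := by rw [abs_pow]; gcongr
  have hy2 : |y ^ 2| ≤ R ^ 2 := by rw [abs_pow]; gcongr
  have hxy : |x * y| ≤ R ^ 2 := by
    rw [abs_mul, sq]; exact mul_le_mul hx hy (abs_nonneg _) hR
  have h2 : |x ^ 2 + x * y + y ^ 2| ≤ 3 * R ^ 2 := by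
    refine (abs_add_le _ _).trans ?_
    have := abs_add_le (x ^ 2) (x * y)
    linarith
  rw [h1, abs_mul]
  exact mul_le_mul h2 hD (abs_nonneg _) ((abs_nonneg _).trans h2)

lemma exists_profile {ε α σ : ℝ} (hε : 0 < ε) (hε' : ε ≤ 1 / 100) (hα : 0 ≤ α) (hα' : α ≤ 1)
    (hσ : σ = 0 ∨ σ = 1 ∨ σ = -1) :
    ∃ y : ℕ → ℝ, y 0 = α ∧ (∀ n, y (n + 1) = ε * (y (n + 2) + y n) + y (n + 1) ^ 3) ∧
      |y 1 - σ| ≤ 2 * ε * (α + |σ|) ∧ ∀ n, |y (n + 2)| ≤ 2 * ε * (α + |σ|) := by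
  have hσ1 : |σ| ≤ 1 := by rcases hσ with rfl | rfl | rfl <;> simp
  have hσ3 : σ ^ 3 = σ := by rcases hσ with rfl | rfl | rfl <;> norm_num
  have hσ2 : 1 ≤ |1 - 3 * σ ^ 2| := by
    rcases hσ with rfl | rfl | rfl <;> norm_num [abs_of_neg]
  have hσ0 : 1 - 3 * σ ^ 2 ≠ 0 := fun h => by
    rw [h, abs_zero] at hσ2
    linarith
  have hdiv : ∀ u C : ℝ, |u| ≤ C → |u / (1 - 3 * σ ^ 2)| ≤ C := fun u C hu => by
    rw [abs_div]
    exact (div_le_self (abs_nonneg _) hσ2).trans hu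
  set R := 2 * ε * (α + |σ|) with hR
  have hR0 : 0 ≤ R := by positivity
  have hR1 : R ≤ 1 / 25 := by
    have : α + |σ| ≤ 2 := by linarith
    calc R ≤ 2 * (1 / 100) * 2 := by rw [hR]; gcongr
      _ = 1 / 25 := by norm_num
  -- Here `x 0` is the correction to σ at site 1, and `x n` for n ≥ 1 is the value at site n + 1. At
  -- site 1 the constant term cancels because σ³ = σ, and the linearization 1 - 3σ² (equal to 1 or
  -- -2) is divided out.
  set Ψ : (ℕ → ℝ) → ℕ → ℝ := fun x n =>
    if n = 0 then (ε * (x 1 + α) + 3 * σ * x 0 ^ 2 + x 0 ^ 3) / (1 - 3 * σ ^ 2)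
    else ε * (x (n + 1) + x (n - 1) + if n = 1 then σ else 0) + x n ^ 3 with hΨ
  obtain ⟨x, hxR, hx⟩ := exists_fixedPoint_of_weighted_contraction (fun _ : ℕ => (1 : ℝ)) R Ψ
    (by
      intro n
      rcases n with _ | n
      · simp only [hΨ, if_true, Pi.zero_apply]
        refine hdiv _ _ ?_
        have : 0 ≤ ε * |σ| := by positivity
        have h1 : 0 ≤ ε * α := by positivity
        simp only [zero_add, ne_eq, OfNat.ofNat_ne_zero, not_false_eq_true, zero_pow, mul_zero,
          add_zero]
        rw [abs_of_nonneg h1, hR]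
        nlinarith
      · simp only [hΨ, Pi.zero_apply, Nat.succ_ne_zero, if_false]
        have h1 : |(if n + 1 = 1 then σ else 0)| ≤ α + |σ| := by
          split_ifs
          · linarith
          · rw [abs_zero]; positivity
        simp only [zero_add, ne_eq, OfNat.ofNat_ne_zero, not_false_eq_true, zero_pow, add_zero]
        rw [abs_mul, abs_of_pos hε, hR]
        nlinarith)
    (by
      intro x y D hx hy hD n
      simp only [mul_one] at hx hy hD ⊢
      have hD0 : 0 ≤ D := (abs_nonneg _).trans (hD 0)
      have h3 := fun n => abs_cube_sub_cube_le (hx n) (hy n) (hD n)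
      have hRD : 3 * R ^ 2 * D ≤ 1 / 100 * D := by
        gcongr
        nlinarith
      rcases n with _ | n
      · simp only [hΨ, if_true]
        rw [← sub_div]
        refine hdiv _ _ ?_
        have h2 := abs_sq_sub_sq_le (hx 0) (hy 0) (hD 0)
        have e : ε * (x 1 + α) + 3 * σ * x 0 ^ 2 + x 0 ^ 3 -
            (ε * (y 1 + α) + 3 * σ * y 0 ^ 2 + y 0 ^ 3) =
            ε * (x 1 - y 1) + 3 * σ * (x 0 ^ 2 - y 0 ^ 2) + (x 0 ^ 3 - y 0 ^ 3) := by ring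
        rw [e]
        refine (abs_add_three _ _ _).trans ?_
        rw [abs_mul, abs_of_pos hε, abs_mul, abs_mul, abs_of_pos (three_pos : (0 : ℝ) < 3)]
        have e1 : ε * |x 1 - y 1| ≤ 1 / 100 * D :=
          mul_le_mul hε' (hD 1) (abs_nonneg _) (by norm_num)
        have e2 : 3 * |σ| * |x 0 ^ 2 - y 0 ^ 2| ≤ 3 * 1 * (2 * (1 / 25) * D) := by
          gcongr
          exact h2.trans (by gcongr)
        linarith [h3 0]
      · simp only [hΨ, Nat.succ_ne_zero, if_false, Nat.add_sub_cancel]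
        have e : ε * (x (n + 1 + 1) + x n + (if n + 1 = 1 then σ else 0)) + x (n + 1) ^ 3 -
            (ε * (y (n + 1 + 1) + y n + (if n + 1 = 1 then σ else 0)) + y (n + 1) ^ 3) =
            ε * (x (n + 2) - y (n + 2)) + ε * (x n - y n) + (x (n + 1) ^ 3 - y (n + 1) ^ 3) := by
          ring
        rw [e]
        refine (abs_add_three _ _ _).trans ?_
        rw [abs_mul, abs_of_pos hε, abs_mul, abs_of_pos hε]
        have e1 : ε * |x (n + 2) - y (n + 2)| ≤ 1 / 100 * D :=
          mul_le_mul hε' (hD _) (abs_nonneg _) (by norm_num)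
        have e2 : ε * |x n - y n| ≤ 1 / 100 * D :=
          mul_le_mul hε' (hD _) (abs_nonneg _) (by norm_num)
        linarith [h3 (n + 1)])
  simp only [mul_one] at hxR
  have hx0 : (1 - 3 * σ ^ 2) * x 0 = ε * (x 1 + α) + 3 * σ * x 0 ^ 2 + x 0 ^ 3 := by
    have := congrFun hx 0
    simp only [hΨ, if_true] at this
    rw [div_eq_iff hσ0] at this
    linarith
  have hx1 : ∀ n, x (n + 1) = ε * (x (n + 2) + x n + if n = 0 then σ else 0) + x (n + 1) ^ 3 := by
    intro n
    have := congrFun hx (n + 1)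
    simp only [hΨ, Nat.succ_ne_zero, if_false, Nat.add_sub_cancel] at this
    simpa using this.symm
  refine ⟨fun n => if n = 0 then α else if n = 1 then σ + x 0 else x (n - 1), by simp, ?_, ?_, ?_⟩
  · intro n
    rcases n with _ | _ | n
    · simp only [zero_add]
      norm_num
      linear_combination hx0 - hσ3
    · have := hx1 0
      norm_num at this ⊢
      linear_combination this
    · have := hx1 (n + 1)
      have h1 : n + 1 + 1 + 2 ≠ 1 := by omega
      simp only [h1, if_false]
      norm_num at this ⊢
      linear_combination this
  · simpa using hxR 0
  · intro n
    simpa using hxR (n + 1)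

/-- As |y| ≤ 1/2, the cubic term is at most |y|/4 and is absorbed on the left. What remains is the
neighbour inequality of `le_two_mul_of_le_neighbours` with θ = 2ε. -/
lemma decay_of_profile {ε r : ℝ} {y : ℕ → ℝ} (hε : 0 < ε) (hε' : ε ≤ 1 / 100) (hr : r ≤ 1 / 2)
    (h0 : ∃ C, |y 0| ≤ C) (hy : ∀ n, y (n + 1) = ε * (y (n + 2) + y n) + y (n + 1) ^ 3)
    (hb : ∀ n, |y (n + 1)| ≤ r) (n : ℕ) : |y (n + 1)| ≤ 4 * ε * |y n| := by
  obtain ⟨C, hC⟩ := h0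
  have := le_two_mul_of_le_neighbours (x := fun n => |y n|) (θ := 2 * ε) (B := max C r)
    (fun n => abs_nonneg _) (fun n => by
      rcases n with _ | n
      · exact hC.trans (le_max_left _ _)
      · exact (hb n).trans (le_max_right _ _)) (by positivity) (by linarith) (fun n => by
      have h1 : |y (n + 1)| ≤ ε * (|y (n + 2)| + |y n|) + |y (n + 1)| ^ 3 := by
        conv_lhs => rw [hy n]
        refine (abs_add_le _ _).trans ?_
        rw [abs_mul, abs_of_pos hε, abs_pow]
        gcongr
        exact abs_add_le _ _
      have h2 : |y (n + 1)| ^ 3 ≤ 1 / 4 * |y (n + 1)| := by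
        have h3 : |y (n + 1)| ≤ 1 / 2 := (hb n).trans hr
        have h4 := abs_nonneg (y (n + 1))
        have h5 : |y (n + 1)| ^ 2 ≤ (1 / 2) ^ 2 := by gcongr
        calc |y (n + 1)| ^ 3 = |y (n + 1)| ^ 2 * |y (n + 1)| := by ring
          _ ≤ (1 / 2) ^ 2 * |y (n + 1)| := by gcongr
          _ = _ := by norm_num
      have h6 : 0 ≤ ε * (|y (n + 2)| + |y n|) := by positivity
      nlinarith) n
  linarith

lemma antitone_tendsto_of_decay {x : ℕ → ℝ} {θ : ℝ} (hx : ∀ n, 0 ≤ x n)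
    (hθ : θ < 1) (h : ∀ n, x (n + 2) ≤ θ * x (n + 1)) :
    AntitoneOn x (Set.Ici 1) ∧ Tendsto x atTop (𝓝 0) := by
  have hmono : Antitone fun n => x (n + 1) := antitone_nat_of_succ_le fun n =>
    (h n).trans (mul_le_of_le_one_left (hx _) hθ.le)
  constructor
  · intro a ha b hb hab
    obtain ⟨a, rfl⟩ := Nat.exists_eq_add_of_le' (Set.mem_Ici.1 ha)
    obtain ⟨b, rfl⟩ := Nat.exists_eq_add_of_le' (Set.mem_Ici.1 hb)
    exact hmono (by omega)
  · rw [← tendsto_add_atTop_iff_nat 1]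
    by_cases h0 : 0 ≤ θ
    · refine squeeze_zero (fun n => hx _) (g := fun n => x 1 * θ ^ n) (fun n => ?_) ?_
      · induction n with
        | zero => simp
        | succ n ih =>
          refine (h n).trans ?_
          rw [pow_succ]
          nlinarith
      · simpa using (tendsto_pow_atTop_nhds_zero_of_lt_one h0 hθ).const_mul (x 1)
    · have hz : ∀ n, x (n + 2) = 0 := fun n => by
        have := h n
        have := hx (n + 1)
        have := hx (n + 2)
        nlinarith
      refine (tendsto_add_atTop_iff_nat 1).1 ?_
      simp [add_assoc, hz]

lemma isLittleO_of_abs_le {f g : ℝ → ℝ} {C : ℝ}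
    (h : ∀ᶠ ε in 𝓝[>] (0 : ℝ), |f ε| ≤ C * ε * |g ε|) : f =o[𝓝[>] (0 : ℝ)] g := by
  refine IsLittleO.of_bound fun c hc => ?_
  have h1 : Tendsto (fun ε : ℝ => C * ε) (𝓝[>] 0) (𝓝 (C * 0)) :=
    ((continuous_const.mul continuous_id).tendsto 0).mono_left nhdsWithin_le_nhds
  rw [mul_zero] at h1
  filter_upwards [h, h1.eventually_le_const hc] with ε h2 h3
  rw [Real.norm_eq_abs, Real.norm_eq_abs]
  exact h2.trans (by gcongr)

lemma eventually_pos_le {c : ℝ} (hc : 0 < c) : ∀ᶠ ε in 𝓝[>] (0 : ℝ), 0 < ε ∧ ε ≤ c := by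
  filter_upwards [Ioc_mem_nhdsGT hc] with ε hε using hε

/-- Reduces the asymptotic definition to bounds at fixed ε: the ratio 4ε yields monotonicity, decay
and smallness of the later sites, and a relative error O(ε) at the first site yields the leading
order. -/
lemma isRapidlyDecayingSoliton_of_bounds {γ C : ℝ} {A ϑ : ℝ → ℝ} {φ : ℝ → ℕ → ℝ}
    (h : ∀ᶠ ε in 𝓝[>] (0 : ℝ), IsStaticSolution γ ε (A ε) (φ ε) ∧
      (∀ n, |φ ε (n + 2)| ≤ 4 * ε * |φ ε (n + 1)|) ∧ |φ ε 1 - ϑ ε| ≤ C * ε * |ϑ ε|) :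
    IsRapidlyDecayingSoliton γ A ϑ φ := by
  have hd : ∀ᶠ ε in 𝓝[>] (0 : ℝ), AntitoneOn (fun n => |φ ε n|) (Set.Ici 1) ∧
      Tendsto (fun n => |φ ε n|) atTop (𝓝 0) := by
    filter_upwards [h, eventually_pos_le (show (0 : ℝ) < 1 / 100 by norm_num)] with ε h hε
    exact antitone_tendsto_of_decay (fun _ => abs_nonneg _) (by linarith) h.2.1
  have hfirst : (fun ε => φ ε 1 - ϑ ε) =o[𝓝[>] (0 : ℝ)] ϑ :=
    isLittleO_of_abs_le (h.mono fun ε h => h.2.2)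
  refine ⟨h.mono fun _ h => h.1, hd.mono fun _ h => h.1, hd.mono fun _ h => h.2, hfirst, ?_⟩
  intro n hn
  obtain ⟨n, rfl⟩ := Nat.exists_eq_add_of_le' hn
  have hone : (fun ε => φ ε (n + 2)) =o[𝓝[>] (0 : ℝ)] fun ε => φ ε 1 := by
    refine isLittleO_of_abs_le (C := 4) ?_
    filter_upwards [h, hd, eventually_pos_le (show (0 : ℝ) < 1 by norm_num)] with ε h hd hε
    have := hd.1 (Set.mem_Ici.2 le_rfl) (Set.mem_Ici.2 (Nat.le_add_left 1 n)) (Nat.le_add_left 1 n)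
    refine (h.2.1 n).trans ?_
    have h4 := hε.1.le
    gcongr
  have hO : (fun ε => φ ε 1) =O[𝓝[>] (0 : ℝ)] ϑ := IsEquivalent.isBigO hfirst
  exact hone.trans_isBigO hO

lemma tendsto_mul_sqrt (γ : ℝ) {A : ℝ → ℝ}
    (hA_bdd : A =O[𝓝[>] (0 : ℝ)] (fun _ => (1 : ℝ))) :
    Tendsto (fun ε => A ε * √(ε * γ)) (𝓝[>] 0) (𝓝 0) := by
  have hs : Tendsto (fun ε : ℝ => √(ε * γ)) (𝓝[>] 0) (𝓝 0) := by
    have : Continuous fun ε : ℝ => √(ε * γ) := by fun_prop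
    have h := (this.tendsto 0).mono_left (nhdsWithin_le_nhds (s := Set.Ioi 0))
    simpa using h
  have h1 : (fun ε => A ε * √(ε * γ)) =O[𝓝[>] (0 : ℝ)] fun ε => 1 * √(ε * γ) :=
    hA_bdd.mul (isBigO_refl _ _)
  simp only [one_mul] at h1
  exact h1.trans_tendsto hs

lemma exists_scaled_profiles {γ σ : ℝ} (hγ : 0 < γ) {A : ℝ → ℝ}
    (hA_pos : ∀ᶠ ε in 𝓝[>] (0 : ℝ), 0 < A ε)
    (hA_bdd : A =O[𝓝[>] (0 : ℝ)] (fun _ => (1 : ℝ))) (hσ : σ = 0 ∨ σ = 1 ∨ σ = -1) :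
    ∃ y : ℝ → ℕ → ℝ, ∀ᶠ ε in 𝓝[>] (0 : ℝ), A ε * √(ε * γ) ≤ 1 ∧ 0 < A ε ∧
      IsStaticSolution γ ε (A ε) (fun n => y ε n / √(ε * γ)) ∧
      y ε 0 = A ε * √(ε * γ) ∧
      (∀ n, y ε (n + 1) = ε * (y ε (n + 2) + y ε n) + y ε (n + 1) ^ 3) ∧
      |y ε 1 - σ| ≤ 2 * ε * (A ε * √(ε * γ) + |σ|) ∧
      ∀ n, |y ε (n + 2)| ≤ 2 * ε * (A ε * √(ε * γ) + |σ|) := by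
  have hα := tendsto_mul_sqrt γ hA_bdd
  have key : ∀ᶠ ε in 𝓝[>] (0 : ℝ), ∃ y : ℕ → ℝ, A ε * √(ε * γ) ≤ 1 ∧ 0 < A ε ∧
      IsStaticSolution γ ε (A ε) (fun n => y n / √(ε * γ)) ∧
      y 0 = A ε * √(ε * γ) ∧
      (∀ n, y (n + 1) = ε * (y (n + 2) + y n) + y (n + 1) ^ 3) ∧
      |y 1 - σ| ≤ 2 * ε * (A ε * √(ε * γ) + |σ|) ∧
      ∀ n, |y (n + 2)| ≤ 2 * ε * (A ε * √(ε * γ) + |σ|) := by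
    filter_upwards [hA_pos, hα.eventually_le_const one_pos,
      eventually_pos_le (show (0 : ℝ) < 1 / 100 by norm_num)] with ε hA hα1 hε
    obtain ⟨y, h0, hy, h1, h2⟩ := exists_profile hε.1 hε.2 (by positivity) hα1 hσ
    have hs0 : 0 < √(ε * γ) := Real.sqrt_pos.2 (mul_pos hε.1 hγ)
    have hsq : √(ε * γ) ^ 2 = ε * γ := Real.sq_sqrt (mul_pos hε.1 hγ).le
    refine ⟨y, hα1, hA, ⟨?_, ?_⟩, h0, hy, h1, h2⟩
    · change y 0 / √(ε * γ) = A ε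
      rw [h0, mul_div_cancel_right₀ _ hs0.ne']
    · intro n hn
      obtain ⟨n, rfl⟩ := Nat.exists_eq_add_of_le' hn
      have h3 : ε * γ * (y (n + 1) / √(ε * γ)) ^ 3 = y (n + 1) ^ 3 / √(ε * γ) := by
        field_simp
        rw [hsq]
        ring
      simp only [Nat.add_sub_cancel]
      have h4 := congrArg (· / √(ε * γ)) (hy n)
      simp only [add_div, mul_div_assoc] at h4
      linear_combination h3 - h4
  exact key.choice

lemma exists_large_soliton {γ σ : ℝ} (hγ : 0 < γ) {A : ℝ → ℝ}
    (hA_pos : ∀ᶠ ε in 𝓝[>] (0 : ℝ), 0 < A ε)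
    (hA_bdd : A =O[𝓝[>] (0 : ℝ)] (fun _ => (1 : ℝ))) (hσ : σ = 1 ∨ σ = -1) :
    ∃ φ, IsRapidlyDecayingSoliton γ A (fun ε => σ * (1 / √(ε * γ))) φ := by
  obtain ⟨y, hy⟩ := exists_scaled_profiles hγ hA_pos hA_bdd (Or.inr hσ)
  refine ⟨fun ε n => y ε n / √(ε * γ), isRapidlyDecayingSoliton_of_bounds (C := 4) ?_⟩
  have hσ1 : |σ| = 1 := by rcases hσ with rfl | rfl <;> simp
  filter_upwards [hy, eventually_pos_le (show (0 : ℝ) < 1 / 100 by norm_num)]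
    with ε ⟨hα, hA, hst, h0, hrec, h1, h2⟩ hε
  rw [hσ1] at h1 h2
  have hs0 : 0 < √(ε * γ) := Real.sqrt_pos.2 (mul_pos hε.1 hγ)
  have hR : 2 * ε * (A ε * √(ε * γ) + 1) ≤ 4 * ε := by nlinarith [hε.1]
  refine ⟨hst, fun n => ?_, ?_⟩
  -- The sequence is shifted because `y ε 1` is near ±1: only from site 2 on are the values small,
  -- and site 1 acts as the boundary value.
  · have := decay_of_profile (y := fun n => y ε (n + 1)) (r := 4 * ε) hε.1 hε.2 (by linarith)
      ⟨_, le_rfl⟩ (fun n => hrec (n + 1)) (fun n => (h2 n).trans hR) n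
    rw [abs_div, abs_div, ← mul_div_assoc]
    gcongr
  · have e : y ε 1 / √(ε * γ) - σ * (1 / √(ε * γ)) = (y ε 1 - σ) / √(ε * γ) := by ring
    rw [e, abs_div, abs_mul, hσ1, one_mul, abs_div, abs_one, mul_one_div]
    gcongr
    linarith

lemma exists_small_soliton {γ : ℝ} (hγ : 0 < γ) {A : ℝ → ℝ}
    (hA_pos : ∀ᶠ ε in 𝓝[>] (0 : ℝ), 0 < A ε)
    (hA_bdd : A =O[𝓝[>] (0 : ℝ)] (fun _ => (1 : ℝ))) :
    ∃ φ, IsRapidlyDecayingSoliton γ A (fun ε => ε * A ε) φ := by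
  obtain ⟨y, hy⟩ := exists_scaled_profiles hγ hA_pos hA_bdd (Or.inl rfl)
  refine ⟨fun ε n => y ε n / √(ε * γ), isRapidlyDecayingSoliton_of_bounds (C := 16) ?_⟩
  filter_upwards [hy, eventually_pos_le (show (0 : ℝ) < 1 / 100 by norm_num)]
    with ε ⟨hα, hA, hst, h0, hrec, h1, h2⟩ hε
  rw [abs_zero, add_zero] at h1 h2
  rw [sub_zero] at h1
  have hε0 := hε.1
  have hs0 : 0 < √(ε * γ) := Real.sqrt_pos.2 (mul_pos hε.1 hγ)
  have hα0 : 0 < A ε * √(ε * γ) := mul_pos hA hs0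
  set α := A ε * √(ε * γ) with hαdef
  have hdecay := decay_of_profile (y := y ε) (r := 2 * ε * α) hε.1 hε.2 (by nlinarith)
      ⟨_, le_rfl⟩ hrec (fun n => by
        rcases n with _ | n
        · exact h1
        · exact h2 n)
  refine ⟨hst, fun n => ?_, ?_⟩
  · rw [abs_div, abs_div, ← mul_div_assoc]
    gcongr
    exact hdecay (n + 1)
  · have e : y ε 1 / √(ε * γ) - ε * A ε = (y ε 1 - ε * α) / √(ε * γ) := by
      rw [hαdef]
      field_simp
    have e2 : 16 * ε * |ε * A ε| = 16 * ε * (ε * α) / √(ε * γ) := by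
      rw [abs_of_pos (mul_pos hε0 hA), hαdef]
      field_simp
    rw [e, e2, abs_div, abs_of_pos hs0]
    gcongr
    -- The error has to be O(ε²α), that is O(ε) relative to the leading term εα. The factor α must
    -- be kept, since A may tend to 0 at any rate.
    have e3 : y ε 1 - ε * α = ε * y ε 2 + y ε 1 ^ 3 := by
      have := hrec 0
      rw [h0] at this
      linear_combination this
    rw [e3]
    refine (abs_add_le _ _).trans ?_
    rw [abs_mul, abs_of_pos hε0, abs_pow]
    have h3 : |y ε 2| ≤ 4 * ε * (2 * ε * α) := (hdecay 1).trans (by gcongr)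
    have h4 : |y ε 1| ^ 3 ≤ (2 * ε * α) ^ 3 := by gcongr
    have h5 : (2 * ε * α) ^ 3 ≤ 8 * ε ^ 3 * α := by
      have : α ^ 3 ≤ α := by
        calc α ^ 3 = α ^ 2 * α := by ring
          _ ≤ 1 ^ 2 * α := by gcongr
          _ = α := by ring
      calc (2 * ε * α) ^ 3 = 8 * ε ^ 3 * α ^ 3 := by ring
        _ ≤ _ := by gcongr
    have h6 : ε * |y ε 2| ≤ 8 * ε ^ 3 * α := by
      calc ε * |y ε 2| ≤ ε * (4 * ε * (2 * ε * α)) := by gcongr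
        _ = _ := by ring
    have h7 : 16 * ε ^ 3 * α ≤ 16 * ε ^ 2 * α := by
      have : ε ^ 3 ≤ ε ^ 2 := by
        calc ε ^ 3 = ε * ε ^ 2 := by ring
          _ ≤ 1 * ε ^ 2 := by gcongr; linarith
          _ = _ := by ring
      gcongr
    nlinarith

/-! ## The linearized difference equations -/

/-- The sum of the two neighbours, with a zero boundary value to the left of the first entry. -/
def nbr {R : Type*} [Add R] (x : ℕ → R) : ℕ → R
  | 0 => x 1
  | k + 1 => x k + x (k + 2)

/-- The linearized equations for `(v, w)` with spectral parameter `z` and potential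
`g k = ε γ φ (k+1) ^ 2`. -/
def IsMode (ε : ℝ) (g : ℕ → ℝ) (z : ℂ) (v w : ℕ → ℂ) : Prop :=
  ∀ k, z * v k = ε * nbr v k + (2 * g k - 1) * v k + g k * w k ∧
    -z * w k = ε * nbr w k + (2 * g k - 1) * w k + g k * v k

/-- By this symmetry every estimate for the first component, proved for all z, also holds for the
second. -/
lemma IsMode.swap {ε : ℝ} {g : ℕ → ℝ} {z : ℂ} {v w : ℕ → ℂ} (h : IsMode ε g z v w) :
    IsMode ε g (-z) w v := fun k => ⟨(h k).2, by rw [neg_neg]; exact (h k).1⟩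

/-- Dividing by ε gives the recurrence of `jost_bound` with κ + κ⁻¹ = (1 + z)/ε and with all
potential terms as a source of size 3CBθ^k/ε. The other component enters only through its bound B.
-/
lemma jost_tail {ε B C θ : ℝ} {G : ℕ → ℝ} {z : ℂ} {x y : ℕ → ℂ} (hε : 0 < ε)
    (hx : Tendsto x atTop (𝓝 0)) (hC : 0 ≤ C) (hθ : 0 ≤ θ) (hθ' : θ ≤ 1 / 2)
    (hG : ∀ k, |G k| ≤ C * θ ^ k) (hxB : ∀ k, ‖x k‖ ≤ B) (hyB : ∀ k, ‖y k‖ ≤ B)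
    (h : ∀ k, z * x (k + 1) = ε * (x k + x (k + 2)) + (2 * G k - 1) * x (k + 1) +
      G k * y (k + 1)) :
    (∃ κ : ℂ, ‖κ‖ ≤ 1 ∧ ‖x 1 - κ * x 0‖ ≤ 6 * C * B / ε) ∧ ∀ k, ‖x k‖ ≤ ‖x 0‖ + 12 * C * B / ε := by
  obtain ⟨κ, hκ0, hκ1, hκ⟩ := exists_joukowski ((1 + z) / ε)
  have hB : 0 ≤ B := (norm_nonneg _).trans (hxB 0)
  have hεc : (ε : ℂ) ≠ 0 := by exact_mod_cast hε.ne'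
  have := jost_bound (v := x) (f := fun k => -(G k / ε) * (2 * x (k + 1) + y (k + 1)))
    (c := 3 * C * B / ε) (θ := θ) hx hκ0 hκ1 (by positivity) hθ hθ' (by
      intro k
      have h1 : ‖2 * x (k + 1) + y (k + 1)‖ ≤ 3 * B := by
        refine (norm_add_le _ _).trans ?_
        rw [norm_mul, Complex.norm_ofNat]
        linarith [hxB (k + 1), hyB (k + 1)]
      rw [norm_mul, norm_neg, norm_div, Complex.norm_real, Complex.norm_real, Real.norm_eq_abs,
        Real.norm_eq_abs, abs_of_pos hε]
      calc |G k| / ε * ‖2 * x (k + 1) + y (k + 1)‖ ≤ C * θ ^ k / ε * (3 * B) := by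
            gcongr
            exact hG k
        _ = 3 * C * B / ε * θ ^ k := by ring) (by
      intro k
      rw [hκ]
      field_simp
      linear_combination -h k)
  refine ⟨⟨κ, hκ1, ?_⟩, fun k => ?_⟩
  · refine (this.1 0).trans (le_of_eq ?_)
    ring
  · refine (this.2 k).trans (le_of_eq ?_)
    ring

lemma bddAbove_max_norm {v w : ℕ → ℂ} (hv : Tendsto v atTop (𝓝 0)) (hw : Tendsto w atTop (𝓝 0)) :
    BddAbove (Set.range fun k => max ‖v k‖ ‖w k‖) := by
  have h := hv.norm.max hw.norm
  exact h.bddAbove_range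

/-- A weak potential on the half-line has no modes at all. -/
lemma IsMode.eq_zero_of_weak {ε : ℝ} {g : ℕ → ℝ} {z : ℂ} {v w : ℕ → ℂ} (hε : 0 < ε)
    (hg : ∀ k, |g k| ≤ ε / 24 * (1 / 2) ^ k) (h : IsMode ε g z v w)
    (hv : Tendsto v atTop (𝓝 0)) (hw : Tendsto w atTop (𝓝 0)) (k : ℕ) : v k = 0 ∧ w k = 0 := by
  -- Prepending the boundary value 0 makes every site interior, so `jost_tail` applies with first
  -- value 0. The constant ε/24 makes its error 12CB/ε equal to B/2.
  set ext : (ℕ → ℂ) → ℕ → ℂ := fun x n => if n = 0 then 0 else x (n - 1) with hext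
  have ext_tendsto : ∀ x : ℕ → ℂ, Tendsto x atTop (𝓝 0) → Tendsto (ext x) atTop (𝓝 0) :=
    fun x hx => (tendsto_add_atTop_iff_nat 1).1 (by simpa [hext] using hx)
  have ext_nbr : ∀ (x : ℕ → ℂ) k, ext x k + ext x (k + 2) = nbr x k := by
    intro x k
    rcases k with _ | k <;> simp [hext, nbr]
  have ext_succ : ∀ (x : ℕ → ℂ) k, ext x (k + 1) = x k := fun x k => by simp [hext]
  have ext_le : ∀ (x : ℕ → ℂ) B, 0 ≤ B → (∀ k, ‖x k‖ ≤ B) → ∀ k, ‖ext x k‖ ≤ B := by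
    intro x B hB hx k
    rcases k with _ | k
    · simpa [hext] using hB
    · rw [ext_succ]; exact hx k
  have key : ∀ (z : ℂ) (v w : ℕ → ℂ), IsMode ε g z v w → Tendsto v atTop (𝓝 0) →
      ∀ B, (∀ k, ‖v k‖ ≤ B) → (∀ k, ‖w k‖ ≤ B) → ∀ k, ‖v k‖ ≤ B / 2 := by
    intro z v w h hv B hvB hwB k
    have hB : 0 ≤ B := (norm_nonneg _).trans (hvB 0)
    have := (jost_tail (x := ext v) (y := ext w) (G := g) (z := z) (θ := 1 / 2) (C := ε / 24) hε
      (ext_tendsto v hv) (by positivity) (by norm_num) le_rfl hg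
      (ext_le v B hB hvB) (ext_le w B hB hwB) (fun k => by
        rw [ext_nbr, ext_succ, ext_succ]
        exact (h k).1)).2 (k + 1)
    rw [ext_succ] at this
    refine this.trans (le_of_eq ?_)
    simp only [hext, if_true, norm_zero, zero_add]
    field_simp
    ring
  have := le_of_bootstrap (a := 0) (bddAbove_max_norm hv hw) (fun B hB i => by
    have h1 : ∀ k, ‖v k‖ ≤ B := fun k => (le_max_left _ _).trans (hB k)
    have h2 : ∀ k, ‖w k‖ ≤ B := fun k => (le_max_right _ _).trans (hB k)
    rw [zero_add]
    exact max_le (key z v w h hv B h1 h2 i) (key (-z) w v h.swap hw B h2 h1 i)) k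
  rw [mul_zero] at this
  exact ⟨norm_le_zero_iff.1 ((le_max_left _ _).trans this),
    norm_le_zero_iff.1 ((le_max_right _ _).trans this)⟩

/-- A soliton concentrated on its first site: `ρ` is its profile, normalized at the first site,
`g` is the potential and `-η` the residual of the boundary driving. -/
structure IsLocalizedProfile (ε η : ℝ) (ρ g : ℕ → ℝ) : Prop where
  pos : 0 < ε
  le : ε ≤ 1 / 1000
  eta_ne : η ≠ 0
  eta_le : |η| ≤ ε
  rho_zero : ρ 0 = 1
  rho_le : ∀ k, |ρ k| ≤ (2 * ε) ^ k
  g_nonneg : ∀ k, 0 ≤ g k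
  g_zero : |g 0 - 1| ≤ ε
  g_succ : ∀ k, g (k + 1) ≤ 8 * ε ^ 2 * (4 * ε ^ 2) ^ k
  eq_zero : ε * ρ 1 + (g 0 - 1) = -η
  eq_succ : ∀ k, ε * (ρ k + ρ (k + 2)) + (g (k + 1) - 1) * ρ (k + 1) = 0

/-! ### A priori bounds on modes of a localized profile -/

namespace IsLocalizedProfile

variable {ε η : ℝ} {ρ g : ℕ → ℝ}

lemma four_sq_le (h : IsLocalizedProfile ε η ρ g) : 4 * ε ^ 2 ≤ 1 / 2 := by
  nlinarith [h.pos, h.le]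

lemma g_succ_le (h : IsLocalizedProfile ε η ρ g) (k : ℕ) : |g (k + 1)| ≤ ε := by
  rw [abs_of_nonneg (h.g_nonneg _)]
  have h1 : (4 * ε ^ 2) ^ k ≤ 1 := pow_le_one₀ (by positivity) (h.four_sq_le.trans (by norm_num))
  calc g (k + 1) ≤ 8 * ε ^ 2 * (4 * ε ^ 2) ^ k := h.g_succ k
    _ ≤ 8 * ε ^ 2 * 1 := by gcongr
    _ ≤ ε := by nlinarith [h.pos, h.le]

/-- Beyond the first site the potential is O(ε²), so after the division by ε in `jost_tail` its
effect is still O(ε). -/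
lemma tail_bound (h : IsLocalizedProfile ε η ρ g) {z : ℂ} {v w : ℕ → ℂ} (hm : IsMode ε g z v w)
    (hv : Tendsto v atTop (𝓝 0)) {B : ℝ} (hvB : ∀ k, ‖v k‖ ≤ B) (hwB : ∀ k, ‖w k‖ ≤ B) :
    (∃ κ : ℂ, ‖κ‖ ≤ 1 ∧ ‖v 1 - κ * v 0‖ ≤ 48 * ε * B) ∧ ∀ k, ‖v k‖ ≤ ‖v 0‖ + 96 * ε * B := by
  have := jost_tail (x := v) (y := w) (G := fun k => g (k + 1)) (z := z) (θ := 4 * ε ^ 2)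
    (C := 8 * ε ^ 2) h.pos hv (by positivity) (by positivity) h.four_sq_le
    (fun k => by rw [abs_of_nonneg (h.g_nonneg _)]; exact h.g_succ k) hvB hwB
    (fun k => (hm (k + 1)).1)
  have hε := h.pos.ne'
  have e1 : 6 * (8 * ε ^ 2) * B / ε = 48 * ε * B := by field_simp; ring
  have e2 : 12 * (8 * ε ^ 2) * B / ε = 96 * ε * B := by field_simp; ring
  rwa [e1, e2] at this

/-- At the first site g ≈ 1 and the coupling to the next site is O(ε), so up to O(ε) the pair (v_0,
w_0) solves the eigenvalue problem of the matrix with rows (1, 1) and (-1, -1). The constant 5 is 2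
+ 2 + 1, from the neighbour, the diagonal and the off-diagonal terms. -/
lemma site_bound (h : IsLocalizedProfile ε η ρ g) {z : ℂ} {v w : ℕ → ℂ} {X : ℝ}
    (hm : IsMode ε g z v w) (hv : Tendsto v atTop (𝓝 0)) (hvB : ∀ k, ‖v k‖ ≤ 2 * X)
    (hwB : ∀ k, ‖w k‖ ≤ 2 * X) (hv0 : ‖v 0‖ ≤ X) (hw0 : ‖w 0‖ ≤ X) :
    ‖(1 - z) * v 0 + w 0‖ ≤ 5 * ε * X := by
  obtain ⟨⟨κ, hκ, hκv⟩, -⟩ := h.tail_bound hm hv hvB hwB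
  have hX : 0 ≤ X := (norm_nonneg _).trans hv0
  have hε := h.pos
  have h1 : ‖v 1‖ ≤ 2 * X := hvB 1
  have h1' : ‖v 1‖ ≤ X + 96 * ε * X := by
    calc ‖v 1‖ = ‖κ * v 0 + (v 1 - κ * v 0)‖ := by ring_nf
      _ ≤ ‖κ‖ * ‖v 0‖ + ‖v 1 - κ * v 0‖ := by
        rw [← norm_mul]; exact norm_add_le _ _
      _ ≤ 1 * X + 48 * ε * (2 * X) := by gcongr
      _ = _ := by ring
  have e : (1 - z) * v 0 + w 0 =
      -(ε * v 1) - 2 * ((g 0 - 1 : ℝ) : ℂ) * v 0 - ((g 0 - 1 : ℝ) : ℂ) * w 0 := by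
    have := (hm 0).1
    simp only [nbr] at this
    push_cast
    linear_combination -this
  rw [e]
  refine (norm_sub_le _ _).trans ?_
  have h2 := norm_sub_le (-(ε * v 1)) (2 * ((g 0 - 1 : ℝ) : ℂ) * v 0)
  rw [norm_neg, norm_mul, norm_mul, norm_mul, Complex.norm_real, Complex.norm_real,
    Complex.norm_ofNat, Real.norm_eq_abs, Real.norm_eq_abs, abs_of_pos hε] at h2
  rw [norm_mul, Complex.norm_real, Real.norm_eq_abs]
  have h3 : ε * ‖v 1‖ ≤ ε * (2 * X) := by gcongr
  have h4 : |g 0 - 1| * ‖v 0‖ ≤ ε * X := mul_le_mul h.g_zero hv0 (norm_nonneg _) hε.le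
  have h5 : |g 0 - 1| * ‖w 0‖ ≤ ε * X := mul_le_mul h.g_zero hw0 (norm_nonneg _) hε.le
  nlinarith

/-- Bootstraps `tail_bound`, using 96ε ≤ 1/2. In particular a non-zero mode cannot vanish at the
first site. -/
lemma mode_bound (h : IsLocalizedProfile ε η ρ g) {z : ℂ} {v w : ℕ → ℂ}
    (hm : IsMode ε g z v w) (hv : Tendsto v atTop (𝓝 0)) (hw : Tendsto w atTop (𝓝 0)) (k : ℕ) :
    max ‖v k‖ ‖w k‖ ≤ 2 * max ‖v 0‖ ‖w 0‖ := by
  refine le_of_bootstrap (bddAbove_max_norm hv hw) (fun B hB i => ?_) k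
  have h1 : ∀ k, ‖v k‖ ≤ B := fun k => (le_max_left _ _).trans (hB k)
  have h2 : ∀ k, ‖w k‖ ≤ B := fun k => (le_max_right _ _).trans (hB k)
  have hB0 : 0 ≤ B := (norm_nonneg _).trans (h1 0)
  have h3 : 96 * ε * B ≤ B / 2 := by nlinarith [h.le]
  exact max_le (((h.tail_bound hm hv h1 h2).2 i).trans (add_le_add (le_max_left _ _) h3))
    (((h.tail_bound hm.swap hw h2 h1).2 i).trans (add_le_add (le_max_right _ _) h3))

/-- Modes of a localized profile have a small spectral parameter. -/
lemma norm_sq_le (h : IsLocalizedProfile ε η ρ g) {z : ℂ} {v w : ℕ → ℂ}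
    (hm : IsMode ε g z v w) (hv : Tendsto v atTop (𝓝 0)) (hw : Tendsto w atTop (𝓝 0))
    (hne : ∃ k, v k ≠ 0 ∨ w k ≠ 0) : ‖z ^ 2‖ ≤ 1 / 8 := by
  set X := max ‖v 0‖ ‖w 0‖ with hX
  have hb := h.mode_bound hm hv hw
  have hvB : ∀ k, ‖v k‖ ≤ 2 * X := fun k => (le_max_left _ _).trans (hb k)
  have hwB : ∀ k, ‖w k‖ ≤ 2 * X := fun k => (le_max_right _ _).trans (hb k)
  have hX0 : 0 < X := by
    obtain ⟨k, hk⟩ := hne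
    rcases hk with hk | hk
    · linarith [norm_pos_iff.2 hk, hvB k]
    · linarith [norm_pos_iff.2 hk, hwB k]
  have h1 := h.site_bound hm hv hvB hwB (le_max_left _ _) (le_max_right _ _)
  have h2 := h.site_bound hm.swap hw hwB hvB (le_max_right _ _) (le_max_left _ _)
  have hz : ∀ (z : ℂ) (a b : ℂ), ‖(1 - z) * a + b‖ ≤ 5 * ε * X → ‖(1 - -z) * b + a‖ ≤ 5 * ε * X →
      ‖z‖ ^ 2 * ‖a‖ ≤ 5 * ε * (2 + ‖z‖) * X := by
    intro z a b h1 h2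
    -- The limiting first-site matrix is nilpotent. Eliminating b therefore leaves only z²a, and the
    -- O(ε) errors bound z².
    have e : z ^ 2 * a = ((1 - -z) * b + a) - (1 + z) * ((1 - z) * a + b) := by ring
    rw [← norm_pow, ← norm_mul, e]
    refine (norm_sub_le _ _).trans ?_
    rw [norm_mul]
    have h3 : ‖1 + z‖ ≤ 1 + ‖z‖ := (norm_add_le _ _).trans (by simp)
    calc _ ≤ 5 * ε * X + (1 + ‖z‖) * (5 * ε * X) := by gcongr
      _ = _ := by ring
  have h3 : ‖z‖ ^ 2 * X ≤ 5 * ε * (2 + ‖z‖) * X := by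
    have ha := hz z (v 0) (w 0) h1 h2
    have hb := hz (-z) (w 0) (v 0) h2 (by rwa [neg_neg])
    rw [norm_neg] at hb
    rw [hX, mul_max_of_nonneg _ _ (by positivity)]
    rw [hX] at ha hb
    exact max_le ha hb
  have h4 : ‖z‖ ^ 2 ≤ 5 * ε * (2 + ‖z‖) := le_of_mul_le_mul_right h3 hX0
  rw [norm_pow]
  nlinarith [h.le, h.pos, norm_nonneg z, sq_nonneg (‖z‖ - 1)]

end IsLocalizedProfile

/-! ## The mode of a localized profile -/

/-- The spectral parameter `ζ = z ^ 2` read off from the first site. -/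
def modeParam (ε η : ℝ) (g s p : ℕ → ℝ) : ℝ := (3 * g 0 - 1) * (ε * s 1 - η) + ε * p 1

/-- The first component of the fixed point map for the mode. -/
def modeMapFst (ε η : ℝ) (ρ g s p : ℕ → ℝ) : ℕ → ℝ
  | 0 => ε * s 1 - η
  | k + 1 => -modeParam ε η g s p * (ρ (k + 1) + s (k + 1)) + ε * (p k + p (k + 2)) +
      3 * g (k + 1) * p (k + 1)

/-- The second component of the fixed point map for the mode. -/
def modeMapSnd (ε η : ℝ) (ρ g s p : ℕ → ℝ) : ℕ → ℝ
  | 0 => 0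
  | k + 1 => -modeMapFst ε η ρ g s p (k + 1) + ε * (s k + s (k + 2)) + g (k + 1) * s (k + 1)

/-- A real solution `(p, ρ + s)` of `L₋ r = p`, `L₊ p = ζ r`, normalized at the first site, with
quantitative bounds. -/
structure IsRealMode (ε η : ℝ) (ρ g : ℕ → ℝ) (ζ : ℝ) (p r : ℕ → ℝ) : Prop where
  zeta_le : |ζ + 2 * η| ≤ 7 * ε * |η|
  p_zero_le : |p 0 + η| ≤ 2 * ε * |η|
  p_le : ∀ k, |p k| ≤ 2 * |η| * (1 / 2) ^ k
  r_le : ∀ k, |r k - ρ k| ≤ 2 * |η| * (1 / 2) ^ k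
  r_zero : r 0 = 1
  eq_r : ∀ k, ε * nbr r k + (g k - 1) * r k = p k
  eq_p : ∀ k, ε * nbr p k + (3 * g k - 1) * p k = ζ * r k

namespace IsLocalizedProfile

variable {ε η : ℝ} {ρ g : ℕ → ℝ}

lemma rho_le_half (h : IsLocalizedProfile ε η ρ g) (k : ℕ) : |ρ k| ≤ (1 / 2) ^ k :=
  (h.rho_le k).trans (pow_le_pow_left₀ (by linarith [h.pos]) (by linarith [h.le]) k)

lemma abs_three_g_zero_sub_one_le (h : IsLocalizedProfile ε η ρ g) : |3 * g 0 - 1| ≤ 3 := by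
  have := abs_le.1 h.g_zero
  have := h.le
  exact abs_le.2 ⟨by linarith, by linarith⟩

lemma modeMap_bound_zero (h : IsLocalizedProfile ε η ρ g) (k : ℕ) :
    |modeMapFst ε η ρ g 0 0 k| ≤ |η| * (1 / 2) ^ k ∧
      |modeMapSnd ε η ρ g 0 0 k| ≤ |η| * (1 / 2) ^ k := by
  have hF : ∀ k, |modeMapFst ε η ρ g 0 0 k| ≤ |η| * (1 / 2) ^ k := by
    intro k
    rcases k with _ | k
    · simp [modeMapFst]
    · simp only [modeMapFst, modeParam, Pi.zero_apply, mul_zero, zero_sub, add_zero]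
      rw [abs_mul, abs_neg, abs_mul, abs_neg]
      calc |3 * g 0 - 1| * |η| * |ρ (k + 1)| ≤ 3 * |η| * (2 * ε) ^ (k + 1) := by
            gcongr
            · exact h.abs_three_g_zero_sub_one_le
            · exact h.rho_le _
        _ ≤ |η| * (1 / 2) ^ (k + 1) := by
            have h1 : (2 * ε) ^ k ≤ (1 / 2) ^ k :=
              pow_le_pow_left₀ (by linarith [h.pos]) (by linarith [h.le]) k
            have h2 : 3 * (2 * ε) ≤ 1 / 2 := by linarith [h.le]
            have h3 : 3 * (2 * ε) * (2 * ε) ^ k ≤ 1 / 2 * (1 / 2) ^ k :=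
              mul_le_mul h2 h1 (pow_nonneg (by linarith [h.pos]) _) (by norm_num)
            calc 3 * |η| * (2 * ε) ^ (k + 1) = |η| * (3 * (2 * ε) * (2 * ε) ^ k) := by ring
              _ ≤ |η| * (1 / 2 * (1 / 2) ^ k) := by gcongr
              _ = _ := by ring
  refine ⟨hF k, ?_⟩
  rcases k with _ | k
  · simp [modeMapSnd]
  · simpa [modeMapSnd] using hF (k + 1)

lemma abs_modeParam_le (h : IsLocalizedProfile ε η ρ g) {s p : ℕ → ℝ}
    (hs : |s 1| ≤ |η|) (hp : |p 1| ≤ |η|) : |modeParam ε η g s p| ≤ 4 * |η| := by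
  have hε := h.pos
  rw [modeParam]
  refine (abs_add_le _ _).trans ?_
  rw [abs_mul, abs_mul, abs_of_pos hε]
  have h1 : |ε * s 1 - η| ≤ ε * |η| + |η| := by
    refine (abs_sub _ _).trans ?_
    rw [abs_mul, abs_of_pos hε]
    gcongr
  have h2 : |3 * g 0 - 1| * |ε * s 1 - η| ≤ 3 * (ε * |η| + |η|) :=
    mul_le_mul h.abs_three_g_zero_sub_one_le h1 (abs_nonneg _) (by norm_num)
  have h3 : ε * |p 1| ≤ ε * |η| := by gcongr
  have h4 : ε * |η| ≤ 1 / 1000 * |η| := by gcongr; exact h.le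
  linarith [abs_nonneg η]

lemma abs_modeParam_sub_le (h : IsLocalizedProfile ε η ρ g) {s p s' p' : ℕ → ℝ} {D : ℝ}
    (hs : |s 1 - s' 1| ≤ D / 2) (hp : |p 1 - p' 1| ≤ D / 2) :
    |modeParam ε η g s p - modeParam ε η g s' p'| ≤ 2 * ε * D := by
  have hε := h.pos
  have e : modeParam ε η g s p - modeParam ε η g s' p' =
      (3 * g 0 - 1) * (ε * (s 1 - s' 1)) + ε * (p 1 - p' 1) := by
    simp only [modeParam]; ring
  rw [e]
  refine (abs_add_le _ _).trans ?_
  rw [abs_mul, abs_mul, abs_mul, abs_of_pos hε]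
  have h2 : |3 * g 0 - 1| * (ε * |s 1 - s' 1|) ≤ 3 * (ε * (D / 2)) := by
    gcongr
    exact h.abs_three_g_zero_sub_one_le
  have h3 : ε * |p 1 - p' 1| ≤ ε * (D / 2) := by gcongr
  linarith

/-- Every term carries a factor ε or |η| ≤ ε, and the weight (1/2)^k costs at most a factor 2 at the
left neighbour. -/
lemma modeMapFst_contraction (h : IsLocalizedProfile ε η ρ g) {s p s' p' : ℕ → ℝ} {D : ℝ}
    (hs : ∀ k, |s k| ≤ 2 * |η| * (1 / 2) ^ k)
    (hs' : ∀ k, |s' k| ≤ 2 * |η| * (1 / 2) ^ k) (hp' : ∀ k, |p' k| ≤ 2 * |η| * (1 / 2) ^ k)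
    (hsD : ∀ k, |s k - s' k| ≤ D * (1 / 2) ^ k) (hpD : ∀ k, |p k - p' k| ≤ D * (1 / 2) ^ k)
    (k : ℕ) : |modeMapFst ε η ρ g s p k - modeMapFst ε η ρ g s' p' k| ≤ D / 4 * (1 / 2) ^ k := by
  have hε := h.pos
  have hε' := h.le
  have hD : 0 ≤ D := by have := (abs_nonneg _).trans (hsD 0); simpa using this
  rcases k with _ | k
  · simp only [modeMapFst]
    have e : ε * s 1 - η - (ε * s' 1 - η) = ε * (s 1 - s' 1) := by ring
    rw [e, abs_mul, abs_of_pos hε]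
    have h1 := hsD 1
    calc ε * |s 1 - s' 1| ≤ 1 / 1000 * (D * (1 / 2) ^ 1) := by gcongr
      _ ≤ D / 4 * (1 / 2) ^ 0 := by norm_num; linarith
  · set W : ℝ := (1 / 2) ^ (k + 1) with hW
    have hW0 : 0 < W := by positivity
    have hWk : (1 / 2 : ℝ) ^ k = 2 * W := by rw [hW, pow_succ]; ring
    have hWk2 : (1 / 2 : ℝ) ^ (k + 2) = W / 2 := by rw [hW, pow_succ]; ring
    set Z := modeParam ε η g s p with hZ
    set Z' := modeParam ε η g s' p' with hZ'
    have e : modeMapFst ε η ρ g s p (k + 1) - modeMapFst ε η ρ g s' p' (k + 1) =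
        (-((Z - Z') * (ρ (k + 1) + s (k + 1))) - Z' * (s (k + 1) - s' (k + 1))) +
          (ε * (p k - p' k) + ε * (p (k + 2) - p' (k + 2))) +
          3 * g (k + 1) * (p (k + 1) - p' (k + 1)) := by
      simp only [modeMapFst, ← hZ, ← hZ']; ring
    have hZZ : |Z - Z'| ≤ 2 * ε * D := h.abs_modeParam_sub_le
      (by have := hsD 1; rwa [pow_one, mul_one_div] at this)
      (by have := hpD 1; rwa [pow_one, mul_one_div] at this)
    have hZ'1 : |Z'| ≤ 4 * |η| := h.abs_modeParam_le
      (by have := hs' 1; linarith) (by have := hp' 1; linarith)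
    have hρs : |ρ (k + 1) + s (k + 1)| ≤ 2 * W := by
      refine (abs_add_le _ _).trans ?_
      have h1 := h.rho_le_half (k + 1)
      have h2 := hs (k + 1)
      have h3 : 2 * |η| * W ≤ 1 * W := by gcongr; linarith [h.eta_le]
      linarith
    have t1 : |(Z - Z') * (ρ (k + 1) + s (k + 1))| ≤ 2 * ε * D * (2 * W) := by
      rw [abs_mul]; gcongr
    have t2 : |Z' * (s (k + 1) - s' (k + 1))| ≤ 4 * ε * (D * W) := by
      rw [abs_mul]
      gcongr
      · exact hZ'1.trans (by linarith [h.eta_le])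
      · exact hsD (k + 1)
    have t3 : |ε * (p k - p' k)| ≤ ε * (D * (2 * W)) := by
      rw [abs_mul, abs_of_pos hε, ← hWk]
      gcongr
      exact hpD k
    have t4 : |ε * (p (k + 2) - p' (k + 2))| ≤ ε * (D * (W / 2)) := by
      rw [abs_mul, abs_of_pos hε, ← hWk2]
      gcongr
      exact hpD (k + 2)
    have t5 : |3 * g (k + 1) * (p (k + 1) - p' (k + 1))| ≤ 3 * ε * (D * W) := by
      rw [abs_mul, abs_mul, abs_of_pos (three_pos : (0 : ℝ) < 3)]
      gcongr
      · exact h.g_succ_le k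
      · exact hpD (k + 1)
    rw [e]
    refine (abs_add_three _ _ _).trans ?_
    have a1 := abs_sub (-((Z - Z') * (ρ (k + 1) + s (k + 1)))) (Z' * (s (k + 1) - s' (k + 1)))
    have a2 := abs_add_le (ε * (p k - p' k)) (ε * (p (k + 2) - p' (k + 2)))
    rw [abs_neg] at a1
    have hDW : 0 ≤ D * W := by positivity
    have hfin : ε * (D * W) ≤ 1 / 1000 * (D * W) := by gcongr
    nlinarith

/-- The equation for s contains p with coefficient -1, which by itself would not contract. Hence the
map inserts the updated first component, whose Lipschitz constant 1/4 leaves room for the remaining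
O(ε) terms. -/
lemma modeMapSnd_contraction (h : IsLocalizedProfile ε η ρ g) {s p s' p' : ℕ → ℝ} {D : ℝ}
    (hs : ∀ k, |s k| ≤ 2 * |η| * (1 / 2) ^ k)
    (hs' : ∀ k, |s' k| ≤ 2 * |η| * (1 / 2) ^ k) (hp' : ∀ k, |p' k| ≤ 2 * |η| * (1 / 2) ^ k)
    (hsD : ∀ k, |s k - s' k| ≤ D * (1 / 2) ^ k) (hpD : ∀ k, |p k - p' k| ≤ D * (1 / 2) ^ k)
    (k : ℕ) : |modeMapSnd ε η ρ g s p k - modeMapSnd ε η ρ g s' p' k| ≤ D / 2 * (1 / 2) ^ k := by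
  have hε := h.pos
  have hε' := h.le
  have hD : 0 ≤ D := by have := (abs_nonneg _).trans (hsD 0); simpa using this
  rcases k with _ | k
  · simp only [modeMapSnd, sub_self, abs_zero]
    positivity
  · have hF := h.modeMapFst_contraction hs hs' hp' hsD hpD (k + 1)
    set W : ℝ := (1 / 2) ^ (k + 1) with hW
    have hWk : (1 / 2 : ℝ) ^ k = 2 * W := by rw [hW, pow_succ]; ring
    have hWk2 : (1 / 2 : ℝ) ^ (k + 2) = W / 2 := by rw [hW, pow_succ]; ring
    have e : modeMapSnd ε η ρ g s p (k + 1) - modeMapSnd ε η ρ g s' p' (k + 1) =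
        -(modeMapFst ε η ρ g s p (k + 1) - modeMapFst ε η ρ g s' p' (k + 1)) +
          (ε * (s k - s' k) + ε * (s (k + 2) - s' (k + 2))) +
          g (k + 1) * (s (k + 1) - s' (k + 1)) := by
      simp only [modeMapSnd]; ring
    have t3 : |ε * (s k - s' k)| ≤ ε * (D * (2 * W)) := by
      rw [abs_mul, abs_of_pos hε, ← hWk]
      gcongr
      exact hsD k
    have t4 : |ε * (s (k + 2) - s' (k + 2))| ≤ ε * (D * (W / 2)) := by
      rw [abs_mul, abs_of_pos hε, ← hWk2]
      gcongr
      exact hsD (k + 2)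
    have t5 : |g (k + 1) * (s (k + 1) - s' (k + 1))| ≤ ε * (D * W) := by
      rw [abs_mul]
      gcongr
      · exact h.g_succ_le k
      · exact hsD (k + 1)
    rw [e]
    refine (abs_add_three _ _ _).trans ?_
    have a2 := abs_add_le (ε * (s k - s' k)) (ε * (s (k + 2) - s' (k + 2)))
    rw [abs_neg]
    have hDW : 0 ≤ D * W := by positivity
    have hfin : ε * (D * W) ≤ 1 / 1000 * (D * W) := by gcongr
    nlinarith

/-- Write r = ρ + s with s_0 = 0. Since L₋ρ = -ηδ_0, the first-site equation L₋r = p reads p_0 =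
εs_1 - η, and L₊p = ζr at the first site then defines ζ. The equations at the other sites are solved
for their diagonal terms -p and -s, which gives the fixed point map. -/
lemma exists_realMode (h : IsLocalizedProfile ε η ρ g) :
    ∃ (ζ : ℝ) (p r : ℕ → ℝ), IsRealMode ε η ρ g ζ p r := by
  have hε := h.pos
  obtain ⟨x, hxb, hx⟩ := exists_fixedPoint_of_weighted_contraction
    (fun i : ℕ ⊕ ℕ => (1 / 2 : ℝ) ^ (Sum.elim id id i : ℕ)) (2 * |η|)
    (fun x => Sum.elim (modeMapSnd ε η ρ g (x ∘ Sum.inl) (x ∘ Sum.inr))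
      (modeMapFst ε η ρ g (x ∘ Sum.inl) (x ∘ Sum.inr)))
    (by
      have e : 2 * |η| / 2 = |η| := by ring
      rw [e]
      rintro (k | k)
      · exact (h.modeMap_bound_zero k).2
      · exact (h.modeMap_bound_zero k).1)
    (by
      intro x y D hx hy hD i
      have hs : ∀ k, |(x ∘ Sum.inl) k| ≤ 2 * |η| * (1 / 2) ^ k := fun k => hx (Sum.inl k)
      have hs' : ∀ k, |(y ∘ Sum.inl) k| ≤ 2 * |η| * (1 / 2) ^ k := fun k => hy (Sum.inl k)
      have hp' : ∀ k, |(y ∘ Sum.inr) k| ≤ 2 * |η| * (1 / 2) ^ k := fun k => hy (Sum.inr k)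
      have hsD : ∀ k, |(x ∘ Sum.inl) k - (y ∘ Sum.inl) k| ≤ D * (1 / 2) ^ k :=
        fun k => hD (Sum.inl k)
      have hpD : ∀ k, |(x ∘ Sum.inr) k - (y ∘ Sum.inr) k| ≤ D * (1 / 2) ^ k :=
        fun k => hD (Sum.inr k)
      rcases i with k | k
      · exact h.modeMapSnd_contraction hs hs' hp' hsD hpD k
      · refine (h.modeMapFst_contraction hs hs' hp' hsD hpD k).trans ?_
        have : 0 ≤ D := by have := (abs_nonneg _).trans (hsD 0); simpa using this
        simp only [Sum.elim_inr, id]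
        gcongr
        norm_num)
  set s : ℕ → ℝ := x ∘ Sum.inl with hs
  set p : ℕ → ℝ := x ∘ Sum.inr with hp
  have hsb : ∀ k, |s k| ≤ 2 * |η| * (1 / 2) ^ k := fun k => hxb (Sum.inl k)
  have hpb : ∀ k, |p k| ≤ 2 * |η| * (1 / 2) ^ k := fun k => hxb (Sum.inr k)
  have hsx : ∀ k, modeMapSnd ε η ρ g s p k = s k := fun k => congrFun hx (Sum.inl k)
  have hpx : ∀ k, modeMapFst ε η ρ g s p k = p k := fun k => congrFun hx (Sum.inr k)
  have hs0 : s 0 = 0 := (hsx 0).symm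
  have hp0 : p 0 = ε * s 1 - η := (hpx 0).symm
  have hs1 : |s 1| ≤ |η| := by have := hsb 1; linarith
  have hp1 : |p 1| ≤ |η| := by have := hpb 1; linarith
  have e1 : |ε * s 1| ≤ ε * |η| := by
    rw [abs_mul, abs_of_pos hε]; gcongr
  refine ⟨modeParam ε η g s p, p, fun k => ρ k + s k, ?_, ?_, hpb, fun k => ?_, ?_, ?_, ?_⟩
  -- The three summands contribute 3, 3 and 1 times ε|η|.
  · have e : modeParam ε η g s p + 2 * η =
        -(3 * ((g 0 - 1) * η)) + (3 * g 0 - 1) * (ε * s 1) + ε * p 1 := by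
      rw [modeParam]; ring
    rw [e]
    refine (abs_add_three _ _ _).trans ?_
    have e2 : |3 * g 0 - 1| * |ε * s 1| ≤ 3 * (ε * |η|) :=
      mul_le_mul h.abs_three_g_zero_sub_one_le e1 (abs_nonneg _) (by norm_num)
    have e3 : |g 0 - 1| * |η| ≤ ε * |η| := by gcongr; exact h.g_zero
    have e4 : ε * |p 1| ≤ ε * |η| := by gcongr
    rw [abs_neg, abs_mul, abs_mul, abs_mul (3 * g 0 - 1), abs_mul ε (p 1), abs_of_pos hε,
      abs_of_pos (three_pos : (0 : ℝ) < 3)]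
    linarith
  · rw [hp0, sub_add_cancel]
    linarith [(abs_nonneg _).trans e1]
  · rw [add_sub_cancel_left]
    exact hsb k
  · simp only [hs0, h.rho_zero, add_zero]
  · intro k
    rcases k with _ | k
    · simp only [nbr, hs0, h.rho_zero, hp0]
      linear_combination h.eq_zero
    · have h1 := hsx (k + 1)
      have h2 := h.eq_succ k
      simp only [modeMapSnd, hpx] at h1
      simp only [nbr]
      linear_combination h2 + h1
  · intro k
    rcases k with _ | k
    · simp only [nbr, hs0, h.rho_zero, hp0, modeParam]
      ring
    · have h1 := hpx (k + 1)
      simp only [modeMapFst] at h1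
      simp only [nbr]
      linear_combination h1

end IsLocalizedProfile

/-! ### Properties and uniqueness of the mode -/

lemma eq_zero_of_norm_le_half {ι : Type*} {x : ι → ℂ} (hx : BddAbove (Set.range fun i => ‖x i‖))
    (h : ∀ B, (∀ i, ‖x i‖ ≤ B) → ∀ i, ‖x i‖ ≤ B / 2) (i : ι) : x i = 0 := by
  have := le_of_bootstrap (a := 0) hx (fun B hB i => by rw [zero_add]; exact h B hB i) i
  rw [mul_zero] at this
  exact norm_le_zero_iff.1 this

lemma norm_ofReal_mul (a : ℝ) (x : ℂ) : ‖(a : ℂ) * x‖ = |a| * ‖x‖ := by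
  rw [norm_mul, Complex.norm_real, Real.norm_eq_abs]

lemma norm_nbr_succ_le {ε B : ℝ} {x : ℕ → ℂ} (hε : 0 ≤ ε) (hx : ∀ k, ‖x k‖ ≤ B) (k : ℕ) :
    ‖(ε : ℂ) * nbr x (k + 1)‖ ≤ 2 * ε * B := by
  rw [norm_ofReal_mul, abs_of_nonneg hε]
  have : ‖nbr x (k + 1)‖ ≤ B + B := (norm_add_le _ _).trans (add_le_add (hx _) (hx _))
  nlinarith

lemma norm_nbr_zero_le {ε B : ℝ} {x : ℕ → ℂ} (hε : 0 ≤ ε) (hx : ∀ k, ‖x k‖ ≤ B) :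
    ‖(ε : ℂ) * nbr x 0‖ ≤ ε * B := by
  rw [norm_ofReal_mul, abs_of_nonneg hε]
  exact mul_le_mul_of_nonneg_left (hx 1) hε

namespace IsRealMode

variable {ε η ζ : ℝ} {ρ g p r : ℕ → ℝ}

lemma eq_r_complex (R : IsRealMode ε η ρ g ζ p r) (k : ℕ) :
    (ε : ℂ) * nbr (fun k => (r k : ℂ)) k + (g k - 1) * r k = p k := by
  have := R.eq_r k
  rcases k with _ | k <;> simp only [nbr] at this ⊢ <;> exact_mod_cast this

lemma eq_p_complex (R : IsRealMode ε η ρ g ζ p r) (k : ℕ) :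
    (ε : ℂ) * nbr (fun k => (p k : ℂ)) k + (3 * g k - 1) * p k = ζ * r k := by
  have := R.eq_p k
  rcases k with _ | k <;> simp only [nbr] at this ⊢ <;> exact_mod_cast this

/-- Inverts p = v + w, zr = v - w; both square roots of ζ thus give modes. -/
lemma isMode (R : IsRealMode ε η ρ g ζ p r) {z : ℂ} (hz : z ^ 2 = ζ) :
    IsMode ε g z (fun k => (p k + z * r k) / 2) (fun k => (p k - z * r k) / 2) := by
  intro k
  have h1 := R.eq_r_complex k
  have h2 := R.eq_p_complex k
  rcases k with _ | k <;> simp only [nbr] at h1 h2 ⊢ <;> constructor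
  · linear_combination (r 0 / 2 : ℂ) * hz - z / 2 * h1 - 1 / 2 * h2
  · linear_combination (r 0 / 2 : ℂ) * hz + z / 2 * h1 - 1 / 2 * h2
  · linear_combination (r (k + 1) / 2 : ℂ) * hz - z / 2 * h1 - 1 / 2 * h2
  · linear_combination (r (k + 1) / 2 : ℂ) * hz + z / 2 * h1 - 1 / 2 * h2

lemma abs_r_le (h : IsLocalizedProfile ε η ρ g) (R : IsRealMode ε η ρ g ζ p r) (k : ℕ) :
    |r k| ≤ 2 * (1 / 2) ^ k := by
  have h1 := R.r_le k
  have h2 := h.rho_le_half k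
  have h3 := abs_sub_abs_le_abs_sub (r k) (ρ k)
  have h4 : 2 * |η| * (1 / 2) ^ k ≤ 1 * (1 / 2) ^ k := by
    gcongr
    linarith [h.eta_le, h.le]
  linarith

lemma abs_r_succ_le (h : IsLocalizedProfile ε η ρ g) (R : IsRealMode ε η ρ g ζ p r) (k : ℕ) :
    |r (k + 1)| ≤ 3 * ε * (1 / 2) ^ k := by
  have hε := h.pos
  have h1 := R.r_le (k + 1)
  have h2 : |ρ (k + 1)| ≤ 2 * ε * (1 / 2) ^ k := by
    refine (h.rho_le (k + 1)).trans ?_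
    rw [pow_succ, mul_comm]
    gcongr
    linarith [h.le]
  have h3 := abs_sub_abs_le_abs_sub (r (k + 1)) (ρ (k + 1))
  have h4 : 2 * |η| * (1 / 2) ^ (k + 1) ≤ ε * (1 / 2) ^ k := by
    calc 2 * |η| * (1 / 2) ^ (k + 1) = |η| * (1 / 2) ^ k := by rw [pow_succ]; ring
      _ ≤ _ := by gcongr; exact h.eta_le
  linarith

/-- The term p_0 r_0 ≈ -η dominates: later terms gain a factor ε from r and add up to at most 4ε|η|.
This pairing with the adjoint eigenvector is what makes the eigenvalues algebraically simple. -/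
lemma tsum_mul_ne_zero (h : IsLocalizedProfile ε η ρ g) (R : IsRealMode ε η ρ g ζ p r) :
    ∑' k, p k * r k ≠ 0 := by
  have hε := h.pos
  have hη : 0 < |η| := abs_pos.2 h.eta_ne
  have hb : ∀ k, ‖p (k + 1) * r (k + 1)‖ ≤ 3 * ε * |η| * (1 / 4) ^ k := by
    intro k
    rw [Real.norm_eq_abs, abs_mul]
    calc |p (k + 1)| * |r (k + 1)| ≤ (2 * |η| * (1 / 2) ^ (k + 1)) * (3 * ε * (1 / 2) ^ k) :=
          mul_le_mul (R.p_le _) (R.abs_r_succ_le h k) (abs_nonneg _) (by positivity)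
      _ = 3 * ε * |η| * ((1 / 2) ^ k * (1 / 2) ^ k) := by rw [pow_succ]; ring
      _ = _ := by rw [← mul_pow]; norm_num
  have hg : HasSum (fun k : ℕ => 3 * ε * |η| * (1 / 4) ^ k) (3 * ε * |η| * (1 - 1 / 4)⁻¹) :=
    (hasSum_geometric_of_lt_one (by norm_num) (by norm_num)).mul_left _
  have hsum : Summable fun k => p (k + 1) * r (k + 1) :=
    Summable.of_norm_bounded hg.summable hb
  have hle : ‖∑' k, p (k + 1) * r (k + 1)‖ ≤ 3 * ε * |η| * (1 - 1 / 4)⁻¹ :=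
    tsum_of_norm_bounded hg hb
  have hsum0 : Summable fun k => p k * r k := (summable_nat_add_iff 1).1 hsum
  rw [hsum0.tsum_eq_zero_add, R.r_zero, mul_one]
  intro h0
  have h1 : |η| ≤ |p 0 + η| + |p 0| := by
    have := abs_sub (p 0 + η) (p 0)
    rwa [add_sub_cancel_left] at this
  have h2 : |p 0| = ‖∑' k, p (k + 1) * r (k + 1)‖ := by
    rw [eq_neg_of_add_eq_zero_left h0, abs_neg, Real.norm_eq_abs]
  have h3 := R.p_zero_le
  have h4 : ε * |η| ≤ 1 / 1000 * |η| := by gcongr; exact h.le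
  norm_num at hle
  rw [Real.norm_eq_abs] at h2
  nlinarith

end IsRealMode

namespace IsLocalizedProfile

variable {ε η ζ : ℝ} {ρ g p r : ℕ → ℝ}

lemma norm_g_mul_le (h : IsLocalizedProfile ε η ρ g) {x : ℂ} {B : ℝ} (hx : ‖x‖ ≤ B) (k : ℕ) :
    ‖(g (k + 1) : ℂ) * x‖ ≤ ε * B := by
  rw [norm_ofReal_mul]
  exact mul_le_mul (h.g_succ_le k) hx (norm_nonneg _) h.pos.le

/-- Uniqueness for the linear system satisfied by differences of modes. -/
lemma difference_eq_zero (h : IsLocalizedProfile ε η ρ g) {s P : ℕ → ℂ} {Z δ : ℂ} {r : ℕ → ℝ}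
    (hs : Tendsto s atTop (𝓝 0)) (hP : Tendsto P atTop (𝓝 0)) (hZ : ‖Z‖ ≤ 1 / 8)
    (hr0 : r 0 = 1) (hr : ∀ k, |r k| ≤ 2) (hs0 : s 0 = 0)
    (h1 : ∀ k, (ε : ℂ) * nbr s k + (g k - 1) * s k = P k)
    (h2 : ∀ k, (ε : ℂ) * nbr P k + (3 * g k - 1) * P k = Z * s k + δ * r k) :
    (∀ k, s k = 0 ∧ P k = 0) ∧ δ = 0 := by
  have hε := h.pos
  have hε' := h.le
  -- The normalization s_0 = 0 makes P_0, and through the first-site equation also δ, of size ε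
  -- times the supremum. The only remaining term not of order ε is Z s, and ‖Z‖ ≤ 1/8 suffices to
  -- close the bootstrap.
  have hP0 : P 0 = ε * nbr s 0 := by rw [← h1 0, hs0]; ring
  have hδ : δ = ε * nbr P 0 + ((3 * g 0 - 1 : ℝ) : ℂ) * P 0 := by
    have := h2 0
    rw [hs0, hr0, Complex.ofReal_one] at this
    push_cast
    linear_combination -this
  have key : ∀ k, s k = 0 ∧ P k = 0 := by
    intro k
    have := le_of_bootstrap (a := 0) (bddAbove_max_norm hs hP) (fun B hB => by
      have hsB : ∀ k, ‖s k‖ ≤ B := fun k => (le_max_left _ _).trans (hB k)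
      have hPB : ∀ k, ‖P k‖ ≤ B := fun k => (le_max_right _ _).trans (hB k)
      have hB0 : 0 ≤ B := (norm_nonneg _).trans (hsB 0)
      have hεB : ε * B ≤ 1 / 1000 * B := by gcongr
      have hP0B : ‖P 0‖ ≤ ε * B := by rw [hP0]; exact norm_nbr_zero_le hε.le hsB
      have hδB : ‖δ‖ ≤ 4 * (ε * B) := by
        rw [hδ]
        refine (norm_add_le _ _).trans ?_
        have e1 := norm_nbr_zero_le hε.le hPB
        have e2 : ‖((3 * g 0 - 1 : ℝ) : ℂ) * P 0‖ ≤ 3 * (ε * B) := by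
          rw [norm_ofReal_mul]
          exact mul_le_mul h.abs_three_g_zero_sub_one_le hP0B (norm_nonneg _) (by norm_num)
        linarith
      have hPs : ∀ k, ‖P (k + 1)‖ ≤ B / 8 + 13 * (ε * B) := by
        intro k
        have e : P (k + 1) = (ε * nbr P (k + 1) + 3 * (g (k + 1) * P (k + 1))) -
            (Z * s (k + 1) + δ * r (k + 1)) := by
          rw [← h2 (k + 1)]; ring
        rw [e]
        have a1 := norm_sub_le ((ε : ℂ) * nbr P (k + 1) + 3 * (g (k + 1) * P (k + 1)))
            (Z * s (k + 1) + δ * r (k + 1))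
        have a2 := norm_add_le ((ε : ℂ) * nbr P (k + 1)) (3 * (g (k + 1) * P (k + 1)))
        have a3 := norm_add_le (Z * s (k + 1)) (δ * r (k + 1))
        rw [norm_mul 3, Complex.norm_ofNat] at a2
        rw [norm_mul, norm_mul, Complex.norm_real, Real.norm_eq_abs] at a3
        have b1 := norm_nbr_succ_le hε.le hPB k
        have b2 := h.norm_g_mul_le (hPB (k + 1)) k
        have b3 : ‖Z‖ * ‖s (k + 1)‖ ≤ 1 / 8 * B := mul_le_mul hZ (hsB _) (norm_nonneg _) (by norm_num)
        have b4 : ‖δ‖ * |r (k + 1)| ≤ 4 * (ε * B) * 2 :=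
          mul_le_mul hδB (hr _) (abs_nonneg _) (by positivity)
        linarith
      intro i
      rw [zero_add]
      rcases i with _ | k
      · refine max_le ?_ ?_
        · rw [hs0, norm_zero]; positivity
        · linarith
      · refine max_le ?_ (by linarith [hPs k])
        have e : s (k + 1) = ε * nbr s (k + 1) + g (k + 1) * s (k + 1) - P (k + 1) := by
          rw [← h1 (k + 1)]; ring
        rw [e]
        have a1 := norm_sub_le ((ε : ℂ) * nbr s (k + 1) + g (k + 1) * s (k + 1)) (P (k + 1))
        have a2 := norm_add_le ((ε : ℂ) * nbr s (k + 1)) (g (k + 1) * s (k + 1))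
        have b1 := norm_nbr_succ_le hε.le hsB k
        have b2 := h.norm_g_mul_le (hsB (k + 1)) k
        linarith [hPs k]) k
    rw [mul_zero] at this
    exact ⟨norm_le_zero_iff.1 ((le_max_left _ _).trans this),
      norm_le_zero_iff.1 ((le_max_right _ _).trans this)⟩
  refine ⟨key, ?_⟩
  rw [hδ, (key 0).2, nbr, (key 1).2]
  ring

/-- Zero is not an eigenvalue. -/
lemma kernel_eq_zero (h : IsLocalizedProfile ε η ρ g) {p q : ℕ → ℂ}
    (hp : Tendsto p atTop (𝓝 0)) (hq : Tendsto q atTop (𝓝 0))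
    (h1 : ∀ k, (ε : ℂ) * nbr q k + (g k - 1) * q k = 0)
    (h2 : ∀ k, (ε : ℂ) * nbr p k + (3 * g k - 1) * p k = 0) (k : ℕ) : p k = 0 ∧ q k = 0 := by
  have hε := h.pos
  have hε' := h.le
  constructor
  -- L₊ is diagonally dominant: its diagonal is near 2 at the first site and near -1 elsewhere.
  · refine eq_zero_of_norm_le_half hp.norm.bddAbove_range (fun B hB i => ?_) k
    have hB0 : 0 ≤ B := (norm_nonneg _).trans (hB 0)
    have hεB : ε * B ≤ 1 / 1000 * B := by gcongr
    rcases i with _ | k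
    · have e : p 0 = -(1 / 2) * (ε * nbr p 0) - 3 / 2 * (((g 0 - 1 : ℝ) : ℂ) * p 0) := by
        push_cast
        linear_combination (1 / 2) * h2 0
      rw [e]
      refine (norm_sub_le _ _).trans ?_
      have a1 := norm_nbr_zero_le hε.le hB
      have a2 : ‖((g 0 - 1 : ℝ) : ℂ) * p 0‖ ≤ ε * B := by
        rw [norm_ofReal_mul]
        exact mul_le_mul h.g_zero (hB 0) (norm_nonneg _) hε.le
      have b1 : ‖-(1 / 2 : ℂ)‖ = 1 / 2 := by norm_num
      have b2 : ‖(3 / 2 : ℂ)‖ = 3 / 2 := by norm_num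
      rw [norm_mul, norm_mul (3 / 2 : ℂ), b1, b2]
      linarith
    · have e : p (k + 1) = ε * nbr p (k + 1) + 3 * (g (k + 1) * p (k + 1)) := by
        linear_combination -h2 (k + 1)
      rw [e]
      refine (norm_add_le _ _).trans ?_
      have a1 := norm_nbr_succ_le hε.le hB k
      have a2 := h.norm_g_mul_le (hB (k + 1)) k
      rw [norm_mul 3, Complex.norm_ofNat]
      linarith
  -- Away from the first site L₋ annihilates ρ and determines a decaying solution from q_0, so q =
  -- q_0 ρ. The first-site equation becomes q_0 η = 0, and the driving η ≠ 0 excludes a kernel.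
  · set s : ℕ → ℂ := fun k => q k - q 0 * ρ k with hs
    have hρ : Tendsto (fun k => (ρ k : ℂ)) atTop (𝓝 0) := by
      rw [tendsto_zero_iff_norm_tendsto_zero]
      refine squeeze_zero (fun _ => norm_nonneg _) (fun k => ?_)
        (tendsto_pow_atTop_nhds_zero_of_lt_one (r := (1 / 2 : ℝ)) (by norm_num) (by norm_num))
      rw [Complex.norm_real]
      exact h.rho_le_half k
    have hst : Tendsto s atTop (𝓝 0) := by
      simpa using hq.sub (hρ.const_mul (q 0))
    have hs0 : s 0 = 0 := by simp [hs, h.rho_zero]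
    have hsucc : ∀ k, s (k + 1) = ε * nbr s (k + 1) + g (k + 1) * s (k + 1) := by
      intro k
      have e1 := h1 (k + 1)
      have e2 : (ε * (ρ k + ρ (k + 2)) + (g (k + 1) - 1) * ρ (k + 1) : ℂ) = 0 := by
        exact_mod_cast h.eq_succ k
      simp only [nbr, hs] at e1 ⊢
      linear_combination -e1 + q 0 * e2
    have hz : ∀ k, s k = 0 := by
      refine eq_zero_of_norm_le_half hst.norm.bddAbove_range (fun B hB i => ?_)
      have hB0 : 0 ≤ B := (norm_nonneg _).trans (hB 0)
      have hεB : ε * B ≤ 1 / 1000 * B := by gcongr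
      rcases i with _ | k
      · rw [hs0, norm_zero]; positivity
      · rw [hsucc]
        refine (norm_add_le _ _).trans ?_
        have a1 := norm_nbr_succ_le hε.le hB k
        have a2 := h.norm_g_mul_le (hB (k + 1)) k
        linarith
    have hq' : ∀ k, q k = q 0 * ρ k := fun k => sub_eq_zero.1 (hz k)
    have hq0 : q 0 = 0 := by
      have e1 := h1 0
      have e2 : (ε * ρ 1 + (g 0 - 1) : ℂ) = -η := by exact_mod_cast h.eq_zero
      simp only [nbr] at e1
      rw [hq' 1] at e1
      have e3 : q 0 * η = 0 := by linear_combination -e1 + q 0 * e2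
      exact (mul_eq_zero.1 e3).resolve_right (by exact_mod_cast h.eta_ne)
    rw [hq' k, hq0, zero_mul]

/-- Every mode is a multiple of the real mode. -/
lemma mode_eq (h : IsLocalizedProfile ε η ρ g) (R : IsRealMode ε η ρ g ζ p r) {z : ℂ}
    {v w : ℕ → ℂ} (hm : IsMode ε g z v w) (hv : Tendsto v atTop (𝓝 0))
    (hw : Tendsto w atTop (𝓝 0)) (hne : ∃ k, v k ≠ 0 ∨ w k ≠ 0) :
    z ^ 2 = ζ ∧ ∃ c : ℂ, ∀ k, v k = c * ((p k + z * r k) / 2) ∧ w k = c * ((p k - z * r k) / 2) := by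
  have hZ := h.norm_sq_le hm hv hw hne
  have hr : ∀ k, |r k| ≤ 2 := fun k => (R.abs_r_le h k).trans
    (mul_le_of_le_one_right (by norm_num) (pow_le_one₀ (by norm_num) (by norm_num)))
  have hrt : Tendsto (fun k => (r k : ℂ)) atTop (𝓝 0) := by
    rw [tendsto_zero_iff_norm_tendsto_zero]
    refine squeeze_zero (fun _ => norm_nonneg _) (g := fun k => 2 * (1 / 2 : ℝ) ^ k) (fun k => ?_) ?_
    · rw [Complex.norm_real]
      exact R.abs_r_le h k
    · simpa using (tendsto_pow_atTop_nhds_zero_of_lt_one (r := (1 / 2 : ℝ)) (by norm_num)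
        (by norm_num)).const_mul 2
  have hpt : Tendsto (fun k => (p k : ℂ)) atTop (𝓝 0) := by
    rw [tendsto_zero_iff_norm_tendsto_zero]
    refine squeeze_zero (fun _ => norm_nonneg _) (g := fun k => 2 * |η| * (1 / 2 : ℝ) ^ k)
      (fun k => ?_) ?_
    · rw [Complex.norm_real]
      exact R.p_le k
    · simpa using (tendsto_pow_atTop_nhds_zero_of_lt_one (r := (1 / 2 : ℝ)) (by norm_num)
        (by norm_num)).const_mul (2 * |η|)
  have hnbr_sub : ∀ (x y : ℕ → ℂ) (c : ℂ) k, nbr (fun k => x k - c * y k) k =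
      nbr x k - c * nbr y k := by
    intro x y c k
    rcases k with _ | k <;> simp only [nbr] ; ring
  have hnbr_add : ∀ (x y : ℕ → ℂ) k, nbr (fun k => x k + y k) k = nbr x k + nbr y k := by
    intro x y k
    rcases k with _ | k <;> simp only [nbr] ; ring
  have hnbr_sub' : ∀ (x y : ℕ → ℂ) k, nbr (fun k => x k - y k) k = nbr x k - nbr y k := by
    intro x y k
    rcases k with _ | k <;> simp only [nbr] ; ring
  have hq1 : ∀ k, (ε : ℂ) * nbr (fun k => v k - w k) k + (g k - 1) * (v k - w k) =
      z * (v k + w k) := by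
    intro k
    rw [hnbr_sub']
    linear_combination -(hm k).1 + (hm k).2
  have hp1 : ∀ k, (ε : ℂ) * nbr (fun k => v k + w k) k + (3 * g k - 1) * (v k + w k) =
      z * (v k - w k) := by
    intro k
    rw [hnbr_add]
    linear_combination -(hm k).1 - (hm k).2
  by_cases hz0 : z = 0
  · exfalso
    have := h.kernel_eq_zero (p := fun k => v k + w k) (q := fun k => v k - w k)
      (by simpa using hv.add hw) (by simpa using hv.sub hw)
      (fun k => by rw [hq1, hz0, zero_mul]) (fun k => by rw [hp1, hz0, zero_mul])
    obtain ⟨k, hk⟩ := hne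
    have e1 : v k = 0 := by linear_combination (1 / 2) * (this k).1 + (1 / 2) * (this k).2
    have e2 : w k = 0 := by linear_combination (1 / 2) * (this k).1 - (1 / 2) * (this k).2
    exact hk.elim (· e1) (· e2)
  -- This c makes z⁻¹(v - w) - cr vanish at the first site. The difference from c times the real
  -- mode solves the system of `difference_eq_zero` with δ = c(z² - ζ), so δ = 0 also identifies z².
  · set c : ℂ := (v 0 - w 0) / z with hc
    have hcz : c * z = v 0 - w 0 := div_mul_cancel₀ _ hz0
    obtain ⟨hsP, hδ⟩ := h.difference_eq_zero (s := fun k => z⁻¹ * (v k - w k) - c * r k)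
      (P := fun k => v k + w k - c * p k) (Z := z ^ 2) (δ := c * (z ^ 2 - ζ)) (r := r)
      (by simpa using ((hv.sub hw).const_mul z⁻¹).sub (hrt.const_mul c))
      (by simpa using (hv.add hw).sub (hpt.const_mul c)) hZ R.r_zero hr
      (by simp only [R.r_zero, ← hcz]; field_simp; push_cast; ring)
      (fun k => by
        have e : nbr (fun k => z⁻¹ * (v k - w k)) k = z⁻¹ * nbr (fun k => v k - w k) k := by
          rcases k with _ | k <;> simp only [nbr]; ring
        rw [hnbr_sub, e]
        have h1 := hq1 k
        have h2 := R.eq_r_complex k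
        have h3 : z⁻¹ * z = 1 := inv_mul_cancel₀ hz0
        linear_combination z⁻¹ * h1 - c * h2 + (v k + w k) * h3)
      (fun k => by
        rw [hnbr_sub]
        have h1 := hp1 k
        have h2 := R.eq_p_complex k
        have h3 : z⁻¹ * z = 1 := inv_mul_cancel₀ hz0
        linear_combination h1 - c * h2 - z * (v k - w k) * h3)
    have hsol : ∀ k, v k = c * ((p k + z * r k) / 2) ∧ w k = c * ((p k - z * r k) / 2) := by
      intro k
      obtain ⟨h1, h2⟩ := hsP k
      have h3 : z⁻¹ * z = 1 := inv_mul_cancel₀ hz0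
      constructor
      · linear_combination (1 / 2) * h2 + (z / 2) * h1 - (1 / 2) * (v k - w k) * h3
      · linear_combination (1 / 2) * h2 - (z / 2) * h1 + (1 / 2) * (v k - w k) * h3
    refine ⟨?_, c, hsol⟩
    have hc0 : c ≠ 0 := by
      rintro hc0
      obtain ⟨k, hk⟩ := hne
      have := hsol k
      rw [hc0, zero_mul, zero_mul] at this
      exact hk.elim (· this.1) (· this.2)
    exact sub_eq_zero.1 ((mul_eq_zero.1 hδ).resolve_left hc0)

end IsLocalizedProfile

/-! ## Coercive operators and perturbations of finite rank -/

/-- A Lax–Milgram argument twisted by J: coercivity bounds T from below, hence T is injective with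
closed range. A vector Ju orthogonal to the range satisfies ⟨Ju, Tu⟩ = 0, so u = 0. -/
lemma bijective_of_coercive {X : Type*} [NormedAddCommGroup X] [InnerProductSpace ℂ X]
    [CompleteSpace X] (T : X →L[ℂ] X) (J : X → X) (hJ : ∀ u, ‖J u‖ = ‖u‖)
    (hJs : Function.Surjective J) {c : ℝ} (hc : 0 < c)
    (h : ∀ u, c * ‖u‖ ^ 2 ≤ ‖inner ℂ (J u) (T u)‖) : Function.Bijective T := by
  have hlow : ∀ u, c * ‖u‖ ≤ ‖T u‖ := by
    intro u
    rcases (norm_nonneg u).eq_or_lt with h0 | h0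
    · rw [← h0, mul_zero]; exact norm_nonneg _
    · refine le_of_mul_le_mul_right ?_ h0
      have h1 := (h u).trans (norm_inner_le_norm (J u) (T u))
      rw [hJ] at h1
      linarith
  have hanti : AntilipschitzWith (c⁻¹).toNNReal T := by
    refine ContinuousLinearMap.antilipschitz_of_bound T fun u => ?_
    rw [Real.coe_toNNReal _ (inv_nonneg.2 hc.le), ← div_eq_inv_mul, le_div_iff₀ hc, mul_comm]
    exact hlow u
  refine ⟨hanti.injective, ?_⟩
  have hclosed : IsClosed (T.range : Set X) := hanti.isClosed_range T.uniformContinuous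
  have := hclosed.completeSpace_coe
  have htop : T.range = ⊤ := by
    rw [← Submodule.orthogonal_eq_bot_iff, Submodule.eq_bot_iff]
    intro y hy
    obtain ⟨u, rfl⟩ := hJs y
    have h1 : inner ℂ (T u) (J u) = 0 := (Submodule.mem_orthogonal _ _).1 hy _ ⟨u, rfl⟩
    have h2 := h u
    rw [← inner_conj_symm, h1, map_zero, norm_zero] at h2
    have h3 : ‖u‖ ^ 2 ≤ 0 := by
      by_contra! h4
      linarith [mul_pos hc h4]
    rw [← norm_eq_zero, hJ]
    exact pow_eq_zero_iff (two_ne_zero) |>.1 (le_antisymm h3 (sq_nonneg _))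
  exact LinearMap.range_eq_top.1 htop

/-- Factor S + F = S(1 + T) with T = S⁻¹F of finite rank. On the range of T, 1 + T is injective,
hence onto. If (1 + T)t = Ty' there, then y' - t solves (1 + T)x = y'. -/
lemma surjective_of_injective_of_finite_rank {V : Type*} [AddCommGroup V] [Module ℂ V]
    {S F : V →ₗ[ℂ] V} (hS : Function.Bijective S) [FiniteDimensional ℂ (LinearMap.range F)]
    (h : Function.Injective (S + F)) : Function.Surjective (S + F) := by
  set e := LinearEquiv.ofBijective S hS with he
  set T : V →ₗ[ℂ] V := e.symm.toLinearMap ∘ₗ F with hT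
  have hST : ∀ x, S (x + T x) = (S + F) x := by
    intro x
    have : S (T x) = F x := e.apply_symm_apply (F x)
    rw [map_add, this, LinearMap.add_apply]
  have hfin : FiniteDimensional ℂ (LinearMap.range T) := by
    rw [hT, LinearMap.range_comp]
    infer_instance
  set G : LinearMap.range T →ₗ[ℂ] LinearMap.range T :=
    LinearMap.id + (T.restrict (p := LinearMap.range T) (q := LinearMap.range T)
      (fun x _ => ⟨x, rfl⟩)) with hG
  have hGapp : ∀ x, (G x : V) = x + T x := fun x => rfl
  have hGinj : Function.Injective G := by
    intro x y hxy
    have h1 : (x : V) + T x = y + T y := by rw [← hGapp, ← hGapp, hxy]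
    have h2 : (S + F) (x : V) = (S + F) y := by rw [← hST, ← hST, h1]
    exact Subtype.ext (h h2)
  have hGsurj := LinearMap.injective_iff_surjective.1 hGinj
  intro y
  obtain ⟨y', rfl⟩ := hS.2 y
  obtain ⟨t, ht⟩ := hGsurj ⟨T y', ⟨y', rfl⟩⟩
  have ht' : (t : V) + T t = T y' := by rw [← hGapp, ht]
  refine ⟨y' - t, ?_⟩
  rw [← hST, map_sub]
  congr 1
  rw [← ht']
  abel

/-! ## Square-summable sequences -/

lemma EllTwo.tendsto_zero (u : EllTwo) : Tendsto (fun k => u k) atTop (𝓝 0) := by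
  rw [tendsto_zero_iff_norm_tendsto_zero]
  have h := (summable_sq u).tendsto_atTop_zero
  have h2 := h.sqrt
  simpa using h2

lemma EllTwo.ext_coe {u v : EllTwo} (h : ∀ k, u k = v k) : u = v := lp.ext (funext h)

lemma prevSite_add_nextSite (u : EllTwo) (k : ℕ) : prevSite u k + u (k + 1) = nbr u k := by
  rcases k with _ | k
  · simp [nbr]
  · rfl

lemma summable_mul_of_sq {x y : ℕ → ℂ} (hx : Summable fun k => ‖x k‖ ^ 2)
    (hy : Summable fun k => ‖y k‖ ^ 2) : Summable fun k => x k * y k := by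
  refine Summable.of_norm_bounded ((hx.add hy).mul_left (1 / 2)) fun k => ?_
  rw [norm_mul]
  nlinarith [sq_nonneg (‖x k‖ - ‖y k‖)]

lemma summable_sq_nbr {x : ℕ → ℂ} (hx : Summable fun k => ‖x k‖ ^ 2) :
    Summable fun k => ‖nbr x k‖ ^ 2 := by
  rw [← summable_nat_add_iff 1]
  refine Summable.of_nonneg_of_le (fun k => by positivity) (fun k => ?_)
    ((hx.add ((summable_nat_add_iff 2).2 hx)).mul_left 2)
  have h := norm_add_le (x k) (x (k + 2))
  have h2 : ‖nbr x (k + 1)‖ ^ 2 ≤ (‖x k‖ + ‖x (k + 2)‖) ^ 2 := by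
    simp only [nbr]; gcongr
  nlinarith [sq_nonneg (‖x k‖ - ‖x (k + 2)‖)]

/-- Summation by parts. -/
lemma tsum_mul_nbr {x y : ℕ → ℂ} (hx : Summable fun k => ‖x k‖ ^ 2)
    (hy : Summable fun k => ‖y k‖ ^ 2) : ∑' k, x k * nbr y k = ∑' k, nbr x k * y k := by
  have key : ∀ x y : ℕ → ℂ, Summable (fun k => ‖x k‖ ^ 2) → Summable (fun k => ‖y k‖ ^ 2) →
      ∑' k, x k * nbr y k = ∑' k, x (k + 1) * y k + ∑' k, x k * y (k + 1) := by
    intro x y hx hy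
    have hy1 := (summable_nat_add_iff 1).2 hy
    have hx1 := (summable_nat_add_iff 1).2 hx
    have ha := summable_mul_of_sq hx1 hy
    have hb := summable_mul_of_sq hx hy1
    rw [(summable_mul_of_sq hx (summable_sq_nbr hy)).tsum_eq_zero_add, hb.tsum_eq_zero_add]
    have : ∀ k, x (k + 1) * nbr y (k + 1) = x (k + 1) * y k + x (k + 1) * y (k + 1 + 1) := by
      intro k; simp only [nbr]; ring
    simp only [this]
    rw [ha.tsum_add ((summable_nat_add_iff 1).2 hb)]
    simp only [nbr]
    ring
  rw [key x y hx hy]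
  simp only [mul_comm (nbr x _)]
  rw [key y x hy hx, add_comm]
  simp only [mul_comm]

/-! ## The linearized operator -/

lemma rhsOp_eq_smul_iff {γ ε : ℝ} {φ : ℕ → ℝ} {C : ℝ} (hφ : ∀ n, |φ (n + 1)| ≤ C) {z : ℂ}
    (v w : EllTwo) : rhsOp γ ε φ (v, w) = z • (v, w) ↔
      IsMode ε (fun k => ε * γ * φ (k + 1) ^ 2) z v w := by
  have h := rhsOp_apply (γ := γ) (ε := ε) hφ v w
  constructor
  · intro he k
    have h1 : (rhsOp γ ε φ (v, w)).1 k = z * v k := by rw [he]; rfl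
    have h2 : (rhsOp γ ε φ (v, w)).2 k = z * w k := by rw [he]; rfl
    rw [(h k).1, prevSite_add_nextSite, sq_abs] at h1
    rw [(h k).2, prevSite_add_nextSite, sq_abs] at h2
    push_cast at h1 h2 ⊢
    exact ⟨by linear_combination -h1, by linear_combination h2⟩
  · intro hm
    refine Prod.ext (EllTwo.ext_coe fun k => ?_) (EllTwo.ext_coe fun k => ?_)
    · have : (z • (v, w)).1 k = z * v k := rfl
      rw [this, (h k).1, prevSite_add_nextSite, (hm k).1, sq_abs]
      push_cast
      ring
    · have : (z • (v, w)).2 k = z * w k := rfl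
      have h2 := (hm k).2
      rw [this, (h k).2, prevSite_add_nextSite, sq_abs]
      push_cast at h2 ⊢
      linear_combination h2

lemma linearization_eq_smul_iff {γ ε : ℝ} (hε : ε ≠ 0) {φ : ℕ → ℝ} {l : ℂ}
    (u : EllTwo × EllTwo) :
    linearization γ ε φ u = l • u ↔ rhsOp γ ε φ u = (l * ε) • u := by
  have hεc : (ε : ℂ) ≠ 0 := by exact_mod_cast hε
  change (ε : ℂ)⁻¹ • rhsOp γ ε φ u = l • u ↔ _
  rw [inv_smul_eq_iff₀ hεc, smul_smul, mul_comm]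

lemma mem_eigenvalues_iff {γ ε : ℝ} (hε : ε ≠ 0) {φ : ℕ → ℝ} {C : ℝ}
    (hφ : ∀ n, |φ (n + 1)| ≤ C) {l : ℂ} :
    l ∈ eigenvalues γ ε φ ↔ ∃ v w : EllTwo, (∃ k, v k ≠ 0 ∨ w k ≠ 0) ∧
      IsMode ε (fun k => ε * γ * φ (k + 1) ^ 2) (l * ε) v w := by
  have hne : ∀ v w : EllTwo, (v, w) ≠ 0 ↔ ∃ k, v k ≠ 0 ∨ w k ≠ 0 := by
    intro v w
    rw [← not_iff_not]
    push Not
    constructor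
    · intro h k
      rw [Prod.mk_eq_zero] at h
      rw [h.1, h.2]
      exact ⟨rfl, rfl⟩
    · intro h
      exact Prod.ext (EllTwo.ext_coe fun k => (h k).1) (EllTwo.ext_coe fun k => (h k).2)
  constructor
  · intro h
    obtain ⟨⟨v, w⟩, hu⟩ := Module.End.HasEigenvalue.exists_hasEigenvector h
    refine ⟨v, w, (hne v w).1 hu.2, ?_⟩
    rw [← rhsOp_eq_smul_iff hφ, ← linearization_eq_smul_iff hε]
    exact hu.apply_eq_smul
  · rintro ⟨v, w, hk, hm⟩
    rw [← rhsOp_eq_smul_iff hφ, ← linearization_eq_smul_iff hε] at hm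
    exact Module.End.hasEigenvalue_of_hasEigenvector (x := (v, w))
      (Module.End.hasEigenvector_iff.2
        ⟨Module.End.mem_eigenspace_iff.2 hm, (hne v w).2 hk⟩)

/-! ## Invertibility off the real axis -/

lemma EllTwo.norm_le_mul_of_le {u v : EllTwo} {c : ℝ} (hc : 0 ≤ c) (h : ∀ k, ‖u k‖ ≤ c * ‖v k‖) :
    ‖u‖ ≤ c * ‖v‖ := by
  refine norm_le_of_tsum_sq_le u (by positivity) ?_
  rw [mul_pow, norm_sq_eq, ← tsum_mul_left]
  refine Summable.tsum_le_tsum (fun k => ?_) (summable_sq u) ((summable_sq v).mul_left _)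
  rw [← mul_pow]
  gcongr
  exact h k

lemma norm_nextSite_le (u : EllTwo) : ‖nextSite u‖ ≤ ‖u‖ := by
  have h : ‖nextSite‖ ≤ 1 := LinearMap.mkContinuous_norm_le _ zero_le_one _
  simpa using nextSite.le_of_opNorm_le h u

lemma norm_prevSite_le (u : EllTwo) : ‖prevSite u‖ ≤ ‖u‖ := by
  have h : ‖prevSite‖ ≤ 1 := LinearMap.mkContinuous_norm_le _ zero_le_one _
  simpa using prevSite.le_of_opNorm_le h u

lemma EllTwo.inner_eq (u v : EllTwo) : inner ℂ u v = ∑' k, v k * starRingEnd ℂ (u k) := by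
  rw [lp.inner_eq_tsum]
  rfl

lemma EllTwo.inner_self (u : EllTwo) : inner ℂ u u = ((‖u‖ ^ 2 : ℝ) : ℂ) := by
  rw [inner_self_eq_norm_sq_to_K, Complex.ofReal_pow]
  rfl

section

variable {γ ε : ℝ} {φ : ℕ → ℝ} {c : ℝ}

lemma offDiagOp_apply (hg : ∀ k, |ε * γ * φ (k + 1) ^ 2| ≤ c) (u : EllTwo) (k : ℕ) :
    offDiagOp γ ε φ u k = ((ε * γ * φ (k + 1) ^ 2 : ℝ) : ℂ) * u k := mulOp_apply hg u k

lemma diagOp_apply (hg : ∀ k, |ε * γ * φ (k + 1) ^ 2| ≤ c) (u : EllTwo) (k : ℕ) :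
    diagOp γ ε φ u k = ε * nbr u k + ((2 * (ε * γ * φ (k + 1) ^ 2) - 1 : ℝ) : ℂ) * u k := by
  have h1 : ∀ n, |(-1 + 2 * ε * γ * |φ (n + 1)| ^ 2)| ≤ 1 + 2 * c := fun n => by
    have e : 2 * ε * γ * |φ (n + 1)| ^ 2 = 2 * (ε * γ * φ (n + 1) ^ 2) := by rw [sq_abs]; ring
    rw [e]
    refine (abs_add_le _ _).trans ?_
    rw [abs_neg, abs_one, abs_mul, abs_two]
    linarith [hg n]
  have e : diagOp γ ε φ u k = (ε : ℂ) * (prevSite u k + u (k + 1)) +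
      mulOp (fun k => -1 + 2 * ε * γ * |φ (k + 1)| ^ 2) u k := rfl
  rw [e, mulOp_apply h1, prevSite_add_nextSite, sq_abs]
  push_cast
  ring

lemma inner_offDiagOp (hg : ∀ k, |ε * γ * φ (k + 1) ^ 2| ≤ c) (u v : EllTwo) :
    inner ℂ (offDiagOp γ ε φ u) v = inner ℂ u (offDiagOp γ ε φ v) := by
  rw [EllTwo.inner_eq, EllTwo.inner_eq]
  congr 1
  funext k
  rw [offDiagOp_apply hg, offDiagOp_apply hg, map_mul, Complex.conj_ofReal]
  ring

lemma inner_diagOp (hg : ∀ k, |ε * γ * φ (k + 1) ^ 2| ≤ c) (u v : EllTwo) :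
    inner ℂ (diagOp γ ε φ u) v = inner ℂ u (diagOp γ ε φ v) := by
  rw [EllTwo.inner_eq, EllTwo.inner_eq]
  have hsu : Summable fun k => ‖starRingEnd ℂ (u k)‖ ^ 2 := by
    simpa using summable_sq u
  have hsv := summable_sq v
  have hconj : ∀ k, starRingEnd ℂ (nbr u k) = nbr (fun k => starRingEnd ℂ (u k)) k := by
    intro k
    rcases k with _ | k <;> simp [nbr]
  set b : ℕ → ℂ := fun k =>
    ((2 * (ε * γ * φ (k + 1) ^ 2) - 1 : ℝ) : ℂ) * (v k * starRingEnd ℂ (u k)) with hb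
  have hbs : Summable b := by
    refine Summable.of_norm_bounded
      ((summable_mul_of_sq hsv hsu).norm.mul_left (2 * c + 1)) fun k => ?_
    rw [hb, norm_ofReal_mul]
    gcongr
    refine (abs_sub _ _).trans ?_
    rw [abs_one, abs_mul, abs_two]
    linarith [hg k]
  have e1 : ∀ k, v k * starRingEnd ℂ (diagOp γ ε φ u k) =
      ε * (v k * nbr (fun k => starRingEnd ℂ (u k)) k) + b k := by
    intro k
    rw [diagOp_apply hg, map_add, map_mul, map_mul, Complex.conj_ofReal, Complex.conj_ofReal,
      hconj]
    ring
  have e2 : ∀ k, diagOp γ ε φ v k * starRingEnd ℂ (u k) =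
      ε * (nbr v k * starRingEnd ℂ (u k)) + b k := by
    intro k
    rw [diagOp_apply hg]
    ring
  simp only [e1, e2]
  rw [((summable_mul_of_sq hsv (summable_sq_nbr hsu)).mul_left _).tsum_add hbs,
    ((summable_mul_of_sq (summable_sq_nbr hsv) hsu).mul_left _).tsum_add hbs, tsum_mul_left,
    tsum_mul_left, tsum_mul_nbr hsv hsu]

lemma norm_offDiagOp_le (hc : 0 ≤ c) (hg : ∀ k, |ε * γ * φ (k + 1) ^ 2| ≤ c) (u : EllTwo) :
    ‖offDiagOp γ ε φ u‖ ≤ c * ‖u‖ := by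
  refine EllTwo.norm_le_mul_of_le hc fun k => ?_
  rw [offDiagOp_apply hg, norm_ofReal_mul]
  gcongr
  exact hg k

lemma norm_diagOp_add_le (hε : 0 ≤ ε) (hc : 0 ≤ c) (hg : ∀ k, |ε * γ * φ (k + 1) ^ 2| ≤ c)
    (u : EllTwo) : ‖diagOp γ ε φ u + u‖ ≤ 2 * (ε + c) * ‖u‖ := by
  have e : diagOp γ ε φ u + u =
      (ε : ℂ) • (prevSite u + nextSite u) + (2 : ℂ) • offDiagOp γ ε φ u := by
    refine EllTwo.ext_coe fun k => ?_
    have h1 : (diagOp γ ε φ u + u) k = diagOp γ ε φ u k + u k := rfl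
    have h2 : ((ε : ℂ) • (prevSite u + nextSite u) + (2 : ℂ) • offDiagOp γ ε φ u) k =
      ε * (prevSite u k + u (k + 1)) + 2 * offDiagOp γ ε φ u k := rfl
    rw [h1, h2, diagOp_apply hg, offDiagOp_apply hg, prevSite_add_nextSite]
    push_cast
    ring
  rw [e]
  refine (norm_add_le _ _).trans ?_
  rw [norm_smul, norm_smul, Complex.norm_real, Real.norm_eq_abs, abs_of_nonneg hε,
    Complex.norm_ofNat]
  have h1 : ‖prevSite u + nextSite u‖ ≤ ‖u‖ + ‖u‖ :=
    (norm_add_le _ _).trans (add_le_add (norm_prevSite_le u) (norm_nextSite_le u))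
  have h2 := norm_offDiagOp_le hc hg u
  nlinarith [mul_le_mul_of_nonneg_left h1 hε]

lemma re_inner_diagOp_le (hε : 0 ≤ ε) (hc : 0 ≤ c) (hg : ∀ k, |ε * γ * φ (k + 1) ^ 2| ≤ c)
    (u : EllTwo) : (inner ℂ u (diagOp γ ε φ u)).re ≤ -(1 - 2 * (ε + c)) * ‖u‖ ^ 2 := by
  have e : diagOp γ ε φ u = (diagOp γ ε φ u + u) - u := by abel
  have h1 : (inner ℂ u (diagOp γ ε φ u + u)).re ≤ ‖u‖ * (2 * (ε + c) * ‖u‖) :=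
    ((Complex.re_le_norm _).trans (norm_inner_le_norm _ _)).trans
      (mul_le_mul_of_nonneg_left (norm_diagOp_add_le hε hc hg u) (norm_nonneg _))
  have h2 : (inner ℂ u u).re = ‖u‖ ^ 2 := by rw [EllTwo.inner_self, Complex.ofReal_re]
  rw [e, inner_sub_right, Complex.sub_re, h2]
  linarith

lemma im_inner_diagOp (hg : ∀ k, |ε * γ * φ (k + 1) ^ 2| ≤ c) (u : EllTwo) :
    (inner ℂ u (diagOp γ ε φ u)).im = 0 := by
  rw [← Complex.conj_eq_iff_im, inner_conj_symm, inner_diagOp hg]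

/-- For a potential that is uniformly small, every non-real number is in the resolvent set. -/
lemma bijective_rhsOp_sub_of_small (hε : 0 ≤ ε) (hε' : ε ≤ 1 / 16)
    (hg : ∀ k, |ε * γ * φ (k + 1) ^ 2| ≤ 1 / 16) {z : ℂ} (hz : z.im ≠ 0) :
    Function.Bijective (rhsOp γ ε φ - z • ContinuousLinearMap.id ℂ (EllTwo × EllTwo)) := by
  -- The product type carries the supremum norm; the form argument needs the Hilbert norm on pairs.
  set e := WithLp.prodContinuousLinearEquiv 2 ℂ EllTwo EllTwo with he
  set S := rhsOp γ ε φ - z • ContinuousLinearMap.id ℂ (EllTwo × EllTwo) with hS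
  set T : WithLp 2 (EllTwo × EllTwo) →L[ℂ] WithLp 2 (EllTwo × EllTwo) :=
    e.symm.toContinuousLinearMap ∘L S ∘L e.toContinuousLinearMap with hT
  have hz0 : 0 < ‖z‖ := norm_pos_iff.2 fun h => hz (by rw [h]; rfl)
  have hTb : Function.Bijective T := by
    refine bijective_of_coercive T (fun u => WithLp.toLp 2 (u.fst, -u.snd)) (fun u => ?_)
      (fun u => ⟨WithLp.toLp 2 (u.fst, -u.snd), ?_⟩) (c := |z.im| / (2 * ‖z‖))
      (by have := abs_pos.2 hz; positivity) (fun u => ?_)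
    · rw [← sq_eq_sq₀ (norm_nonneg _) (norm_nonneg _), WithLp.prod_norm_sq_eq_of_L2,
        WithLp.prod_norm_sq_eq_of_L2]
      simp
    · change WithLp.toLp 2 (u.fst, - -u.snd) = u
      rw [neg_neg]
      rfl
    · set v := u.fst with hv
      set w := u.snd with hw
      have hTu : inner ℂ (WithLp.toLp 2 (v, -w)) (T u) =
          inner ℂ v (diagOp γ ε φ v + offDiagOp γ ε φ w - z • v) +
            inner ℂ (-w) (-offDiagOp γ ε φ v - diagOp γ ε φ w - z • w) := rfl
      have hnorm : ‖u‖ ^ 2 = ‖v‖ ^ 2 + ‖w‖ ^ 2 := WithLp.prod_norm_sq_eq_of_L2 u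
      -- With J = diag(1, -1) the form is κ - zt. Both entries of the operator are symmetric, so κ
      -- is real, and it is at most -‖u‖²/2 because the diagonal entry is close to -1; t is real but
      -- of either sign.
      set κ := inner ℂ v (diagOp γ ε φ v) + inner ℂ w (diagOp γ ε φ w) +
        (inner ℂ v (offDiagOp γ ε φ w) + inner ℂ w (offDiagOp γ ε φ v)) with hκ
      set t : ℝ := ‖v‖ ^ 2 - ‖w‖ ^ 2 with ht
      have hB : inner ℂ (WithLp.toLp 2 (v, -w)) (T u) = κ - z * t := by
        rw [hTu]
        simp only [inner_sub_right, inner_add_right, inner_neg_left, inner_neg_right,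
          inner_smul_right, EllTwo.inner_self, hκ, ht]
        push_cast
        ring
      have hκim : κ.im = 0 := by
        have h1 := im_inner_diagOp hg v
        have h2 := im_inner_diagOp hg w
        have h3 : inner ℂ v (offDiagOp γ ε φ w) =
            starRingEnd ℂ (inner ℂ w (offDiagOp γ ε φ v)) := by
          rw [inner_conj_symm, inner_offDiagOp hg]
        rw [hκ, Complex.add_im, Complex.add_im, Complex.add_im, h1, h2, h3, Complex.conj_im]
        ring
      have hκre : κ.re ≤ -(1 / 2) * ‖u‖ ^ 2 := by
        have h1 := re_inner_diagOp_le hε (by norm_num) hg v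
        have h2 := re_inner_diagOp_le hε (by norm_num) hg w
        have h3 : ∀ x y : EllTwo, (inner ℂ x (offDiagOp γ ε φ y)).re ≤ ‖x‖ * (1 / 16 * ‖y‖) :=
          fun x y => ((Complex.re_le_norm _).trans (norm_inner_le_norm _ _)).trans
            (mul_le_mul_of_nonneg_left (norm_offDiagOp_le (by norm_num) hg y) (norm_nonneg _))
        have h4 := h3 v w
        have h5 := h3 w v
        rw [hκ, Complex.add_re, Complex.add_re, Complex.add_re, hnorm]
        have h6 : -(1 - 2 * (ε + 1 / 16)) ≤ -(3 / 4 : ℝ) := by linarith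
        have h7 := mul_le_mul_of_nonneg_right h6 (sq_nonneg ‖v‖)
        have h8 := mul_le_mul_of_nonneg_right h6 (sq_nonneg ‖w‖)
        nlinarith [sq_nonneg (‖v‖ - ‖w‖), sq_nonneg ‖v‖, sq_nonneg ‖w‖]
      -- Multiplication by the conjugate of z makes the t-term real, so the imaginary part sees κ
      -- only.
      have hle : |z.im| * |κ.re| ≤ ‖z‖ * ‖κ - z * t‖ := by
        have h1 : (starRingEnd ℂ z * (κ - z * t)).im = -(z.im * κ.re) := by
          simp [Complex.mul_im, hκim]
          ring
        have h2 := Complex.abs_im_le_norm (starRingEnd ℂ z * (κ - z * t))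
        rwa [h1, abs_neg, abs_mul, norm_mul, RCLike.norm_conj] at h2
      have hκabs : 1 / 2 * ‖u‖ ^ 2 ≤ |κ.re| := by
        have := neg_le_abs κ.re
        linarith
      rw [hB, div_mul_eq_mul_div, div_le_iff₀ (by positivity)]
      have := mul_le_mul_of_nonneg_left hκabs (abs_nonneg z.im)
      linarith
  have hSe : ⇑S = e ∘ T ∘ e.symm := by
    funext x
    simp [hT]
  rw [hSe]
  exact e.bijective.comp (hTb.comp e.symm.bijective)

end

/-- A non-real point of the spectrum is an eigenvalue, if the potential is small away from the
first site. -/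
lemma mem_eigenvalues_of_mem_spectrum {γ ε : ℝ} {φ : ℕ → ℝ} (hε : 0 < ε) (hε' : ε ≤ 1 / 16)
    (hg : ∀ k, |ε * γ * φ (k + 2) ^ 2| ≤ 1 / 16) {C : ℝ} (hφ : ∀ n, |φ (n + 1)| ≤ C) {l : ℂ}
    (hl : l ∈ spectrum ℂ (linearization γ ε φ)) (him : l.im ≠ 0) : l ∈ eigenvalues γ ε φ := by
  by_contra hnot
  have hεc : (ε : ℂ) ≠ 0 := by exact_mod_cast hε.ne'
  have hC : 0 ≤ C := (abs_nonneg _).trans (hφ 0)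
  set z := l * ε with hz
  have hzim : z.im ≠ 0 := by
    rw [hz, Complex.im_mul_ofReal]
    exact mul_ne_zero him hε.ne'
  set I := ContinuousLinearMap.id ℂ (EllTwo × EllTwo) with hI
  -- Deleting the first-site potential makes the remaining potential uniformly small. The deleted
  -- part F acts only at that site, so its range lies in the span of `e₁` and `e₂`.
  set ψ : ℕ → ℝ := fun n => if n = 1 then 0 else φ n with hψ
  have hψC : ∀ n, |ψ (n + 1)| ≤ C := by
    intro n
    simp only [hψ]
    split_ifs
    · simpa using hC
    · exact hφ n
  have hS : Function.Bijective (rhsOp γ ε ψ - z • I) := by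
    refine bijective_rhsOp_sub_of_small hε.le hε' (fun k => ?_) hzim
    rcases k with _ | k
    · simp [hψ]
    · simpa [hψ] using hg k
  set F := rhsOp γ ε φ - rhsOp γ ε ψ with hF
  set e₁ : EllTwo × EllTwo := (lp.single 2 0 1, 0) with he₁
  set e₂ : EllTwo × EllTwo := (0, lp.single 2 0 1) with he₂
  have hFu : ∀ u, F u = ((F u).1 0) • e₁ + ((F u).2 0) • e₂ := by
    rintro ⟨v, w⟩
    have h1 : ∀ k, (F (v, w)).1 (k + 1) = 0 ∧ (F (v, w)).2 (k + 1) = 0 := by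
      intro k
      have hk : ψ (k + 1 + 1) = φ (k + 1 + 1) := by simp [hψ]
      have a := rhsOp_apply (γ := γ) (ε := ε) hφ v w (k + 1)
      have b := rhsOp_apply (γ := γ) (ε := ε) hψC v w (k + 1)
      have c1 : (F (v, w)).1 (k + 1) =
        (rhsOp γ ε φ (v, w)).1 (k + 1) - (rhsOp γ ε ψ (v, w)).1 (k + 1) := rfl
      have c2 : (F (v, w)).2 (k + 1) =
        (rhsOp γ ε φ (v, w)).2 (k + 1) - (rhsOp γ ε ψ (v, w)).2 (k + 1) := rfl
      rw [c1, c2, a.1, a.2, b.1, b.2, hk]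
      exact ⟨sub_self _, sub_self _⟩
    refine Prod.ext (EllTwo.ext_coe fun k => ?_) (EllTwo.ext_coe fun k => ?_)
    · have : (((F (v, w)).1 0) • e₁ + ((F (v, w)).2 0) • e₂).1 k =
        (F (v, w)).1 0 * (lp.single 2 0 1 : EllTwo) k + (F (v, w)).2 0 * 0 := rfl
      rw [this, mul_zero, add_zero]
      rcases k with _ | k
      · rw [lp.single_apply_self, mul_one]
      · rw [lp.single_apply_ne _ _ _ (Nat.succ_ne_zero k), mul_zero, (h1 k).1]
    · have : (((F (v, w)).1 0) • e₁ + ((F (v, w)).2 0) • e₂).2 k =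
        (F (v, w)).1 0 * 0 + (F (v, w)).2 0 * (lp.single 2 0 1 : EllTwo) k := rfl
      rw [this, mul_zero, zero_add]
      rcases k with _ | k
      · rw [lp.single_apply_self, mul_one]
      · rw [lp.single_apply_ne _ _ _ (Nat.succ_ne_zero k), mul_zero, (h1 k).2]
  have hfin : FiniteDimensional ℂ (LinearMap.range F.toLinearMap) := by
    have : FiniteDimensional ℂ (Submodule.span ℂ {e₁, e₂}) :=
      FiniteDimensional.span_of_finite ℂ (Set.toFinite _)
    refine Submodule.finiteDimensional_of_le (S₂ := Submodule.span ℂ {e₁, e₂}) ?_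
    rintro _ ⟨u, rfl⟩
    rw [ContinuousLinearMap.coe_coe, hFu u]
    exact Submodule.add_mem _ (Submodule.smul_mem _ _ (Submodule.subset_span (by simp)))
      (Submodule.smul_mem _ _ (Submodule.subset_span (by simp)))
  have hsum : ∀ u, ((rhsOp γ ε ψ - z • I).toLinearMap + F.toLinearMap) u =
      rhsOp γ ε φ u - z • u := by
    intro u
    change rhsOp γ ε ψ u - z • u + (rhsOp γ ε φ u - rhsOp γ ε ψ u) = _
    abel
  have hker : ∀ u, rhsOp γ ε φ u = z • u → u = 0 := by
    rintro ⟨v, w⟩ hu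
    by_contra hne
    refine hnot (Module.End.hasEigenvalue_of_hasEigenvector (x := (v, w))
      (Module.End.hasEigenvector_iff.2 ⟨Module.End.mem_eigenspace_iff.2 ?_, hne⟩))
    exact (linearization_eq_smul_iff hε.ne' _).2 hu
  have hinj : Function.Injective ((rhsOp γ ε ψ - z • I).toLinearMap + F.toLinearMap) := by
    rw [injective_iff_map_eq_zero]
    intro u hu
    rw [hsum, sub_eq_zero] at hu
    exact hker u hu
  have hsurj := surjective_of_injective_of_finite_rank hS hinj
  refine hl ?_
  rw [spectrum.mem_resolventSet_iff, ContinuousLinearMap.isUnit_iff_bijective]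
  have hop : ∀ u, (algebraMap ℂ (EllTwo × EllTwo →L[ℂ] EllTwo × EllTwo) l -
      linearization γ ε φ) u = -(ε : ℂ)⁻¹ • (rhsOp γ ε φ u - z • u) := by
    intro u
    change l • u - (ε : ℂ)⁻¹ • rhsOp γ ε φ u = _
    have : (ε : ℂ)⁻¹ * (l * ε) = l := by field_simp
    rw [smul_sub, neg_smul, neg_smul, smul_smul, hz, this]
    abel
  constructor
  · rw [injective_iff_map_eq_zero]
    intro u hu
    rw [hop, smul_eq_zero, sub_eq_zero] at hu
    exact hker u (hu.resolve_left (neg_ne_zero.2 (inv_ne_zero hεc)))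
  · intro y
    obtain ⟨u, hu⟩ := hsurj (-(ε : ℂ) • y)
    refine ⟨u, ?_⟩
    rw [hop, ← hsum, hu, smul_smul, neg_mul_neg, inv_mul_cancel₀ hεc, one_smul]

/-! ## Eigenvalues of a localized soliton -/

/-- The profile equations are the static equation divided by φ_1. The condition 2A ≤ |φ_1| gives |η|
≤ ε/2, and g_{k+1} = g_0 ρ_{k+1}² gives the decay of the potential. -/
lemma isLocalizedProfile_of_static {γ ε A : ℝ} {φ : ℕ → ℝ} (hγ : 0 < γ) (hε : 0 < ε)
    (hε' : ε ≤ 1 / 1000) (hA : 0 < A) (hst : IsStaticSolution γ ε A φ) (hA' : 2 * A ≤ |φ 1|)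
    (hφ : ∀ n, |φ (n + 2)| ≤ 2 * ε * |φ (n + 1)|) :
    IsLocalizedProfile ε (ε * A / φ 1) (fun k => φ (k + 1) / φ 1)
      (fun k => ε * γ * φ (k + 1) ^ 2) := by
  have hφ1 : 0 < |φ 1| := by linarith
  have h1 : φ 1 ≠ 0 := abs_pos.1 hφ1
  have hη : |ε * A / φ 1| ≤ ε / 2 := by
    rw [abs_div, abs_of_pos (mul_pos hε hA), div_le_iff₀ hφ1]
    nlinarith
  have hρ : ∀ k, |φ (k + 1) / φ 1| ≤ (2 * ε) ^ k := by
    intro k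
    rw [abs_div, div_le_iff₀ hφ1]
    induction k with
    | zero => simp
    | succ k ih =>
      refine (hφ k).trans ?_
      rw [pow_succ]
      have : 2 * ε * |φ (k + 1)| ≤ 2 * ε * ((2 * ε) ^ k * |φ 1|) := by gcongr
      linarith
  have heq0 : ε * (φ 2 / φ 1) + (ε * γ * φ 1 ^ 2 - 1) = -(ε * A / φ 1) := by
    have h2 := hst.2 1 le_rfl
    rw [Nat.sub_self, hst.1] at h2
    norm_num at h2
    field_simp
    linear_combination h2
  have hg0 : |ε * γ * φ 1 ^ 2 - 1| ≤ ε := by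
    have e : ε * γ * φ 1 ^ 2 - 1 = -(ε * A / φ 1) - ε * (φ 2 / φ 1) := by linarith
    rw [e]
    refine (abs_sub _ _).trans ?_
    rw [abs_neg, abs_mul, abs_of_pos hε]
    have h3 : ε * |φ 2 / φ 1| ≤ ε * (2 * ε) ^ 1 := by gcongr; exact hρ 1
    nlinarith
  refine ⟨hε, hε', by positivity, by linarith, div_self h1, hρ, fun k => by positivity, hg0, ?_,
    heq0, ?_⟩
  · intro k
    have e : ε * γ * φ (k + 1 + 1) ^ 2 = ε * γ * φ 1 ^ 2 * (φ (k + 1 + 1) / φ 1) ^ 2 := by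
      field_simp
    have h2 : ε * γ * φ 1 ^ 2 ≤ 2 := by linarith [(abs_le.1 hg0).2]
    have h3 : (φ (k + 1 + 1) / φ 1) ^ 2 ≤ ((2 * ε) ^ (k + 1)) ^ 2 := by
      rw [← sq_abs]
      gcongr
      exact hρ (k + 1)
    rw [e]
    calc _ ≤ 2 * ((2 * ε) ^ (k + 1)) ^ 2 := by gcongr
      _ = 2 * ((2 * ε) ^ 2) ^ (k + 1) := by rw [← pow_mul, ← pow_mul, mul_comm 2 (k + 1)]
      _ = _ := by rw [pow_succ, mul_pow]; ring
  · intro k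
    have h2 := hst.2 (k + 2) (by omega)
    have e : k + 2 - 1 = k + 1 := by omega
    rw [e] at h2
    field_simp
    linear_combination h2

/-! ### Eigenvectors, the adjoint pairing and algebraic simplicity -/

lemma summable_sq_of_le_geometric {x : ℕ → ℂ} {C : ℝ} (h : ∀ k, ‖x k‖ ≤ C * (1 / 2) ^ k) :
    Summable fun k => ‖x k‖ ^ 2 := by
  refine Summable.of_nonneg_of_le (fun k => by positivity) (fun k => ?_)
    ((summable_geometric_of_lt_one (r := (1 / 4 : ℝ)) (by norm_num) (by norm_num)).mul_left (C ^ 2))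
  calc ‖x k‖ ^ 2 ≤ (C * (1 / 2) ^ k) ^ 2 := by gcongr; exact h k
    _ = C ^ 2 * ((1 / 2) ^ 2) ^ k := by rw [mul_pow, ← pow_mul, ← pow_mul, mul_comm 2 k]
    _ = _ := by norm_num

section

variable {γ ε η ζ : ℝ} {φ ρ p r : ℕ → ℝ}

lemma IsRealMode.summable_sq_fst {g : ℕ → ℝ} (R : IsRealMode ε η ρ g ζ p r) :
    Summable fun k => ‖(p k : ℂ)‖ ^ 2 :=
  summable_sq_of_le_geometric (C := 2 * |η|) fun k => by
    rw [Complex.norm_real]; exact R.p_le k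

lemma IsRealMode.summable_sq_snd {g : ℕ → ℝ} (h : IsLocalizedProfile ε η ρ g)
    (R : IsRealMode ε η ρ g ζ p r) : Summable fun k => ‖(r k : ℂ)‖ ^ 2 :=
  summable_sq_of_le_geometric (C := 2) fun k => by
    rw [Complex.norm_real]; exact R.abs_r_le h k

/-- The real mode gives an eigenvector. -/
lemma IsRealMode.exists_eigenvector {g : ℕ → ℝ} (h : IsLocalizedProfile ε η ρ g)
    (R : IsRealMode ε η ρ g ζ p r) (z : ℂ) :
    ∃ v w : EllTwo, ∀ k, v k = (p k + z * r k) / 2 ∧ w k = (p k - z * r k) / 2 := by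
  set P : EllTwo := ⟨fun k => (p k : ℂ), (memEllTwo_iff _).2 R.summable_sq_fst⟩ with hP
  set S : EllTwo := ⟨fun k => (r k : ℂ), (memEllTwo_iff _).2 (R.summable_sq_snd h)⟩ with hS
  refine ⟨(1 / 2 : ℂ) • (P + z • S), (1 / 2 : ℂ) • (P - z • S), fun k => ⟨?_, ?_⟩⟩
  · change (1 / 2 : ℂ) * (p k + z * r k) = _
    ring
  · change (1 / 2 : ℂ) * (p k - z * r k) = _
    ring

lemma IsRealMode.zeta_ne_zero {g : ℕ → ℝ} (h : IsLocalizedProfile ε η ρ g)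
    (R : IsRealMode ε η ρ g ζ p r) : ζ ≠ 0 := by
  intro h0
  have h1 := R.zeta_le
  rw [h0, zero_add, abs_mul, abs_two] at h1
  have h2 : ε * |η| ≤ 1 / 1000 * |η| := by gcongr; exact h.le
  linarith [abs_pos.2 h.eta_ne]

/-- The eigenvector is not in the range of the operator minus the eigenvalue. -/
lemma IsRealMode.coeff_eq_zero {g : ℕ → ℝ} (h : IsLocalizedProfile ε η ρ g)
    (R : IsRealMode ε η ρ g ζ p r) {z c : ℂ} (hz : z ^ 2 = ζ) {v w : EllTwo}
    (h1 : ∀ k, (ε : ℂ) * nbr v k + (2 * g k - 1) * v k + g k * w k - z * v k =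
      c * ((p k + z * r k) / 2))
    (h2 : ∀ k, (ε : ℂ) * nbr w k + (2 * g k - 1) * w k + g k * v k + z * w k =
      -(c * ((p k - z * r k) / 2))) : c = 0 := by
  have hz0 : z ≠ 0 := by
    rintro rfl
    refine R.zeta_ne_zero h ?_
    have : (ζ : ℂ) = 0 := by rw [← hz]; ring
    exact_mod_cast this
  have hps := R.summable_sq_fst
  have hrs := R.summable_sq_snd h
  set P := v + w with hP
  set Q := v - w with hQ
  have hPk : ∀ k, P k = v k + w k := fun k => rfl
  have hQk : ∀ k, Q k = v k - w k := fun k => rfl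
  have hPn : ∀ k, nbr P k = nbr v k + nbr w k := by
    intro k
    rcases k with _ | k
    · rfl
    · change v k + w k + (v (k + 2) + w (k + 2)) = _
      simp only [nbr]
      ring
  have hQn : ∀ k, nbr Q k = nbr v k - nbr w k := by
    intro k
    rcases k with _ | k
    · rfl
    · change v k - w k + (v (k + 2) - w (k + 2)) = _
      simp only [nbr]
      ring
  set a := ∑' k, (r k : ℂ) * P k with ha
  set b := ∑' k, (p k : ℂ) * Q k with hb
  set s := ∑' k, (p k : ℂ) * r k with hs
  have hsa := summable_mul_of_sq hrs (summable_sq P)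
  have hsb := summable_mul_of_sq hps (summable_sq Q)
  have hss := summable_mul_of_sq hps hrs
  have hs0 : s ≠ 0 := by
    have := R.tsum_mul_ne_zero h
    have e : s = ((∑' k, p k * r k : ℝ) : ℂ) := by
      rw [hs, Complex.ofReal_tsum]
      push_cast
      rfl
    rw [e]
    exact_mod_cast this
  have e1 : ∑' k, (ε : ℂ) * ((r k : ℂ) * nbr Q k) =
      ∑' k, (ε : ℂ) * (nbr (fun k => (r k : ℂ)) k * Q k) := by
    rw [tsum_mul_left, tsum_mul_left, tsum_mul_nbr hrs (summable_sq Q)]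
  have e2 : ∑' k, (ε : ℂ) * ((p k : ℂ) * nbr P k) =
      ∑' k, (ε : ℂ) * (nbr (fun k => (p k : ℂ)) k * P k) := by
    rw [tsum_mul_left, tsum_mul_left, tsum_mul_nbr hps (summable_sq P)]
  have sQ := (summable_mul_of_sq hrs (summable_sq_nbr (summable_sq Q))).mul_left (ε : ℂ)
  have sP := (summable_mul_of_sq hps (summable_sq_nbr (summable_sq P))).mul_left (ε : ℂ)
  have sQ' := (summable_mul_of_sq (summable_sq_nbr hrs) (summable_sq Q)).mul_left (ε : ℂ)
  have sP' := (summable_mul_of_sq (summable_sq_nbr hps) (summable_sq P)).mul_left (ε : ℂ)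
  -- The hypotheses say L₋Q - zP = cp and L₊P - zQ = czr. The first is paired with r, the second
  -- with p, and L₋, L₊ are moved across by summation by parts. Since z² = ζ, a and b drop out of
  -- the combination and 2czs = 0 remains.
  have f1 : b - z * a - c * s = 0 := by
    have hk : ∀ k, (p k : ℂ) * Q k - z * ((r k : ℂ) * P k) - c * ((p k : ℂ) * r k) =
        (ε : ℂ) * (nbr (fun k => (r k : ℂ)) k * Q k) - (ε : ℂ) * ((r k : ℂ) * nbr Q k) := by
      intro k
      have := R.eq_r_complex k
      rw [hQn, hQk, hPk]
      linear_combination (-(v k - w k)) * this + r k * h1 k - r k * h2 k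
    rw [hb, ha, hs, ← tsum_mul_left, ← tsum_mul_left, ← (hsb.tsum_sub (hsa.mul_left z)),
      ← ((hsb.sub (hsa.mul_left z)).tsum_sub (hss.mul_left c))]
    simp only [hk]
    rw [sQ'.tsum_sub sQ, e1, sub_self]
  have f2 : ζ * a - z * b - c * z * s = 0 := by
    have hk : ∀ k, ζ * ((r k : ℂ) * P k) - z * ((p k : ℂ) * Q k) - c * z * ((p k : ℂ) * r k) =
        (ε : ℂ) * (nbr (fun k => (p k : ℂ)) k * P k) - (ε : ℂ) * ((p k : ℂ) * nbr P k) := by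
      intro k
      have := R.eq_p_complex k
      rw [hPn, hQk, hPk]
      linear_combination (-(v k + w k)) * this + p k * h1 k + p k * h2 k
    rw [hb, ha, hs, ← tsum_mul_left, ← tsum_mul_left, ← tsum_mul_left,
      ← ((hsa.mul_left (ζ : ℂ)).tsum_sub (hsb.mul_left z)),
      ← (((hsa.mul_left (ζ : ℂ)).sub (hsb.mul_left z)).tsum_sub (hss.mul_left (c * z)))]
    simp only [hk]
    rw [sP'.tsum_sub sP, e2, sub_self]
  have f3 : c * (2 * z * s) = 0 := by linear_combination -z * f1 - f2 - a * hz
  exact (mul_eq_zero.1 f3).resolve_right (mul_ne_zero (mul_ne_zero two_ne_zero hz0) hs0)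

lemma eigenvalues_eq (h : IsLocalizedProfile ε η ρ fun k => ε * γ * φ (k + 1) ^ 2) {C : ℝ}
    (hφ : ∀ n, |φ (n + 1)| ≤ C)
    (R : IsRealMode ε η ρ (fun k => ε * γ * φ (k + 1) ^ 2) ζ p r) :
    eigenvalues γ ε φ = {l : ℂ | (l * ε) ^ 2 = ζ} := by
  ext l
  rw [mem_eigenvalues_iff h.pos.ne' hφ]
  constructor
  · rintro ⟨v, w, hne, hm⟩
    exact (h.mode_eq R hm v.tendsto_zero w.tendsto_zero hne).1
  · intro hl
    obtain ⟨v, w, hvw⟩ := R.exists_eigenvector h (l * ε)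
    refine ⟨v, w, ⟨0, ?_⟩, ?_⟩
    · by_contra! hcon
      have h1 := (hvw 0).1
      have h2 := (hvw 0).2
      rw [hcon.1] at h1
      rw [hcon.2] at h2
      have h3 : (l * ε) * (r 0 : ℂ) = 0 := by linear_combination h2 - h1
      rw [R.r_zero, Complex.ofReal_one, mul_one] at h3
      refine R.zeta_ne_zero h ?_
      have hl' : (l * ε) ^ 2 = (ζ : ℂ) := hl
      rw [h3] at hl'
      have : (ζ : ℂ) = 0 := by rw [← hl']; ring
      exact_mod_cast this
    · have hv : (v : ℕ → ℂ) = fun k => (p k + (l * ε) * r k) / 2 := funext fun k => (hvw k).1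
      have hw : (w : ℕ → ℂ) = fun k => (p k - (l * ε) * r k) / 2 := funext fun k => (hvw k).2
      rw [hv, hw]
      exact R.isMode hl

/-- By `mode_eq` the eigenspace is a line, and by `coeff_eq_zero` this line meets the range of the
operator minus l only in 0, so there are no Jordan chains. -/
lemma isSimpleEigenvalue (h : IsLocalizedProfile ε η ρ fun k => ε * γ * φ (k + 1) ^ 2) {C : ℝ}
    (hφ : ∀ n, |φ (n + 1)| ≤ C)
    (R : IsRealMode ε η ρ (fun k => ε * γ * φ (k + 1) ^ 2) ζ p r) {l : ℂ}
    (hl : (l * ε) ^ 2 = ζ) : IsSimpleEigenvalue γ ε φ l := by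
  have hε : (ε : ℂ) ≠ 0 := by exact_mod_cast h.pos.ne'
  set z := l * ε with hz
  have hz0 : z ≠ 0 := by
    intro h0
    refine R.zeta_ne_zero h ?_
    have : (ζ : ℂ) = 0 := by rw [← hl, h0]; ring
    exact_mod_cast this
  obtain ⟨v, w, hvw⟩ := R.exists_eigenvector h z
  have hu0 : (v, w) ≠ 0 := by
    intro h0
    rw [Prod.mk_eq_zero] at h0
    have h1 := (hvw 0).1
    have h2 := (hvw 0).2
    rw [h0.1] at h1
    rw [h0.2] at h2
    have h3 : z * (r 0 : ℂ) = 0 := by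
      have e1 : (0 : EllTwo) 0 = 0 := rfl
      rw [e1] at h1 h2
      linear_combination h2 - h1
    rw [R.r_zero, Complex.ofReal_one, mul_one] at h3
    exact hz0 h3
  set f : Module.End ℂ (EllTwo × EllTwo) := (linearization γ ε φ).toLinearMap with hf
  have hfapp : ∀ u, (f - l • (1 : Module.End ℂ (EllTwo × EllTwo))) u =
      (ε : ℂ)⁻¹ • (rhsOp γ ε φ u - z • u) := by
    intro u
    change (ε : ℂ)⁻¹ • rhsOp γ ε φ u - l • u = _
    have : (ε : ℂ)⁻¹ * (l * ε) = l := by field_simp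
    rw [smul_sub, smul_smul, hz, this]
  have hker : ∀ u, (f - l • (1 : Module.End ℂ (EllTwo × EllTwo))) u = 0 →
      u ∈ Submodule.span ℂ {(v, w)} := by
    rintro ⟨x, y⟩ hu
    rw [hfapp, smul_eq_zero, sub_eq_zero] at hu
    have hm := (rhsOp_eq_smul_iff hφ x y).1 (hu.resolve_left (inv_ne_zero hε))
    by_cases hne : ∃ k, x k ≠ 0 ∨ y k ≠ 0
    · obtain ⟨-, c, hc⟩ := h.mode_eq R hm x.tendsto_zero y.tendsto_zero hne
      refine Submodule.mem_span_singleton.2 ⟨c, ?_⟩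
      refine Prod.ext (EllTwo.ext_coe fun k => ?_) (EllTwo.ext_coe fun k => ?_)
      · change c * v k = x k
        rw [(hvw k).1, (hc k).1]
      · change c * w k = y k
        rw [(hvw k).2, (hc k).2]
    · push Not at hne
      have : (x, y) = 0 :=
        Prod.ext (EllTwo.ext_coe fun k => (hne k).1) (EllTwo.ext_coe fun k => (hne k).2)
      rw [this]
      exact Submodule.zero_mem _
  have hgen : ∀ u, (f - l • (1 : Module.End ℂ (EllTwo × EllTwo))) u ∈
      Submodule.span ℂ {(v, w)} → u ∈ Submodule.span ℂ {(v, w)} := by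
    rintro ⟨x, y⟩ hu
    obtain ⟨c, hc⟩ := Submodule.mem_span_singleton.1 hu
    have hcz : c * ε = 0 := by
      rw [hfapp, eq_inv_smul_iff₀ hε, smul_smul] at hc
      have hr := rhsOp_apply (γ := γ) (ε := ε) hφ x y
      have h1 : ∀ k, ε * c * v k = (rhsOp γ ε φ (x, y)).1 k - z * x k := fun k =>
        congrArg (fun t : EllTwo × EllTwo => t.1 k) hc
      have h2 : ∀ k, ε * c * w k = (rhsOp γ ε φ (x, y)).2 k - z * y k := fun k =>
        congrArg (fun t : EllTwo × EllTwo => t.2 k) hc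
      refine R.coeff_eq_zero h hl (v := x) (w := y) (fun k => ?_) (fun k => ?_)
      · have := h1 k
        rw [(hr k).1, prevSite_add_nextSite, (hvw k).1, sq_abs] at this
        push_cast at this ⊢
        linear_combination -this
      · have := h2 k
        rw [(hr k).2, prevSite_add_nextSite, (hvw k).2, sq_abs] at this
        push_cast at this ⊢
        linear_combination this
    have hc0 : c = 0 := (mul_eq_zero.1 hcz).resolve_right hε
    rw [hc0, zero_smul] at hc
    exact hker _ hc.symm
  have hpow : ∀ (n : ℕ) u, ((f - l • (1 : Module.End ℂ (EllTwo × EllTwo))) ^ n) u = 0 →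
      u ∈ Submodule.span ℂ {(v, w)} := by
    intro n
    induction n with
    | zero =>
      intro u hu
      rw [pow_zero, Module.End.one_apply] at hu
      rw [hu]
      exact Submodule.zero_mem _
    | succ n ih =>
      intro u hu
      rw [pow_succ, Module.End.mul_apply] at hu
      exact hgen u (ih _ hu)
  have hmax : f.maxGenEigenspace l = Submodule.span ℂ {(v, w)} := by
    refine le_antisymm (fun u hu => ?_) ?_
    · obtain ⟨n, hn⟩ := (Module.End.mem_maxGenEigenspace f l u).1 hu
      exact hpow n u hn
    · rw [Submodule.span_singleton_le_iff_mem, Module.End.mem_maxGenEigenspace]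
      refine ⟨1, ?_⟩
      rw [pow_one, hfapp, smul_eq_zero, sub_eq_zero]
      right
      rw [rhsOp_eq_smul_iff hφ]
      have hv : (v : ℕ → ℂ) = fun k => (p k + z * r k) / 2 := funext fun k => (hvw k).1
      have hw : (w : ℕ → ℂ) = fun k => (p k - z * r k) / 2 := funext fun k => (hvw k).2
      rw [hv, hw]
      exact R.isMode hl
  rw [IsSimpleEigenvalue, ← hf, hmax]
  exact finrank_span_singleton hu0

end

/-! ## Arbitrary families of solitons -/

/-- Monotonicity bounds the right neighbour by the site itself, so it is absorbed together with the
cubic term: 1 - 1/4 - 1/100 > 1/2. This gives a rate uniform in n, whereas the definition of a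
soliton only provides o(ϑ) site by site. -/
lemma abs_le_two_mul_of_static {γ ε A : ℝ} {φ : ℕ → ℝ} (hγ : 0 < γ) (hε : 0 < ε)
    (hε' : ε ≤ 1 / 100) (hst : IsStaticSolution γ ε A φ)
    (hanti : AntitoneOn (fun n => |φ n|) (Set.Ici 1)) (h2 : ε * γ * φ 2 ^ 2 ≤ 1 / 4) (n : ℕ) :
    |φ (n + 2)| ≤ 2 * ε * |φ (n + 1)| := by
  have h3 : |φ (n + 2)| ≤ |φ 2| :=
    hanti (by simp) (Set.mem_Ici.2 (by omega)) (by omega)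
  have h4 : |φ (n + 3)| ≤ |φ (n + 2)| :=
    hanti (Set.mem_Ici.2 (by omega)) (Set.mem_Ici.2 (by omega)) (by omega)
  have h5 : ε * γ * φ (n + 2) ^ 2 ≤ 1 / 4 := by
    refine le_trans ?_ h2
    have := sq_le_sq.2 h3
    gcongr
  have h6 := hst.2 (n + 2) (by omega)
  have e : n + 2 - 1 = n + 1 := by omega
  rw [e] at h6
  have h7 : φ (n + 2) = ε * (φ (n + 3) + φ (n + 1)) + ε * γ * φ (n + 2) ^ 2 * φ (n + 2) := by
    linear_combination -h6
  have h8 : |φ (n + 2)| ≤ ε * (|φ (n + 3)| + |φ (n + 1)|) + 1 / 4 * |φ (n + 2)| := by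
    conv_lhs => rw [h7]
    refine (abs_add_le _ _).trans ?_
    rw [abs_mul, abs_mul _ (φ (n + 2)), abs_of_pos hε,
      abs_of_nonneg (by positivity : 0 ≤ ε * γ * φ (n + 2) ^ 2)]
    gcongr
    exact abs_add_le _ _
  have h9 : ε * |φ (n + 3)| ≤ 1 / 100 * |φ (n + 2)| := by gcongr
  nlinarith [abs_nonneg (φ (n + 2))]

/-- The leading order of the eigenvalue. -/
def leadingEigenvalue (γ ε A : ℝ) : ℝ := ε ^ (-(1 / 4) : ℝ) * √(2 * A * √γ)

lemma leadingEigenvalue_sq {γ ε A : ℝ} (hε : 0 < ε) (hA : 0 ≤ A) :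
    leadingEigenvalue γ ε A ^ 2 * √ε = 2 * A * √γ := by
  have h1 : (ε ^ (-(1 / 4) : ℝ)) ^ 2 * √ε = 1 := by
    rw [← Real.rpow_natCast, ← Real.rpow_mul hε.le, Real.sqrt_eq_rpow, ← Real.rpow_add hε]
    norm_num
  have h2 : √(2 * A * √γ) ^ 2 = 2 * A * √γ := Real.sq_sqrt (by positivity)
  rw [leadingEigenvalue, mul_pow, h2]
  linear_combination 2 * A * √γ * h1

/-- Converts a relative error O(ε) into the stated O(ε^{1/4}); the left side is in fact O(ε^{3/4}).
-/
lemma leadingEigenvalue_le {γ ε A M : ℝ} (hε : 0 < ε) (hε' : ε ≤ 1) (hA : A ≤ M) :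
    ε * leadingEigenvalue γ ε A ≤ √(2 * M * √γ) * ε ^ (1 / 4 : ℝ) := by
  have h1 : ε * ε ^ (-(1 / 4) : ℝ) ≤ ε ^ (1 / 4 : ℝ) := by
    calc ε * ε ^ (-(1 / 4) : ℝ) = ε ^ (1 + -(1 / 4) : ℝ) := by
          rw [Real.rpow_add hε, Real.rpow_one]
      _ ≤ _ := Real.rpow_le_rpow_of_exponent_ge hε hε' (by norm_num)
  have h2 : √(2 * A * √γ) ≤ √(2 * M * √γ) := by gcongr
  rw [leadingEigenvalue, ← mul_assoc, mul_comm (√(2 * M * √γ))]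
  exact mul_le_mul h1 h2 (Real.sqrt_nonneg _) (by positivity)

/-- With y = |x|√(εγ) and η = εA/x, the leading value m₀ satisfies ε²m₀² = 2|η|y exactly, and |y² -
1| ≤ ε gives |y - 1| ≤ ε. The constant 9 adds 7 from the error in ζ and 2 from replacing y by 1. -/
lemma abs_sub_leadingEigenvalue_le {γ ε A x ζ : ℝ} (hγ : 0 < γ) (hε : 0 < ε)
    (hε' : ε ≤ 1 / 1000) (hA : 0 < A) (hx : x ≠ 0) (hx1 : |ε * γ * x ^ 2 - 1| ≤ ε)
    (hζ : |ζ + 2 * (ε * A / x)| ≤ 7 * ε * |ε * A / x|) :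
    |√|ζ| / ε - leadingEigenvalue γ ε A| ≤ 9 * ε * leadingEigenvalue γ ε A := by
  set m := √|ζ| / ε with hm
  set m₀ := leadingEigenvalue γ ε A with hm₀
  have hm₀0 : 0 < m₀ := by
    rw [hm₀, leadingEigenvalue]
    have := Real.sqrt_pos.2 hγ
    positivity
  have hm0 : 0 ≤ m := by positivity
  set y := |x| * √(ε * γ) with hy
  have hx0 : 0 < |x| := abs_pos.2 hx
  have hsε := Real.sqrt_pos.2 hε
  have hsγ := Real.sqrt_pos.2 hγ
  have hsq : √(ε * γ) = √ε * √γ := Real.sqrt_mul hε.le γ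
  have hεs : √ε * √ε = ε := Real.mul_self_sqrt hε.le
  have hy0 : 0 < y := mul_pos hx0 (Real.sqrt_pos.2 (mul_pos hε hγ))
  have hy2 : y ^ 2 = ε * γ * x ^ 2 := by
    rw [hy, mul_pow, Real.sq_sqrt (mul_pos hε hγ).le, sq_abs]
    ring
  rw [← hy2] at hx1
  have hy1 : |y - 1| ≤ ε := by
    have e : y ^ 2 - 1 = (y - 1) * (y + 1) := by ring
    rw [e, abs_mul, abs_of_pos (by linarith : 0 < y + 1)] at hx1
    nlinarith [abs_nonneg (y - 1)]
  have hyb := abs_le.1 hy1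
  have hη : |ε * A / x| * 2 * y = ε ^ 2 * m₀ ^ 2 := by
    have h1 : m₀ ^ 2 * √ε = 2 * A * √γ := leadingEigenvalue_sq hε hA.le
    rw [abs_div, abs_of_pos (mul_pos hε hA), hy, hsq]
    have h2 : ε * A / |x| * 2 * (|x| * (√ε * √γ)) = ε * √ε * (2 * A * √γ) := by
      field_simp
    rw [h2, ← h1]
    linear_combination ε * m₀ ^ 2 * hεs
  have hm2 : m ^ 2 * ε ^ 2 = |ζ| := by
    rw [hm, div_pow, Real.sq_sqrt (abs_nonneg _)]
    field_simp
  have hζ2 : |(|ζ| - 2 * |ε * A / x|)| ≤ 7 * ε * |ε * A / x| := by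
    refine le_trans ?_ hζ
    have h1 := abs_abs_sub_abs_le_abs_sub ζ (-(2 * (ε * A / x)))
    rwa [abs_neg, abs_mul 2, abs_two, sub_neg_eq_add] at h1
  have hdiff : |m ^ 2 - m₀ ^ 2| ≤ 9 * ε * m₀ ^ 2 := by
    have hT : |ε * A / x| ≤ ε ^ 2 * m₀ ^ 2 * (501 / 1000) := by
      have h0 := abs_nonneg (ε * A / x)
      nlinarith
    have e1 : ε ^ 2 * (m ^ 2 - m₀ ^ 2) =
        (|ζ| - 2 * |ε * A / x|) + 2 * |ε * A / x| * (1 - y) := by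
      linear_combination hm2 + hη
    have e2 : |ε ^ 2 * (m ^ 2 - m₀ ^ 2)| ≤ 7 * ε * |ε * A / x| + 2 * |ε * A / x| * ε := by
      rw [e1]
      refine (abs_add_le _ _).trans (add_le_add hζ2 ?_)
      rw [abs_mul, abs_mul, abs_two, abs_abs, abs_sub_comm]
      gcongr
    rw [abs_mul, abs_of_pos (by positivity : 0 < ε ^ 2)] at e2
    have e3 : 9 * ε * |ε * A / x| ≤ 9 * ε * (ε ^ 2 * m₀ ^ 2 * (501 / 1000)) := by gcongr
    have e4 : ε ^ 2 * |m ^ 2 - m₀ ^ 2| ≤ ε ^ 2 * (9 * ε * m₀ ^ 2) := by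
      have : 0 ≤ ε * (ε ^ 2 * m₀ ^ 2) := by positivity
      linarith
    exact le_of_mul_le_mul_left e4 (by positivity)
  have e : m ^ 2 - m₀ ^ 2 = (m - m₀) * (m + m₀) := by ring
  rw [e, abs_mul, abs_of_pos (by linarith : 0 < m + m₀)] at hdiff
  have h1 : |m - m₀| * m₀ ≤ 9 * ε * m₀ * m₀ := by nlinarith [abs_nonneg (m - m₀)]
  exact le_of_mul_le_mul_right h1 hm₀0

lemma setOf_sq_eq {ε : ℝ} (hε : ε ≠ 0) {ζ μ : ℂ} (hμ : (μ * ε) ^ 2 = ζ) :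
    {l : ℂ | (l * ε) ^ 2 = ζ} = {μ, -μ} := by
  have hεc : (ε : ℂ) ≠ 0 := by exact_mod_cast hε
  ext l
  change (l * ε) ^ 2 = ζ ↔ l = μ ∨ l = -μ
  rw [← hμ, sq_eq_sq_iff_eq_or_eq_neg, mul_left_inj' hεc, ← neg_mul, mul_left_inj' hεc]

lemma mem_spectrum_of_mem_eigenvalues {γ ε : ℝ} {φ : ℕ → ℝ} {l : ℂ}
    (h : l ∈ eigenvalues γ ε φ) : l ∈ spectrum ℂ (linearization γ ε φ) := by
  intro hu
  rw [spectrum.mem_resolventSet_iff, ContinuousLinearMap.isUnit_iff_bijective] at hu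
  obtain ⟨u, hu'⟩ := Module.End.HasEigenvalue.exists_hasEigenvector h
  refine hu'.2 (hu.1 ?_)
  have h1 : linearization γ ε φ u = l • u := hu'.apply_eq_smul
  rw [map_zero]
  change l • u - linearization γ ε φ u = 0
  rw [h1, sub_self]

lemma exists_eventually_le {A : ℝ → ℝ} (hA_bdd : A =O[𝓝[>] (0 : ℝ)] (fun _ => (1 : ℝ))) :
    ∃ M : ℝ, 0 < M ∧ ∀ᶠ ε in 𝓝[>] (0 : ℝ), A ε ≤ M := by
  obtain ⟨M, hM, h⟩ := hA_bdd.exists_pos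
  refine ⟨M, hM, h.bound.mono fun ε hε => ?_⟩
  rw [norm_one, mul_one] at hε
  exact (le_abs_self _).trans hε

/-- Only the asymptotics at sites 1 and 2 enter; monotonicity and the static equation supply the
remaining sites. As A√(εγ) → 0, the driving is eventually small compared with φ_1. -/
lemma IsRapidlyDecayingSoliton.eventually_localized {γ : ℝ} {A ϑ : ℝ → ℝ} {φ : ℝ → ℕ → ℝ}
    (hγ : 0 < γ) (hA_pos : ∀ᶠ ε in 𝓝[>] (0 : ℝ), 0 < A ε)
    (hA_bdd : A =O[𝓝[>] (0 : ℝ)] (fun _ => (1 : ℝ))) (h : IsRapidlyDecayingSoliton γ A ϑ φ)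
    (hϑ : ∀ ε, |ϑ ε| = 1 / √(ε * γ)) :
    ∀ᶠ ε in 𝓝[>] (0 : ℝ), 0 < A ε ∧ |φ ε 1 - ϑ ε| ≤ 1 / 2 * |ϑ ε| ∧ φ ε 1 ≠ 0 ∧
      (∀ n, |φ ε (n + 1)| ≤ |φ ε 1|) ∧
      IsLocalizedProfile ε (ε * A ε / φ ε 1) (fun k => φ ε (k + 1) / φ ε 1)
        (fun k => ε * γ * φ ε (k + 1) ^ 2) := by
  have h1 : ∀ᶠ ε in 𝓝[>] (0 : ℝ), ‖φ ε 1 - ϑ ε‖ ≤ 1 / 2 * ‖ϑ ε‖ :=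
    IsLittleO.bound h.first_site (by norm_num)
  have h2 := (h.other_sites 2 le_rfl).bound (show (0 : ℝ) < 1 / 2 by norm_num)
  have h3 := (tendsto_mul_sqrt γ hA_bdd).eventually_le_const (show (0 : ℝ) < 1 / 4 by norm_num)
  filter_upwards [h1, h2, h3, hA_pos, h.static, h.decreasing,
    eventually_pos_le (show (0 : ℝ) < 1 / 1000 by norm_num)] with ε h1 h2 h3 hA hst hanti hε
  rw [Real.norm_eq_abs, Real.norm_eq_abs] at h1 h2
  have hs := Real.sqrt_pos.2 (mul_pos hε.1 hγ)
  have hsq : √(ε * γ) ^ 2 = ε * γ := Real.sq_sqrt (mul_pos hε.1 hγ).le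
  have hφ1 : 1 / 2 * |ϑ ε| ≤ |φ ε 1| := by
    have := abs_sub_abs_le_abs_sub (ϑ ε) (φ ε 1)
    rw [abs_sub_comm] at this
    linarith
  have hA2 : 2 * A ε ≤ |φ ε 1| := by
    refine le_trans ?_ hφ1
    rw [hϑ, mul_one_div, le_div_iff₀ hs]
    linarith
  have hφ2 : ε * γ * φ ε 2 ^ 2 ≤ 1 / 4 := by
    rw [hϑ, mul_one_div, le_div_iff₀ hs] at h2
    calc ε * γ * φ ε 2 ^ 2 = (|φ ε 2| * √(ε * γ)) ^ 2 := by rw [mul_pow, hsq, sq_abs]; ring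
      _ ≤ (1 / 2) ^ 2 := by gcongr
      _ = 1 / 4 := by norm_num
  exact ⟨hA, h1, abs_pos.1 (by linarith),
    fun n => hanti (by simp) (Set.mem_Ici.2 (by omega)) (by omega),
    isLocalizedProfile_of_static hγ hε.1 hε.2 hA hst hA2
      (abs_le_two_mul_of_static hγ hε.1 (by linarith [hε.2]) hst hanti hφ2)⟩

/-- The spectral picture of the large solitons, for both signs of the leading order. -/
lemma IsRapidlyDecayingSoliton.eventually_spectrum {γ M : ℝ} {A ϑ : ℝ → ℝ} {φ : ℝ → ℕ → ℝ}
    (hγ : 0 < γ) (hA_pos : ∀ᶠ ε in 𝓝[>] (0 : ℝ), 0 < A ε)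
    (hA_bdd : A =O[𝓝[>] (0 : ℝ)] (fun _ => (1 : ℝ))) (hM : ∀ᶠ ε in 𝓝[>] (0 : ℝ), A ε ≤ M)
    (h : IsRapidlyDecayingSoliton γ A ϑ φ) (hϑ : ∀ ε, |ϑ ε| = 1 / √(ε * γ)) :
    ∀ᶠ ε in 𝓝[>] (0 : ℝ), ∃ m ζ : ℝ, 0 < ε ∧
      |m - leadingEigenvalue γ ε (A ε)| ≤ 9 * √(2 * M * √γ) * ε ^ (1 / 4 : ℝ) ∧
      0 < m ∧ (m * ε) ^ 2 = |ζ| ∧ (0 < ϑ ε → ζ < 0) ∧ (ϑ ε < 0 → 0 < ζ) ∧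
      eigenvalues γ ε (φ ε) = {l : ℂ | (l * ε) ^ 2 = ζ} ∧
      (∀ l : ℂ, (l * ε) ^ 2 = ζ → IsSimpleEigenvalue γ ε (φ ε) l) ∧
      ∀ l ∈ spectrum ℂ (linearization γ ε (φ ε)), l.im ≠ 0 → l ∈ eigenvalues γ ε (φ ε) := by
  filter_upwards [h.eventually_localized hγ hA_pos hA_bdd hϑ, hM]
    with ε ⟨hA, h1, hφ1, hbd, hprof⟩ hAM
  have hε := hprof.pos
  obtain ⟨ζ, p, r, R⟩ := hprof.exists_realMode
  have hζ0 := R.zeta_ne_zero hprof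
  have hζ := R.zeta_le
  set η := ε * A ε / φ ε 1 with hη
  have hsmall : 7 * ε * |η| < 2 * |η| := by
    have := abs_pos.2 hprof.eta_ne
    nlinarith [hprof.le]
  have hζ2 := abs_lt.1 (hζ.trans_lt hsmall)
  refine ⟨√|ζ| / ε, ζ, hε, ?_, by have := abs_pos.2 hζ0; positivity, ?_, ?_, ?_,
    eigenvalues_eq hprof hbd R, fun l hl => isSimpleEigenvalue hprof hbd R hl, ?_⟩
  · have h2 := abs_sub_leadingEigenvalue_le hγ hε hprof.le hA hφ1 hprof.g_zero hζ
    have h3 := leadingEigenvalue_le (γ := γ) hε (hprof.le.trans (by norm_num)) hAM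
    linarith
  · rw [div_mul_cancel₀ _ hε.ne', Real.sq_sqrt (abs_nonneg _)]
  · intro hpos
    rw [abs_of_pos hpos] at h1
    have hφpos : 0 < φ ε 1 := by linarith [(abs_le.1 h1).1]
    have hηpos : 0 < η := div_pos (mul_pos hε hA) hφpos
    rw [abs_of_pos hηpos] at hζ2
    linarith
  · intro hneg
    rw [abs_of_neg hneg] at h1
    have hφneg : φ ε 1 < 0 := by linarith [(abs_le.1 h1).2]
    have hηneg : η < 0 := div_neg_of_pos_of_neg (mul_pos hε hA) hφneg
    rw [abs_of_neg hηneg] at hζ2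
    linarith
  · intro l hl him
    exact mem_eigenvalues_of_mem_spectrum hε (hprof.le.trans (by norm_num))
      (fun k => (hprof.g_succ_le k).trans (hprof.le.trans (by norm_num))) hbd hl him

/-! ### Spectra of the three solitons -/

lemma IsPhi2.eventually_stable {γ : ℝ} {A : ℝ → ℝ} {φ : ℝ → ℕ → ℝ}
    (hγ : 0 < γ) (hA_pos : ∀ᶠ ε in 𝓝[>] (0 : ℝ), 0 < A ε)
    (hA_bdd : A =O[𝓝[>] (0 : ℝ)] (fun _ => (1 : ℝ))) (h : IsPhi2 γ A φ) :
    ∀ᶠ ε in 𝓝[>] (0 : ℝ), IsLinearlyStable γ ε (φ ε) ∧ eigenvalues γ ε (φ ε) = ∅ := by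
  obtain ⟨M, hM, hAM⟩ := exists_eventually_le hA_bdd
  have h1 : ∀ᶠ ε in 𝓝[>] (0 : ℝ), ‖φ ε 1 - ε * A ε‖ ≤ 1 * ‖ε * A ε‖ :=
    IsLittleO.bound h.first_site one_pos
  filter_upwards [h1, hA_pos, hAM, h.static, h.decreasing,
    eventually_pos_le (show (0 : ℝ) < 1 / 100 by norm_num),
    eventually_pos_le (show (0 : ℝ) < 1 / (96 * γ * M ^ 2) by positivity)]
    with ε h1 hA hAM hst hanti hε hε2
  have hε0 := hε.1
  have hφ1 : |φ ε 1| ≤ 2 * ε * M := by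
    rw [Real.norm_eq_abs, Real.norm_eq_abs, abs_of_pos (mul_pos hε0 hA)] at h1
    have h2 := abs_sub_abs_le_abs_sub (φ ε 1) (ε * A ε)
    rw [abs_of_pos (mul_pos hε0 hA)] at h2
    have h3 : ε * A ε ≤ ε * M := by gcongr
    linarith
  have hbd : ∀ n, |φ ε (n + 1)| ≤ |φ ε 1| :=
    fun n => hanti (by simp) (Set.mem_Ici.2 (by omega)) (by omega)
  -- From |φ_1| ≤ 2εM the left side is at most 4γM²ε³. The threshold 1/(96γM²), with 96 = 4 · 24,
  -- brings it below the constant needed in `IsMode.eq_zero_of_weak`.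
  have hg0 : ε * γ * φ ε 1 ^ 2 ≤ ε / 24 := by
    have h2 : φ ε 1 ^ 2 ≤ (2 * ε * M) ^ 2 := by rw [← sq_abs]; gcongr
    have h3 : ε * (96 * γ * M ^ 2) ≤ 1 := (le_div_iff₀ (by positivity)).1 hε2.2
    have h4 : γ * (2 * ε * M) ^ 2 ≤ 1 / 24 := by
      have h5 : ε * (ε * (96 * γ * M ^ 2)) ≤ ε * 1 := by gcongr
      nlinarith
    calc ε * γ * φ ε 1 ^ 2 ≤ ε * γ * (2 * ε * M) ^ 2 := by gcongr
      _ = ε * (γ * (2 * ε * M) ^ 2) := by ring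
      _ ≤ ε * (1 / 24) := by gcongr
      _ = _ := by ring
  have hg2 : ε * γ * φ ε 2 ^ 2 ≤ 1 / 4 := by
    have h2 : φ ε 2 ^ 2 ≤ φ ε 1 ^ 2 := sq_le_sq.2 (hbd 1)
    have h3 : ε * γ * φ ε 2 ^ 2 ≤ ε * γ * φ ε 1 ^ 2 := by gcongr
    linarith [hε.2]
  have hratio := abs_le_two_mul_of_static hγ hε0 hε.2 hst hanti hg2
  have hgeo : ∀ k, φ ε (k + 1) ^ 2 ≤ φ ε 1 ^ 2 * (1 / 2) ^ k := by
    intro k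
    induction k with
    | zero => simp
    | succ k ih =>
      have h2 : φ ε (k + 2) ^ 2 ≤ (2 * ε * |φ ε (k + 1)|) ^ 2 := by
        rw [← sq_abs]
        gcongr
        exact hratio k
      have h3 : (2 * ε) ^ 2 ≤ 1 / 2 := by nlinarith [hε.2]
      rw [mul_pow, sq_abs] at h2
      rw [pow_succ]
      calc φ ε (k + 1 + 1) ^ 2 ≤ (2 * ε) ^ 2 * φ ε (k + 1) ^ 2 := h2
        _ ≤ 1 / 2 * (φ ε 1 ^ 2 * (1 / 2) ^ k) := by gcongr
        _ = _ := by ring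
  have hg : ∀ k, |ε * γ * φ ε (k + 1) ^ 2| ≤ ε / 24 * (1 / 2) ^ k := by
    intro k
    rw [abs_of_nonneg (by positivity)]
    calc ε * γ * φ ε (k + 1) ^ 2 ≤ ε * γ * (φ ε 1 ^ 2 * (1 / 2) ^ k) := by
          gcongr
          exact hgeo k
      _ = ε * γ * φ ε 1 ^ 2 * (1 / 2) ^ k := by ring
      _ ≤ _ := by gcongr
  have hempty : eigenvalues γ ε (φ ε) = ∅ := by
    rw [Set.eq_empty_iff_forall_notMem]
    intro l hl
    obtain ⟨v, w, ⟨k, hk⟩, hm⟩ := (mem_eigenvalues_iff hε0.ne' hbd).1 hl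
    have := hm.eq_zero_of_weak hε0 hg v.tendsto_zero w.tendsto_zero k
    exact hk.elim (· this.1) (· this.2)
  refine ⟨fun l hl => ?_, hempty⟩
  by_contra him
  have := mem_eigenvalues_of_mem_spectrum hε0 (by linarith [hε.2]) (fun k => ?_) hbd hl him
  · rw [hempty] at this
    exact this
  · refine (hg (k + 1)).trans ?_
    have : (1 / 2 : ℝ) ^ (k + 1) ≤ 1 := pow_le_one₀ (by norm_num) (by norm_num)
    nlinarith [hε.2]

lemma IsPhi1.exists_eigenvalue {γ : ℝ} {A : ℝ → ℝ} {φ : ℝ → ℕ → ℝ}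
    (hγ : 0 < γ) (hA_pos : ∀ᶠ ε in 𝓝[>] (0 : ℝ), 0 < A ε)
    (hA_bdd : A =O[𝓝[>] (0 : ℝ)] (fun _ => (1 : ℝ))) (h : IsPhi1 γ A φ) :
    ∃ μ : ℝ → ℝ,
      (fun ε => μ ε - leadingEigenvalue γ ε (A ε))
        =O[𝓝[>] (0 : ℝ)] (fun ε => ε ^ (1 / 4 : ℝ)) ∧
      ∀ᶠ ε in 𝓝[>] (0 : ℝ),
        ¬ IsLinearlyStable γ ε (φ ε) ∧ 0 < μ ε ∧
        eigenvalues γ ε (φ ε) = {(μ ε : ℂ) * Complex.I, -((μ ε : ℂ) * Complex.I)} ∧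
        IsSimpleEigenvalue γ ε (φ ε) ((μ ε : ℂ) * Complex.I) ∧
        IsSimpleEigenvalue γ ε (φ ε) (-((μ ε : ℂ) * Complex.I)) := by
  obtain ⟨M, -, hM⟩ := exists_eventually_le hA_bdd
  obtain ⟨μ, hμ⟩ := (h.eventually_spectrum hγ hA_pos hA_bdd hM
    (fun ε => abs_of_nonneg (by positivity))).choice
  refine ⟨μ, IsBigO.of_bound (9 * √(2 * M * √γ)) ?_, ?_⟩
  · filter_upwards [hμ] with ε ⟨ζ, hε, hle, _⟩
    rwa [Real.norm_eq_abs, Real.norm_of_nonneg (by positivity)]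
  · filter_upwards [hμ] with ε ⟨ζ, hε, _, hm, hmζ, hneg, _, heig, hsimple, _⟩
    have hζ : ζ < 0 := hneg (by have := mul_pos hε hγ; positivity)
    rw [abs_of_neg hζ] at hmζ
    have hsq : ((μ ε : ℂ) * Complex.I * ε) ^ 2 = ζ := by
      have h1 : ((μ ε : ℂ) * ε) ^ 2 = -ζ := by exact_mod_cast hmζ
      linear_combination ((μ ε : ℂ) * ε) ^ 2 * Complex.I_sq - h1
    have hsq' : (-((μ ε : ℂ) * Complex.I) * ε) ^ 2 = ζ := by rw [← hsq]; ring
    have heig' := heig.trans (setOf_sq_eq hε.ne' hsq)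
    refine ⟨fun hstab => ?_, hm, heig', hsimple _ hsq, hsimple _ hsq'⟩
    have h1 := hstab _ (mem_spectrum_of_mem_eigenvalues
      (by rw [heig']; exact Set.mem_insert _ _ : (μ ε : ℂ) * Complex.I ∈ eigenvalues γ ε (φ ε)))
    simp only [Complex.mul_im, Complex.I_im, Complex.I_re, Complex.ofReal_re, mul_one, mul_zero,
      add_zero] at h1
    exact hm.ne' h1

lemma IsPhi3.exists_eigenvalue {γ : ℝ} {A : ℝ → ℝ} {φ : ℝ → ℕ → ℝ}
    (hγ : 0 < γ) (hA_pos : ∀ᶠ ε in 𝓝[>] (0 : ℝ), 0 < A ε)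
    (hA_bdd : A =O[𝓝[>] (0 : ℝ)] (fun _ => (1 : ℝ))) (h : IsPhi3 γ A φ) :
    ∃ μ : ℝ → ℝ,
      (fun ε => μ ε - leadingEigenvalue γ ε (A ε))
        =O[𝓝[>] (0 : ℝ)] (fun ε => ε ^ (1 / 4 : ℝ)) ∧
      ∀ᶠ ε in 𝓝[>] (0 : ℝ),
        IsLinearlyStable γ ε (φ ε) ∧ 0 < μ ε ∧
        eigenvalues γ ε (φ ε) = {(μ ε : ℂ), -(μ ε : ℂ)} ∧
        IsSimpleEigenvalue γ ε (φ ε) (μ ε : ℂ) ∧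
        IsSimpleEigenvalue γ ε (φ ε) (-(μ ε : ℂ)) := by
  obtain ⟨M, -, hM⟩ := exists_eventually_le hA_bdd
  obtain ⟨μ, hμ⟩ := (h.eventually_spectrum hγ hA_pos hA_bdd hM
    (fun ε => by rw [abs_neg, abs_of_nonneg (by positivity)])).choice
  refine ⟨μ, IsBigO.of_bound (9 * √(2 * M * √γ)) ?_, ?_⟩
  · filter_upwards [hμ] with ε ⟨ζ, hε, hle, _⟩
    rwa [Real.norm_eq_abs, Real.norm_of_nonneg (by positivity)]
  · filter_upwards [hμ] with ε ⟨ζ, hε, _, hm, hmζ, _, hpos, heig, hsimple, hspec⟩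
    have hζ : 0 < ζ := hpos (by
      have := mul_pos hε hγ
      exact neg_neg_of_pos (by positivity))
    rw [abs_of_pos hζ] at hmζ
    have hsq : ((μ ε : ℂ) * ε) ^ 2 = ζ := by exact_mod_cast hmζ
    have hsq' : (-(μ ε : ℂ) * ε) ^ 2 = ζ := by rw [← hsq]; ring
    have heig' := heig.trans (setOf_sq_eq hε.ne' hsq)
    refine ⟨fun l hl => ?_, hm, heig', hsimple _ hsq, hsimple _ hsq'⟩
    by_contra him
    have hl' := hspec l hl him
    rw [heig'] at hl'
    rcases hl' with rfl | hl'
    · exact him (Complex.ofReal_im _)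
    · rw [Set.mem_singleton_iff.1 hl'] at him
      simp at him

end BoundaryDrivenDNLS

end

theorem mainTheorem3 (γ : ℝ) (hγ : 0 < γ) (A : ℝ → ℝ)
    (hA_pos : ∀ᶠ ε in 𝓝[>] (0 : ℝ), 0 < A ε)
    (hA_bdd : A =O[𝓝[>] (0 : ℝ)] (fun _ => (1 : ℝ))) :
    -- the three solitons exist
    (∃ Φ, BoundaryDrivenDNLS.IsPhi1 γ A Φ) ∧
    (∃ Φ, BoundaryDrivenDNLS.IsPhi2 γ A Φ) ∧
    (∃ Φ, BoundaryDrivenDNLS.IsPhi3 γ A Φ) ∧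
    -- the first soliton is unstable, with a single (up to sign) imaginary eigenvalue
    (∀ Φ, BoundaryDrivenDNLS.IsPhi1 γ A Φ →
      ∃ μ : ℝ → ℝ,
        (fun ε => μ ε - ε ^ (-(1 / 4) : ℝ) * √(2 * A ε * √γ))
          =O[𝓝[>] (0 : ℝ)] (fun ε => ε ^ (1 / 4 : ℝ)) ∧
        ∀ᶠ ε in 𝓝[>] (0 : ℝ),
          ¬ BoundaryDrivenDNLS.IsLinearlyStable γ ε (Φ ε) ∧
          0 < μ ε ∧
          BoundaryDrivenDNLS.eigenvalues γ ε (Φ ε) =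
            {(μ ε : ℂ) * Complex.I, -((μ ε : ℂ) * Complex.I)} ∧
          BoundaryDrivenDNLS.IsSimpleEigenvalue γ ε (Φ ε) ((μ ε : ℂ) * Complex.I) ∧
          BoundaryDrivenDNLS.IsSimpleEigenvalue γ ε (Φ ε) (-((μ ε : ℂ) * Complex.I))) ∧
    -- the second soliton is stable and has no eigenvalues
    (∀ Φ, BoundaryDrivenDNLS.IsPhi2 γ A Φ →
      ∀ᶠ ε in 𝓝[>] (0 : ℝ),
        BoundaryDrivenDNLS.IsLinearlyStable γ ε (Φ ε) ∧
        BoundaryDrivenDNLS.eigenvalues γ ε (Φ ε) = ∅) ∧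
    -- the third soliton is stable, with a single (up to sign) real eigenvalue
    (∀ Φ, BoundaryDrivenDNLS.IsPhi3 γ A Φ →
      ∃ μ : ℝ → ℝ,
        (fun ε => μ ε - ε ^ (-(1 / 4) : ℝ) * √(2 * A ε * √γ))
          =O[𝓝[>] (0 : ℝ)] (fun ε => ε ^ (1 / 4 : ℝ)) ∧
        ∀ᶠ ε in 𝓝[>] (0 : ℝ),
          BoundaryDrivenDNLS.IsLinearlyStable γ ε (Φ ε) ∧
          0 < μ ε ∧
          BoundaryDrivenDNLS.eigenvalues γ ε (Φ ε) = {(μ ε : ℂ), -(μ ε : ℂ)} ∧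
          BoundaryDrivenDNLS.IsSimpleEigenvalue γ ε (Φ ε) (μ ε : ℂ) ∧
          BoundaryDrivenDNLS.IsSimpleEigenvalue γ ε (Φ ε) (-(μ ε : ℂ))) := by
  refine ⟨?_, BoundaryDrivenDNLS.exists_small_soliton hγ hA_pos hA_bdd, ?_,
    fun Φ hΦ => BoundaryDrivenDNLS.IsPhi1.exists_eigenvalue hγ hA_pos hA_bdd hΦ,
    fun Φ hΦ => BoundaryDrivenDNLS.IsPhi2.eventually_stable hγ hA_pos hA_bdd hΦ,
    fun Φ hΦ => BoundaryDrivenDNLS.IsPhi3.exists_eigenvalue hγ hA_pos hA_bdd hΦ⟩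
  · have := BoundaryDrivenDNLS.exists_large_soliton hγ hA_pos hA_bdd (Or.inl rfl)
    simp only [one_mul] at this
    exact this
  · have := BoundaryDrivenDNLS.exists_large_soliton hγ hA_pos hA_bdd (Or.inr rfl)
    simp only [neg_mul, one_mul] at this
    exact this
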